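/- Let $L\ge 4$, let $i_k\in\{1,\dots,L\}\setminus\{k\}$ for $k=4,\dots,L$, and let $s_{ab}=s_{ba}\in\mathbb C$ ($1\le a<b\le L$). Write $z_{ab}=z_a-z_b$, and let $dz\,d\bar z=2i\,d(\mathrm{Re}\,z)\,d(\mathrm{Im}\,z)$. For $z_3\in\mathbb C\setminus\{0,1\}$, with $z_1=0$, $z_2=1$, the closed Selberg integral is $$\mathscr S[i_4,\dots,i_L](z_3)=\frac{1}{(-2\pi i)^{L-3}}\int_{(\mathbb P^1_{\mathbb C})^{L-3}}\frac{\bar z_3}{\bar z_L}\prod_{1\le a<b\le L}|z_{ab}|^{2s_{ab}}\prod_{k=4}^L\frac{dz_k\,d\bar z_k}{z_{k i_k}\,\bar z_{k(k-1)}} .$$ Put $$s_{\max}=\sum_{1\le a<b\le L,\ a,b\ne2}s_{ab},\qquad s_{145\cdots L}=\sum_{k=4}^Ls_{1k}+\sum_{4\le a<b\le L}s_{ab}.$$ Let $\lim_{s_{3\bullet}\to0}$ denote the limit in which all $s_{3j}$ ($1\le j\le L$, $j\ne3$) tend jointly to $0$ through values with positive real part, the other exponents being fixed. Assume that $\mathrm{Re}(s_{ab})>0$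 for all $a<b$ with $b\ge4$ and $a\ne3$, and that for all sufficiently small $s_{3j}$ with positive real part the integral $\mathscr S[i_4,\dots,i_L](z_3)$ converges absolutely for every $z_3\in\mathbb C\setminus\{0,1\}$. In the iterated limits below, the inner limit exists for all sufficiently small $s_{3j}$ with positive real part. (i) Suppose $i_k\ne2$ for all $k$. With $w_1=0$, $w_3=1$, the integral $$\frac{1}{(-2\pi i)^{L-3}}\int_{(\mathbb P^1_{\mathbb C})^{L-3}}\frac1{\bar w_L}\prod_{4\le a<b\le L}|w_{ab}|^{2s_{ab}}\prod_{k=4}^L|w_k|^{2s_{1k}}\frac{dw_k\,d\bar w_k}{w_{k i_k}\,\bar w_{k(k-1)}}$$ converges absolutely if and only if $i_4\ne3$, and if $i_4\neq 3$ it is equal to $\lim_{s_{3\bullet}\to0}\lim_{z_3\to0}|z_3|^{-2s_{\max}}\mathscr S[i_4,\dots,i_L](z_3)$. If $i_k=2$ for some $k$, then $\lim_{s_{3\bullet}\to0}\lim_{z_3\to0}|z_3|^{-2s_{\max}}\mathscr S[i_4,\dots,i_L](z_3)=0$. If $i_k\ne2$ and $i_k\ne3$ for all $k$, then with $y_1=0$,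 $y_4=1$, $$\lim_{s_{3\bullet}\to0}\lim_{z_3\to0}|z_3|^{-2s_{\max}}\mathscr S[i_4,\dots,i_L](z_3)=\frac1{s_{145\cdots L}}\frac{1}{(-2\pi i)^{L-4}}\int_{(\mathbb P^1_{\mathbb C})^{L-4}}\frac{1}{(1-y_{i_4})\bar y_L}\prod_{5\le a<b\le L}|y_{ab}|^{2s_{ab}}\prod_{k=5}^L|y_k|^{2s_{1k}}|1-y_k|^{2s_{4k}}\frac{dy_k\,d\bar y_k}{y_{k i_k}\,\bar y_{k(k-1)}},$$ where the integral on the right converges absolutely (for $L=4$ it is the value $1$ of its integrand at a point). (ii) With $z_1=0$ and $z_2=z_3=1$ on the right-hand side, $$\lim_{s_{3\bullet}\to0}\lim_{z_3\to1}|1-z_3|^{-2s_{23}}\mathscr S[i_4,\dots,i_L](z_3)=\frac{1}{(-2\pi i)^{L-3}}\int_{(\mathbb P^1_{\mathbb C})^{L-3}}\frac1{\bar z_L}\prod_{4\le a<b\le L}|z_{ab}|^{2s_{ab}}\prod_{k=4}^L|z_k|^{2s_{1k}}|1-z_k|^{2s_{2k}}\frac{dz_k\,d\bar z_k}{z_{k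 i_k}\,\bar z_{k(k-1)}},$$ where the integral on the right converges absolutely. -/

import Mathlib

open MeasureTheory Filter Topology Complex
open scoped ComplexConjugate

noncomputable section

/-- `|x|^{2a}` for complex `x` and a complex exponent `a`. -/
def absPow (x a : ℂ) : ℂ := ((‖x‖ : ℝ) : ℂ) ^ (2 * a)

/-- The points `z_1, z_2, …`, labelled by natural numbers: those with label in `{a, …, L}` are the
integration variables `x`, all others are the fixed points given by `p`. -/
def points (a L : ℕ) (p : ℕ → ℂ) (x : Finset.Icc a L → ℂ) : ℕ → ℂ :=
  fun k => if h : k ∈ Finset.Icc a L then x ⟨k, h⟩ else p k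

/-- `∫ f ∏_{k=a}^{L} dz_k dz̄_k` over `(ℙ¹_ℂ)^{L-a+1}`, with `dz dz̄ = 2i d(Re z) d(Im z)`.
The points at infinity form a null set, so the domain is `ℂ^{L-a+1}` with Lebesgue measure. -/
def formIntegral (a L : ℕ) (f : (Finset.Icc a L → ℂ) → ℂ) : ℂ :=
  (2 * I) ^ (Finset.Icc a L).card * ∫ x, f x

/-- The fixed points `z_1 = 0`, `z_2 = 1` and `z_3`. -/
def selbergBase (z₃ : ℂ) : ℕ → ℂ := fun k => if k = 2 then 1 else if k = 3 then z₃ else 0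

/-- The integrand of the closed Selberg integral with indices `i_4, …, i_L`. Of the exponents
`s_{ab} = s_{ba}` only the values `s a b` with `1 ≤ a < b ≤ L` are used. -/
def selbergIntegrand (L : ℕ) (i : ℕ → ℕ) (s : ℕ → ℕ → ℂ) (z₃ : ℂ)
    (x : Finset.Icc 4 L → ℂ) : ℂ :=
  let z := points 4 L (selbergBase z₃) x
  conj z₃ / conj (z L) *
    (∏ a ∈ Finset.Icc 1 L, ∏ b ∈ Finset.Ioc a L, absPow (z a - z b) (s a b)) *
    ∏ k ∈ Finset.Icc 4 L, 1 / ((z k - z (i k)) * conj (z k - z (k - 1)))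

/-- The closed Selberg integral `𝒮[i_4, …, i_L](z₃)`. -/
def closedSelberg (L : ℕ) (i : ℕ → ℕ) (s : ℕ → ℕ → ℂ) (z₃ : ℂ) : ℂ :=
  1 / (-2 * Real.pi * I) ^ (L - 3) * formIntegral 4 L (selbergIntegrand L i s z₃)

/-- `s_max`, the sum of all `s_{ab}` with `1 ≤ a < b ≤ L` and `a, b ≠ 2`. -/
def sMax (L : ℕ) (s : ℕ → ℕ → ℂ) : ℂ :=
  ∑ a ∈ (Finset.Icc 1 L).erase 2, ∑ b ∈ (Finset.Ioc a L).erase 2, s a b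

/-- `s_{145⋯L} = ∑_{k=4}^{L} s_{1k} + ∑_{4 ≤ a < b ≤ L} s_{ab}`. -/
def sOneFourToL (L : ℕ) (s : ℕ → ℕ → ℂ) : ℂ :=
  ∑ k ∈ Finset.Icc 4 L, s 1 k + ∑ a ∈ Finset.Icc 4 L, ∑ b ∈ Finset.Ioc a L, s a b

/-- The integrand of the `(L-3)`-fold integral in the limit `z₃ → 0`; here `w_1 = 0`, `w_3 = 1`. -/
def zeroLimitIntegrand (L : ℕ) (i : ℕ → ℕ) (s : ℕ → ℕ → ℂ) (x : Finset.Icc 4 L → ℂ) : ℂ :=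
  let w := points 4 L (fun k => if k = 3 then 1 else 0) x
  1 / conj (w L) *
    (∏ a ∈ Finset.Icc 4 L, ∏ b ∈ Finset.Ioc a L, absPow (w a - w b) (s a b)) *
    ∏ k ∈ Finset.Icc 4 L,
      absPow (w k) (s 1 k) * (1 / ((w k - w (i k)) * conj (w k - w (k - 1))))

/-- The integrand of the `(L-4)`-fold integral in the limit `z₃ → 0`; here `y_1 = 0`, `y_4 = 1`. -/
def zeroLimitReducedIntegrand (L : ℕ) (i : ℕ → ℕ) (s : ℕ → ℕ → ℂ)
    (x : Finset.Icc 5 L → ℂ) : ℂ :=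
  let y := points 5 L (fun k => if k = 4 then 1 else 0) x
  1 / ((1 - y (i 4)) * conj (y L)) *
    (∏ a ∈ Finset.Icc 5 L, ∏ b ∈ Finset.Ioc a L, absPow (y a - y b) (s a b)) *
    ∏ k ∈ Finset.Icc 5 L,
      absPow (y k) (s 1 k) * absPow (1 - y k) (s 4 k) *
        (1 / ((y k - y (i k)) * conj (y k - y (k - 1))))

/-- The integrand of the `(L-3)`-fold integral in the limit `z₃ → 1`; here `z_1 = 0` and
`z_2 = z_3 = 1`. -/
def oneLimitIntegrand (L : ℕ) (i : ℕ → ℕ) (s : ℕ → ℕ → ℂ) (x : Finset.Icc 4 L → ℂ) : ℂ :=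
  let z := points 4 L (selbergBase 1) x
  1 / conj (z L) *
    (∏ a ∈ Finset.Icc 4 L, ∏ b ∈ Finset.Ioc a L, absPow (z a - z b) (s a b)) *
    ∏ k ∈ Finset.Icc 4 L,
      absPow (z k) (s 1 k) * absPow (1 - z k) (s 2 k) *
        (1 / ((z k - z (i k)) * conj (z k - z (k - 1))))

/-- The exponents obtained from `s` by giving each `s_{3j} = s_{j3}` the value `t j`. -/
def withThree (s : ℕ → ℕ → ℂ) (t : ℕ → ℂ) : ℕ → ℕ → ℂ :=
  fun a b => if a = 3 then t b else if b = 3 then t a else s a b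

/-- The limit `s_{3•} → 0`: all `t j = s_{3j}`, `j ∈ {1, …, L}`, `j ≠ 3`, tend to `0` jointly
through values with positive real part. -/
def physicalFilter (L : ℕ) : Filter (ℕ → ℂ) :=
  𝓝[{t | ∀ j ∈ Finset.Icc 1 L, j ≠ 3 → 0 < (t j).re}] 0

/-- `lim_{s_{3•} → 0} lim_{z → z₀} G t z = c`, where `t` stands for `s_{3•}`: the inner limit exists
for all `t` close to `0`, and as a function of `t` it tends to `c`. -/
def HasPhysicalLimit (L : ℕ) (z₀ : ℂ) (G : (ℕ → ℂ) → ℂ → ℂ) (c : ℂ) : Prop :=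
  ∃ ℓ : (ℕ → ℂ) → ℂ,
    (∀ᶠ t in physicalFilter L, Tendsto (G t) (𝓝[≠] z₀) (𝓝 (ℓ t))) ∧
      Tendsto ℓ (physicalFilter L) (𝓝 c)

end

set_option linter.unusedSectionVars false

/-! The modulus of every integrand is a product `coll e g` of powers of the differences `‖u a - u
b‖` and of one-variable weights, so convergence and uniformity are matters of power counting. When
the variables in a set `K` approach a common point, the integral over them scales with the exponent
`clusterDeg`. Two facts carry the analysis. Convergence forces all cluster degrees at a point to be
positive (`clusterDeg_pos_of_integrable`). Conversely, if base points `0` and `ε` merge, each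
integral with `ε ≠ 0` small converges, and all clusters at the merged point have positive degree,
then the integrals stay bounded as `ε → 0` (`coll_uniform_bound`). For the latter, an empty dyadic
shell separates near from far variables, the integral factors up to constants, and the near part is
rescaled by `ε` and controlled by the growth of integrals over large polydiscs (`coll_growth`).

Inner limits: for `z₃ → 1` the base points `1` and `z₃` merge. For `z₃ → 0` the substitution `z = z₃
w` extracts `|z₃|^{2 s_max}` and sends the base point `1` to `1 / z₃`; in the coordinate `u = 1 / w`
the points `0` and `z₃` merge. Uniform integrability comes from moving a single exponent `s_{3k}`:
halving it near `1`, or doubling it near infinity, writes the kernel as a small factor times another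
kernel with bounded integrals. If some `i_k = 2`, a positive power of `|z₃|` survives and the limit
vanishes.

Outer limit: dominated convergence, with a majorant produced by lowering exponents
(`coll_lower_exponents`). This needs positive cluster degrees at `s_{3•} = 0`: each variable
contributes `2` from the measure and loses at most one holomorphic and one antiholomorphic pole, and
the exponents with positive real part supply strictness. For `z₃ → 0` and `i_4 = 3` the single
variable `w_4` has degree exactly `0` at `w_3 = 1`, so the limiting integral diverges.

Reduction by one integration: without indices `2` and `3`, the point `w_3 = 1` enters only through
`conj (w_4 - 1)`. In the variables `w = c (1, y)` the kernel factors, and the integral over the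
scale `c` is `-π / s_{145⋯L}`, because the angular mean of `1 / conj (c - 1)` is `-1` inside the
unit circle and `0` outside (`integral_scaleFactor`). -/

/-- The Koba–Nielsen type product of powers of differences and one-variable weights. -/
noncomputable def coll {ι : Type} [Fintype ι] (e : ι → ι → ℝ) (g : ι → ℂ → ℝ) (u : ι → ℂ) : ℝ :=
  (∏ a, ∏ b, ‖u a - u b‖ ^ e a b) * ∏ k, g k (u k)

/-! ### Changes of variables on `ℂ^n` and generic points. -/

section
variable {ι : Type} [Fintype ι]

theorem map_const_mul_volume (c : ℂ) (hc : c ≠ 0) :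
    Measure.map (fun u : ι → ℂ => c • u) volume
      = ENNReal.ofReal (‖c‖ ^ (-(2 * Fintype.card ι : ℝ))) • (volume : Measure (ι → ℂ)) := by
  classical
  let f : (ι → ℂ) →ₗ[ℝ] (ι → ℂ) :=
    ((c • (LinearMap.id : (ι → ℂ) →ₗ[ℂ] (ι → ℂ))) : (ι → ℂ) →ₗ[ℂ] (ι → ℂ)).restrictScalars ℝ
  have hdet : LinearMap.det f = ‖c‖ ^ (2 * Fintype.card ι) := by
    rw [LinearMap.det_restrictScalars, LinearMap.det_smul, LinearMap.det_id,
      Algebra.norm_complex_apply, Complex.normSq_eq_norm_sq]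
    simp [pow_mul, mul_comm]
  have hd0 : LinearMap.det f ≠ 0 := by rw [hdet]; positivity
  have h := Measure.map_linearMap_addHaar_eq_smul_addHaar (volume : Measure (ι → ℂ)) hd0
  have hf : (f : (ι → ℂ) → (ι → ℂ)) = fun u => c • u := by ext u; simp [f]
  rw [hf, hdet] at h
  rw [h]
  congr 2
  rw [Real.rpow_neg (norm_nonneg _), abs_of_nonneg (by positivity)]
  congr 1
  rw [← Real.rpow_natCast]; push_cast; rfl

theorem lintegral_comp_const_smul (c : ℂ) (hc : c ≠ 0) (F : (ι → ℂ) → ENNReal) :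
    ∫⁻ u, F (c • u) = ENNReal.ofReal (‖c‖ ^ (-(2 * Fintype.card ι : ℝ))) * ∫⁻ u, F u := by
  have h := (Homeomorph.smulOfNeZero c hc : (ι → ℂ) ≃ₜ (ι → ℂ)).toMeasurableEquiv.measurableEmbedding.lintegral_map
    (μ := volume) F
  have h2 := map_const_mul_volume (ι := ι) c hc
  have e1 : ((Homeomorph.smulOfNeZero c hc : (ι → ℂ) ≃ₜ (ι → ℂ)).toMeasurableEquiv : (ι → ℂ) → (ι → ℂ)) = fun u => c • u := by
    ext u; simp
  rw [e1, h2] at h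
  rw [← h, lintegral_smul_measure, smul_eq_mul]

theorem integral_comp_const_smul (c : ℂ) (hc : c ≠ 0) (F : (ι → ℂ) → ℂ) :
    ∫ u, F (c • u) = ((‖c‖ ^ (-(2 * Fintype.card ι : ℝ)) : ℝ) : ℂ) * ∫ u, F u := by
  have h := (Homeomorph.smulOfNeZero c hc : (ι → ℂ) ≃ₜ (ι → ℂ)).toMeasurableEquiv.measurableEmbedding.integral_map
    (μ := volume) F
  have h2 := map_const_mul_volume (ι := ι) c hc
  have e1 : ((Homeomorph.smulOfNeZero c hc : (ι → ℂ) ≃ₜ (ι → ℂ)).toMeasurableEquiv : (ι → ℂ) → (ι → ℂ)) = fun u => c • u := by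
    ext u; simp
  rw [e1, h2] at h
  rw [← h, integral_smul_measure, ENNReal.toReal_ofReal (by positivity)]
  simp

/-- The complex derivative of coordinatewise inversion is diagonal with entries `-u_k⁻²`. Its real
determinant is the squared modulus of the complex one, whence the exponent `-4`. The hyperplanes
where inversion fails are null. -/
theorem lintegral_comp_inv (F : (ι → ℂ) → ENNReal) :
    ∫⁻ u, F u = ∫⁻ u : ι → ℂ, ENNReal.ofReal (∏ k, ‖u k‖ ^ (-4 : ℝ)) * F (fun k => (u k)⁻¹) := by
  classical
  let s : Set (ι → ℂ) := {u | ∀ k, u k ≠ 0}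
  have hs : MeasurableSet s := by
    have : s = ⋂ k, (fun u : ι → ℂ => u k) ⁻¹' {0}ᶜ := by ext; simp [s]
    rw [this]
    exact MeasurableSet.iInter fun k => (measurable_pi_apply k) (measurableSet_singleton 0).compl
  have hae : ∀ᵐ u : ι → ℂ, u ∈ s := by
    simp only [s, Set.mem_ofPred_eq]
    rw [ae_all_iff]
    intro k
    have := (Measure.quasiMeasurePreserving_eval (fun _ : ι => (volume : Measure ℂ)) k).ae
      (p := fun z : ℂ => z ≠ 0) (by simp [ae_iff])
    exact this
  let f' : (ι → ℂ) → (ι → ℂ) →L[ℝ] (ι → ℂ) := fun u =>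
    (LinearMap.toContinuousLinearMap
      (Matrix.toLin' (Matrix.diagonal fun k => -((u k) ^ 2)⁻¹))).restrictScalars ℝ
  have hf' : ∀ x ∈ s, HasFDerivWithinAt (fun u : ι → ℂ => fun k => (u k)⁻¹) (f' x) s x := by
    intro x hx
    apply HasFDerivAt.hasFDerivWithinAt
    apply HasFDerivAt.restrictScalars
    rw [hasFDerivAt_pi']
    intro k
    have h0 : HasFDerivAt (fun u : ι → ℂ => u k)
        (ContinuousLinearMap.proj (R := ℂ) (φ := fun _ : ι => ℂ) k) x := hasFDerivAt_apply k x
    have h1 := (hasDerivAt_inv (hx k)).hasFDerivAt.comp x h0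
    refine h1.congr_fderiv (ContinuousLinearMap.ext fun v => ?_)
    simp [Matrix.mulVec_diagonal, mul_comm]
  have hinj : Set.InjOn (fun u : ι → ℂ => fun k => (u k)⁻¹) s := by
    intro x _ y _ hxy
    ext k
    exact inv_injective (congrFun hxy k)
  have himg : (fun u : ι → ℂ => fun k => (u k)⁻¹) '' s = s := by
    ext y
    constructor
    · rintro ⟨x, hx, rfl⟩ k; exact inv_ne_zero (hx k)
    · intro hy; exact ⟨fun k => (y k)⁻¹, fun k => inv_ne_zero (hy k), by ext k; simp⟩
  have key := lintegral_image_eq_lintegral_abs_det_fderiv_mul volume hs hf' hinj F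
  rw [himg, Measure.restrict_eq_self_of_ae_mem hae] at key
  rw [key]
  apply lintegral_congr_ae
  filter_upwards [hae] with u hu
  congr 2
  have : (f' u).det = Algebra.norm ℝ (∏ k, -((u k) ^ 2)⁻¹ : ℂ) := by
    have : (f' u).det = LinearMap.det ((Matrix.toLin' (Matrix.diagonal fun k => -((u k) ^ 2)⁻¹)).restrictScalars ℝ) := rfl
    rw [this, LinearMap.det_restrictScalars, LinearMap.det_toLin', Matrix.det_diagonal]
  rw [this, Algebra.norm_complex_apply, Complex.normSq_eq_norm_sq, norm_prod, abs_of_nonneg (by positivity), ← Finset.prod_pow]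
  refine Finset.prod_congr rfl fun k _ => ?_
  rw [Real.rpow_neg (norm_nonneg _)]
  simp [← pow_mul]

theorem ae_apply_of_ae (k : ι) {p : ℂ → Prop} (h : ∀ᵐ z, p z) : ∀ᵐ u : ι → ℂ, p (u k) :=
  (Measure.quasiMeasurePreserving_eval (fun _ : ι => (volume : Measure ℂ)) k).ae h

theorem ae_ne (z₀ : ℂ) : ∀ᵐ z : ℂ, z ≠ z₀ := by simp [ae_iff]

theorem ae_apply_ne_apply {a b : ι} (hab : a ≠ b) : ∀ᵐ u : ι → ℂ, u a ≠ u b := by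
  classical
  let S : Submodule ℝ (ι → ℂ) := LinearMap.ker
    (LinearMap.proj (R := ℝ) (φ := fun _ : ι => ℂ) a - LinearMap.proj (R := ℝ) (φ := fun _ : ι => ℂ) b)
  have hS : S ≠ ⊤ := by
    intro h
    have : (Pi.single a 1 : ι → ℂ) ∈ S := by rw [h]; trivial
    simp [S, hab.symm] at this
  have h0 := Measure.addHaar_submodule (volume : Measure (ι → ℂ)) S hS
  rw [ae_iff]
  convert h0 using 2
  ext u
  simp [S, sub_eq_zero]

theorem coll_nonneg {e : ι → ι → ℝ} {g : ι → ℂ → ℝ} (hg : ∀ k z, 0 ≤ g k z) (u : ι → ℂ) :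
    0 ≤ coll e g u :=
  mul_nonneg (Finset.prod_nonneg fun _ _ => Finset.prod_nonneg fun _ _ => by positivity)
    (Finset.prod_nonneg fun k _ => hg k _)

theorem coll_mono {e : ι → ι → ℝ} {g h : ι → ℂ → ℝ} (hg : ∀ k z, 0 ≤ g k z) (u : ι → ℂ)
    (hgh : ∀ k, g k (u k) ≤ h k (u k)) : coll e g u ≤ coll e h u := by
  refine mul_le_mul_of_nonneg_left (Finset.prod_le_prod (fun k _ => hg k _) fun k _ => hgh k)
    (Finset.prod_nonneg fun _ _ => Finset.prod_nonneg fun _ _ => by positivity)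

theorem measurable_coll {e : ι → ι → ℝ} {g : ι → ℂ → ℝ} (hg : ∀ k, Measurable (g k)) :
    Measurable (coll e g) := by
  refine Measurable.mul ?_ (Finset.measurable_prod _ fun k _ => (hg k).comp (measurable_pi_apply k))
  refine Finset.measurable_prod _ fun a _ => Finset.measurable_prod _ fun b _ => ?_
  exact (((measurable_pi_apply a).sub (measurable_pi_apply b)).norm).pow_const _

theorem coll_pos_ae {e : ι → ι → ℝ} {g : ι → ℂ → ℝ} (he : ∀ a, e a a = 0)
    (hg : ∀ k, ∀ᵐ z, 0 < g k z) : ∀ᵐ u, 0 < coll e g u := by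
  have h1 : ∀ᵐ u : ι → ℂ, ∀ a b, a ≠ b → u a ≠ u b := by
    rw [ae_all_iff]; intro a; rw [ae_all_iff]; intro b
    by_cases hab : a = b
    · simp [hab]
    · filter_upwards [ae_apply_ne_apply hab] with u hu _ using hu
  have h2 : ∀ᵐ u : ι → ℂ, ∀ k, 0 < g k (u k) := by
    rw [ae_all_iff]; intro k; exact ae_apply_of_ae k (hg k)
  filter_upwards [h1, h2] with u hu1 hu2
  refine mul_pos (Finset.prod_pos fun a _ => Finset.prod_pos fun b _ => ?_)
    (Finset.prod_pos fun k _ => hu2 k)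
  by_cases hab : a = b
  · subst hab; simp [he]
  · have := norm_pos_iff.2 (sub_ne_zero.2 (hu1 a b hab)); positivity

/-! ### Separation of near and far variables. -/

theorem rpow_le_two_rpow_mul {x y : ℝ} (hx : 0 < x) (hy : 0 < y) (h1 : x ≤ 2 * y) (h2 : y ≤ 2 * x)
    (e : ℝ) : x ^ e ≤ 2 ^ |e| * y ^ e := by
  rcases le_total 0 e with he | he
  · rw [abs_of_nonneg he, ← Real.mul_rpow (by norm_num) hy.le]
    exact Real.rpow_le_rpow hx.le h1 he
  · rw [abs_of_nonpos he, Real.rpow_neg (by norm_num), ← Real.inv_rpow (by norm_num),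
      ← Real.mul_rpow (by norm_num) hy.le]
    exact Real.rpow_le_rpow_of_nonpos (by positivity) (by linarith) he

/-- The weights of the far variables after the interaction with the variables in `K`
has been replaced by its leading behaviour. -/
noncomputable def farWeight (e : ι → ι → ℝ) (K : Finset ι) (g : ι → ℂ → ℝ) (l : {l // l ∉ K}) (z : ℂ) : ℝ :=
  g l z * ‖z‖ ^ (∑ k : {k // k ∈ K}, (e k l + e l k))

variable [DecidableEq ι]

noncomputable def crossConst (e : ι → ι → ℝ) (K : Finset ι) : ℝ :=
  ∏ l : {l // l ∉ K}, ∏ k : {k // k ∈ K}, (2 : ℝ) ^ (|e k l| + |e l k|)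

theorem crossConst_pos (e : ι → ι → ℝ) (K : Finset ι) : 0 < crossConst e K :=
  Finset.prod_pos fun _ _ => Finset.prod_pos fun _ _ => by positivity

theorem coll_eq_split (e : ι → ι → ℝ) (g : ι → ℂ → ℝ) (K : Finset ι) (u : ι → ℂ) :
    coll e g u = coll (fun a b : {k // k ∈ K} => e a b) (fun k => g k) (fun k => u k) *
      coll (fun a b : {l // l ∉ K} => e a b) (fun l => g l) (fun l => u l) *
      ∏ l : {l // l ∉ K}, ∏ k : {k // k ∈ K}, (‖u k - u l‖ ^ e k l * ‖u l - u k‖ ^ e l k) := by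
  have h (f : ι → ℝ) : ∏ a, f a = (∏ a : {k // k ∈ K}, f a) * ∏ a : {l // l ∉ K}, f a :=
    by rw [← Fintype.prod_subtype_mul_prod_subtype (· ∈ K) f]; congr!
  unfold coll
  rw [h (fun k => g k (u k)), h (fun a => ∏ b, ‖u a - u b‖ ^ e a b)]
  simp only [h (fun b => ‖u _ - u b‖ ^ e _ b), Finset.prod_mul_distrib]
  rw [Finset.prod_comm (s := (Finset.univ : Finset {k // k ∈ K})) (t := (Finset.univ : Finset {l // l ∉ K}))]
  ring

theorem coll_far_eq (e : ι → ι → ℝ) (g : ι → ℂ → ℝ) (K : Finset ι) (y : {l // l ∉ K} → ℂ)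
    (hy : ∀ l, y l ≠ 0) :
    coll (fun a b : {l // l ∉ K} => e a b) (farWeight e K g) y =
      coll (fun a b : {l // l ∉ K} => e a b) (fun l => g l) y *
      ∏ l : {l // l ∉ K}, ∏ k : {k // k ∈ K}, (‖y l‖ ^ e k l * ‖y l‖ ^ e l k) := by
  unfold coll farWeight
  rw [Finset.prod_mul_distrib, mul_assoc]
  congr 2
  refine Finset.prod_congr rfl fun l _ => ?_
  have hl := norm_pos_iff.2 (hy l)
  rw [Real.rpow_sum_of_pos hl]
  exact Finset.prod_congr rfl fun k _ => Real.rpow_add hl _ _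

/-- If `u l` is at least twice as large as `u k`, then `‖u k - u l‖` and `‖u l‖` agree up to a
factor `2`, so every cross factor may be replaced by a weight of the far variable alone. The upper
bound serves estimates, the lower bound transfers finiteness to the two factors. -/
theorem coll_split_le {e : ι → ι → ℝ} {g : ι → ℂ → ℝ} (hg : ∀ k z, 0 ≤ g k z) (K : Finset ι)
    (u : ι → ℂ) (h0 : ∀ l ∉ K, u l ≠ 0) (h : ∀ k ∈ K, ∀ l ∉ K, 2 * ‖u k‖ ≤ ‖u l‖) :
    coll e g u ≤ crossConst e K *
        (coll (fun a b : {k // k ∈ K} => e a b) (fun k => g k) (fun k => u k) *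
        coll (fun a b : {l // l ∉ K} => e a b) (farWeight e K g) (fun l => u l)) ∧
      coll (fun a b : {k // k ∈ K} => e a b) (fun k => g k) (fun k => u k) *
        coll (fun a b : {l // l ∉ K} => e a b) (farWeight e K g) (fun l => u l) ≤
      crossConst e K * coll e g u := by
  rw [coll_far_eq e g K _ (fun l => h0 l l.2), coll_eq_split e g K u]
  have hP : 0 ≤ coll (fun a b : {k // k ∈ K} => e a b) (fun k => g k) (fun k => u k) :=
    coll_nonneg (g := fun k : {k // k ∈ K} => g k) (fun k z => hg k z) _
  have hQ : 0 ≤ coll (fun a b : {l // l ∉ K} => e a b) (fun l => g l) (fun l => u l) :=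
    coll_nonneg (g := fun k : {k // k ∉ K} => g k) (fun k z => hg k z) _
  have hcmp : ∀ (l : {l // l ∉ K}) (k : {k // k ∈ K}), 0 < ‖u l‖ ∧ 0 < ‖u k - u l‖ ∧
      ‖u k - u l‖ ≤ 2 * ‖u l‖ ∧ ‖u l‖ ≤ 2 * ‖u k - u l‖ := by
    intro l k
    have h1 := norm_pos_iff.2 (h0 l l.2)
    have h2 := h k k.2 l l.2
    have h3 := norm_sub_le (u k) (u l)
    have h4 := norm_sub_norm_le (u l) (u k)
    rw [norm_sub_rev] at h4
    refine ⟨h1, ?_, ?_, ?_⟩ <;> linarith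
  have hab (x y : ℝ) : ∏ l : {l // l ∉ K}, ∏ k : {k // k ∈ K}, ((‖u k - u l‖ ^ e k l * ‖u l - u k‖ ^ e l k))
      ≤ crossConst e K * ∏ l : {l // l ∉ K}, ∏ k : {k // k ∈ K}, (‖u l‖ ^ e k l * ‖u l‖ ^ e l k) := by
    simp only [crossConst, ← Finset.prod_mul_distrib]
    refine Finset.prod_le_prod (fun _ _ => Finset.prod_nonneg fun _ _ => by positivity) fun l _ =>
      Finset.prod_le_prod (fun _ _ => by positivity) fun k _ => ?_
    obtain ⟨h1, h2, h3, h4⟩ := hcmp l k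
    rw [norm_sub_rev (u l) (u k), Real.rpow_add (by norm_num)]
    calc _ ≤ ((2 : ℝ) ^ |e k l| * ‖u l‖ ^ e k l) * (2 ^ |e l k| * ‖u l‖ ^ e l k) :=
          mul_le_mul (rpow_le_two_rpow_mul h2 h1 h3 h4 _) (rpow_le_two_rpow_mul h2 h1 h3 h4 _)
            (by positivity) (by positivity)
      _ = _ := by ring
  have hba : ∏ l : {l // l ∉ K}, ∏ k : {k // k ∈ K}, (‖u l‖ ^ e k l * ‖u l‖ ^ e l k)
      ≤ crossConst e K * ∏ l : {l // l ∉ K}, ∏ k : {k // k ∈ K}, ((‖u k - u l‖ ^ e k l * ‖u l - u k‖ ^ e l k)) := by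
    simp only [crossConst, ← Finset.prod_mul_distrib]
    refine Finset.prod_le_prod (fun _ _ => Finset.prod_nonneg fun _ _ => by positivity) fun l _ =>
      Finset.prod_le_prod (fun _ _ => by positivity) fun k _ => ?_
    obtain ⟨h1, h2, h3, h4⟩ := hcmp l k
    rw [norm_sub_rev (u l) (u k), Real.rpow_add (by norm_num)]
    calc _ ≤ ((2 : ℝ) ^ |e k l| * ‖u k - u l‖ ^ e k l) * (2 ^ |e l k| * ‖u k - u l‖ ^ e l k) :=
          mul_le_mul (rpow_le_two_rpow_mul h1 h2 h4 h3 _) (rpow_le_two_rpow_mul h1 h2 h4 h3 _)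
            (by positivity) (by positivity)
      _ = _ := by ring
  constructor
  · calc _ ≤ _ := mul_le_mul_of_nonneg_left (hab 0 0) (mul_nonneg hP hQ)
      _ = _ := by ring
  · calc _ = _ := (mul_assoc _ _ _).symm
      _ ≤ _ := mul_le_mul_of_nonneg_left hba (mul_nonneg hP hQ)
      _ = _ := by ring

/-- Points whose coordinates in `K` lie in `A` and whose other coordinates lie in `B`. -/
def splitRegion (K : Finset ι) (A : Set ({k // k ∈ K} → ℂ)) (B : Set ({l // l ∉ K} → ℂ)) :
    Set (ι → ℂ) := {u | (fun k : {k // k ∈ K} => u k) ∈ A ∧ (fun l : {l // l ∉ K} => u l) ∈ B}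

theorem measurableSet_splitRegion {K : Finset ι} {A : Set ({k // k ∈ K} → ℂ)}
    {B : Set ({l // l ∉ K} → ℂ)} (hA : MeasurableSet A) (hB : MeasurableSet B) :
    MeasurableSet (splitRegion K A B) :=
  ((measurable_pi_lambda _ fun _ => measurable_pi_apply _) hA).inter
    ((measurable_pi_lambda _ fun _ => measurable_pi_apply _) hB)

theorem lintegral_splitRegion_mul {K : Finset ι} {A : Set ({k // k ∈ K} → ℂ)}
    {B : Set ({l // l ∉ K} → ℂ)} {φ : ({k // k ∈ K} → ℂ) → ENNReal} {ψ : ({l // l ∉ K} → ℂ) → ENNReal}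
    (hφ : Measurable φ) (hψ : Measurable ψ) :
    ∫⁻ u in splitRegion K A B, φ (fun k => u k) * ψ (fun l => u l) =
      (∫⁻ x in A, φ x) * ∫⁻ y in B, ψ y := by
  have hmp := volume_preserving_piEquivPiSubtypeProd (fun _ : ι => ℂ) (· ∈ K)
  have := hmp.setLIntegral_comp_preimage_emb (MeasurableEquiv.measurableEmbedding _)
    (fun p => φ p.1 * ψ p.2) (A ×ˢ B)
  rw [Measure.volume_eq_prod, ← Measure.prod_restrict, lintegral_prod_mul hφ.aemeasurable hψ.aemeasurable] at this
  convert this <;> rfl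

section SplitIntegral
variable {e : ι → ι → ℝ} {g : ι → ℂ → ℝ} {K : Finset ι} {A : Set ({k // k ∈ K} → ℂ)}
  {B : Set ({l // l ∉ K} → ℂ)}

theorem measurable_farWeight (hgm : ∀ k, Measurable (g k)) (l : {l // l ∉ K}) :
    Measurable (farWeight e K g l) :=
  (hgm l).mul (measurable_norm.pow_const _)

theorem farWeight_nonneg (hg : ∀ k z, 0 ≤ g k z) (l : {l // l ∉ K}) (z : ℂ) :
    0 ≤ farWeight e K g l z := mul_nonneg (hg l z) (by positivity)

theorem lintegral_coll_splitRegion_le (hg : ∀ k z, 0 ≤ g k z) (hgm : ∀ k, Measurable (g k))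
    (hA : MeasurableSet A) (hB : MeasurableSet B)
    (hAB : ∀ x ∈ A, ∀ y ∈ B, ∀ l, y l ≠ 0 ∧ ∀ k, 2 * ‖x k‖ ≤ ‖y l‖) :
    (∫⁻ u in splitRegion K A B, ENNReal.ofReal (coll e g u) ≤ ENNReal.ofReal (crossConst e K) *
      ((∫⁻ x in A, ENNReal.ofReal (coll (fun a b : {k // k ∈ K} => e a b) (fun k => g k) x)) *
      ∫⁻ y in B, ENNReal.ofReal (coll (fun a b : {l // l ∉ K} => e a b) (farWeight e K g) y))) ∧
    ((∫⁻ x in A, ENNReal.ofReal (coll (fun a b : {k // k ∈ K} => e a b) (fun k => g k) x)) *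
      ∫⁻ y in B, ENNReal.ofReal (coll (fun a b : {l // l ∉ K} => e a b) (farWeight e K g) y)) ≤
     ENNReal.ofReal (crossConst e K) * ∫⁻ u in splitRegion K A B, ENNReal.ofReal (coll e g u) := by
  have hC := (crossConst_pos e K).le
  have m1 : Measurable fun x => ENNReal.ofReal (coll (fun a b : {k // k ∈ K} => e a b) (fun k => g k) x) :=
    (measurable_coll (g := fun k : {k // k ∈ K} => g k) fun k => hgm k).ennreal_ofReal
  have m2 : Measurable fun x => ENNReal.ofReal (coll (fun a b : {l // l ∉ K} => e a b) (farWeight e K g) x) :=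
    (measurable_coll fun k => measurable_farWeight hgm k).ennreal_ofReal
  have hP (x) : 0 ≤ coll (fun a b : {k // k ∈ K} => e a b) (fun k => g k) x :=
    coll_nonneg (g := fun k : {k // k ∈ K} => g k) (fun k z => hg k z) _
  have hms := measurableSet_splitRegion hA hB
  have hsp : ∀ u ∈ splitRegion K A B, _ := fun u hu =>
    coll_split_le (e := e) hg K u (fun l hl => (hAB _ hu.1 _ hu.2 ⟨l, hl⟩).1)
      (fun k hk l hl => (hAB _ hu.1 _ hu.2 ⟨l, hl⟩).2 ⟨k, hk⟩)
  rw [← lintegral_splitRegion_mul m1 m2, ← lintegral_const_mul' _ _ ENNReal.ofReal_ne_top,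
    ← lintegral_const_mul' _ _ ENNReal.ofReal_ne_top]
  constructor
  · refine setLIntegral_mono' hms fun u hu => ?_
    rw [← ENNReal.ofReal_mul (hP _), ← ENNReal.ofReal_mul hC]
    exact ENNReal.ofReal_le_ofReal (hsp u hu).1
  · refine setLIntegral_mono' hms fun u hu => ?_
    rw [← ENNReal.ofReal_mul (hP _), ← ENNReal.ofReal_mul hC]
    exact ENNReal.ofReal_le_ofReal (hsp u hu).2

theorem setLIntegral_coll_ne_zero {κ : Type} [Fintype κ] {e : κ → κ → ℝ} {g : κ → ℂ → ℝ}
    (he : ∀ a, e a a = 0) (hgm : ∀ k, Measurable (g k)) (hpos : ∀ k, ∀ᵐ z, 0 < g k z)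
    {A : Set (κ → ℂ)} (hA : volume A ≠ 0) :
    ∫⁻ x in A, ENNReal.ofReal (coll e g x) ≠ 0 := by
  intro h
  rw [lintegral_eq_zero_iff (measurable_coll hgm).ennreal_ofReal] at h
  have h2 := ae_restrict_of_ae (s := A) (coll_pos_ae he hpos)
  have : ∀ᵐ x ∂(volume.restrict A), False := by
    filter_upwards [h, h2] with x h1 h2
    simp only [Pi.zero_apply, ENNReal.ofReal_eq_zero] at h1
    linarith
  simp only [ae_iff, not_false_eq_true] at this
  apply hA
  have h3 : volume.restrict A Set.univ = 0 := by convert this; simp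
  simpa using h3

theorem farWeight_pos_ae (hpos : ∀ k, ∀ᵐ z, 0 < g k z) (l : {l // l ∉ K}) :
    ∀ᵐ z, 0 < farWeight e K g l z := by
  filter_upwards [hpos l, ae_ne 0] with z h1 h2
  have := norm_pos_iff.2 h2
  unfold farWeight; positivity

/-- A finite product in `[0, ∞]` of nonzero factors has finite factors. Neither factor vanishes,
since the integrands are positive almost everywhere and the regions have positive measure. -/
theorem near_far_ne_top (he : ∀ a, e a a = 0) (hg : ∀ k z, 0 ≤ g k z) (hgm : ∀ k, Measurable (g k))
    (hpos : ∀ k, ∀ᵐ z, 0 < g k z) (hA : MeasurableSet A) (hB : MeasurableSet B)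
    (hAB : ∀ x ∈ A, ∀ y ∈ B, ∀ l, y l ≠ 0 ∧ ∀ k, 2 * ‖x k‖ ≤ ‖y l‖)
    (hA0 : volume A ≠ 0) (hB0 : volume B ≠ 0)
    (h : ∫⁻ u in splitRegion K A B, ENNReal.ofReal (coll e g u) ≠ ⊤) :
    ∫⁻ x in A, ENNReal.ofReal (coll (fun a b : {k // k ∈ K} => e a b) (fun k => g k) x) ≠ ⊤ ∧
    ∫⁻ y in B, ENNReal.ofReal (coll (fun a b : {l // l ∉ K} => e a b) (farWeight e K g) y) ≠ ⊤ := by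
  have h1 := (lintegral_coll_splitRegion_le (e := e) hg hgm hA hB hAB).2
  have h2 := ne_top_of_le_ne_top (ENNReal.mul_ne_top ENNReal.ofReal_ne_top h) h1
  have hx := setLIntegral_coll_ne_zero (e := fun a b : {k // k ∈ K} => e a b) (fun a => he a)
    (fun k => hgm k) (fun k => hpos k) hA0
  have hy := setLIntegral_coll_ne_zero (e := fun a b : {l // l ∉ K} => e a b) (fun a => he a)
    (fun k => measurable_farWeight (e := e) hgm k) (fun k => farWeight_pos_ae (e := e) hpos k) hB0
  constructor
  · intro ht; rw [ht, ENNReal.top_mul hy] at h2; exact h2 rfl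
  · intro ht; rw [ht, ENNReal.mul_top hx] at h2; exact h2 rfl

end SplitIntegral

end

/-! ### Scaling degrees and dyadic decompositions. -/

section
variable {ι : Type} [Fintype ι] [DecidableEq ι]

/-- The scaling degree of the integral of `coll e g` over the variables in `K`, where `g k` has
degree `d k`. -/
noncomputable def clusterDeg (e : ι → ι → ℝ) (d : ι → ℝ) (K : Finset ι) : ℝ :=
  2 * (K.card : ℝ) + ∑ a ∈ K, ∑ b ∈ K, e a b + ∑ k ∈ K, d k

theorem clusterDeg_subtype {p : ι → Prop} (e : ι → ι → ℝ) (d : ι → ℝ) (K : Finset (Subtype p)) :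
    clusterDeg (fun a b : Subtype p => e a b) (fun k => d k) K =
      clusterDeg e d (K.map (Function.Embedding.subtype p)) := by
  simp [clusterDeg]

theorem clusterDeg_univ_subtype (e : ι → ι → ℝ) (d : ι → ℝ) (K : Finset ι) :
    clusterDeg (fun a b : {k // k ∈ K} => e a b) (fun k => d k) Finset.univ = clusterDeg e d K := by
  rw [clusterDeg_subtype]
  congr 1
  ext; simp

/-- The exponents between `K` and its complement, missing from the near factor, are exactly those
moved into the far weights. Degrees are therefore additive under the near-far splitting. -/
theorem clusterDeg_add_far (e : ι → ι → ℝ) (d : ι → ℝ) (K : Finset ι) :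
    clusterDeg (fun a b : {k // k ∈ K} => e a b) (fun k => d k) Finset.univ +
      clusterDeg (fun a b : {l // l ∉ K} => e a b)
        (fun l => d l + ∑ k : {k // k ∈ K}, (e k l + e l k)) Finset.univ =
      clusterDeg e d Finset.univ := by
  have h (f : ι → ℝ) : ∑ a, f a = (∑ a : {k // k ∈ K}, f a) + ∑ a : {l // l ∉ K}, f a :=
    by rw [← Fintype.sum_subtype_add_sum_subtype (· ∈ K) f]; congr!
  have hc : (Fintype.card ι : ℝ) = Fintype.card {k // k ∈ K} + Fintype.card {l // l ∉ K} := by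
    have := h (fun _ => 1)
    simpa using this
  simp only [clusterDeg, Finset.card_univ]
  rw [h (fun a => ∑ b, e a b), h d, hc]
  simp only [h (fun b => e _ b), Finset.sum_add_distrib]
  rw [Finset.sum_comm (s := (Finset.univ : Finset {k // k ∈ K})) (t := (Finset.univ : Finset {l // l ∉ K}))]
  ring

theorem coll_le_prod_mul {e : ι → ι → ℝ} {g h : ι → ℂ → ℝ} {C : ι → ℝ} {u : ι → ℂ}
    (hg : ∀ k z, 0 ≤ g k z) (hgh : ∀ k, g k (u k) ≤ C k * h k (u k)) :
    coll e g u ≤ (∏ k, C k) * coll e h u := by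
  have h1 : ∏ k, g k (u k) ≤ ∏ k, (C k * h k (u k)) :=
    Finset.prod_le_prod (fun k _ => hg k _) fun k _ => hgh k
  have h2 : 0 ≤ ∏ a, ∏ b, ‖u a - u b‖ ^ e a b :=
    Finset.prod_nonneg fun _ _ => Finset.prod_nonneg fun _ _ => by positivity
  rw [Finset.prod_mul_distrib] at h1
  calc coll e g u ≤ (∏ a, ∏ b, ‖u a - u b‖ ^ e a b) * ((∏ k, C k) * ∏ k, h k (u k)) :=
        mul_le_mul_of_nonneg_left h1 h2
    _ = _ := by unfold coll; ring

theorem setLIntegral_coll_le {e : ι → ι → ℝ} {g h : ι → ℂ → ℝ} {C : ι → ℝ} {U : Set ℂ}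
    (hU : MeasurableSet U)
    (hg : ∀ k z, 0 ≤ g k z) (hC : ∀ k, 0 ≤ C k) (hgh : ∀ k, ∀ z ∈ U, g k z ≤ C k * h k z) :
    ∫⁻ u in Set.univ.pi fun _ => U, ENNReal.ofReal (coll e g u) ≤
      ENNReal.ofReal (∏ k, C k) * ∫⁻ u in Set.univ.pi fun _ => U, ENNReal.ofReal (coll e h u) := by
  rw [← lintegral_const_mul' _ _ ENNReal.ofReal_ne_top]
  refine setLIntegral_mono' (MeasurableSet.univ_pi fun _ => hU) fun u hu => ?_
  rw [← ENNReal.ofReal_mul (Finset.prod_nonneg fun k _ => hC k)]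
  exact ENNReal.ofReal_le_ofReal (coll_le_prod_mul hg fun k => hgh k _ (hu k trivial))

theorem coll_smul {e : ι → ι → ℝ} {g h : ι → ℂ → ℝ} {d : ι → ℝ} {c : ℂ} (hc : c ≠ 0)
    (hgh : ∀ k z, g k (c * z) = ‖c‖ ^ d k * h k z) (u : ι → ℂ) :
    coll e g (c • u) = ‖c‖ ^ (∑ a, ∑ b, e a b + ∑ k, d k) * coll e h u := by
  have h0 := norm_pos_iff.2 hc
  rw [Real.rpow_add h0, Real.rpow_sum_of_pos h0]
  simp only [Real.rpow_sum_of_pos h0]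
  simp only [coll, Pi.smul_apply, smul_eq_mul, ← mul_sub, norm_mul, hgh]
  simp only [Real.mul_rpow (norm_nonneg _) (norm_nonneg _), Finset.prod_mul_distrib]
  ring

theorem setLIntegral_coll_scale {e : ι → ι → ℝ} {g h : ι → ℂ → ℝ} {d : ι → ℝ} {c : ℂ} (hc : c ≠ 0)
    (hgh : ∀ k z, g k (c * z) = ‖c‖ ^ d k * h k z)
    {S : Set (ι → ℂ)} (hS : MeasurableSet S) :
    ∫⁻ v in S, ENNReal.ofReal (coll e g v) = ENNReal.ofReal (‖c‖ ^ clusterDeg e d Finset.univ) *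
      ∫⁻ u in (fun u => c • u) ⁻¹' S, ENNReal.ofReal (coll e h u) := by
  have h0 := norm_pos_iff.2 hc
  have hm : Measurable fun u : ι → ℂ => c • u := measurable_const_smul c
  have h1 := lintegral_comp_const_smul c hc (S.indicator fun v => ENNReal.ofReal (coll e g v))
  rw [lintegral_indicator hS] at h1
  have h2 : ∫⁻ u, S.indicator (fun v => ENNReal.ofReal (coll e g v)) (c • u) =
      ENNReal.ofReal (‖c‖ ^ (∑ a, ∑ b, e a b + ∑ k, d k)) *
        ∫⁻ u in (fun u => c • u) ⁻¹' S, ENNReal.ofReal (coll e h u) := by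
    rw [← lintegral_const_mul' _ _ ENNReal.ofReal_ne_top, ← lintegral_indicator (hm hS)]
    refine lintegral_congr fun u => ?_
    by_cases hu : c • u ∈ S
    · rw [Set.indicator_of_mem hu, Set.indicator_of_mem (by exact hu), coll_smul hc hgh,
        ENNReal.ofReal_mul (by positivity)]
    · rw [Set.indicator_of_notMem hu, Set.indicator_of_notMem (by exact hu)]
  rw [h2] at h1
  have h3 : ENNReal.ofReal (‖c‖ ^ (2 * Fintype.card ι : ℝ)) *
      ENNReal.ofReal (‖c‖ ^ (-(2 * Fintype.card ι : ℝ))) = 1 := by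
    rw [← ENNReal.ofReal_mul (by positivity), ← Real.rpow_add h0]; simp
  calc _ = ENNReal.ofReal (‖c‖ ^ (2 * Fintype.card ι : ℝ)) *
      (ENNReal.ofReal (‖c‖ ^ (-(2 * Fintype.card ι : ℝ))) * ∫⁻ v in S, ENNReal.ofReal (coll e g v)) := by
        rw [← mul_assoc, h3, one_mul]
    _ = _ := by
        rw [← h1, ← mul_assoc, ← ENNReal.ofReal_mul (by positivity), ← Real.rpow_add h0]
        congr 3
        simp [clusterDeg, add_assoc]

/-- Pigeonhole: `n` coordinates cannot meet `n + 1` disjoint dyadic shells. -/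
theorem exists_norm_gap (u : ι → ℂ) {c : ℝ} (hc : 0 < c) :
    ∃ m : Fin (Fintype.card ι + 1), ∀ k, ‖u k‖ ≤ c / 2 ^ (m.val + 1) ∨ c / 2 ^ m.val < ‖u k‖ := by
  by_contra! h
  choose f hf using h
  have hinj : Function.Injective f := by
    have key : ∀ m m' : Fin (Fintype.card ι + 1), m < m' → f m ≠ f m' := by
      intro m m' hlt heq
      have h1 := (hf m).1
      have h2 := (hf m').2
      rw [heq] at h1
      have : c / 2 ^ m'.val ≤ c / 2 ^ (m.val + 1) :=
        div_le_div_of_nonneg_left hc.le (by positivity)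
          (pow_le_pow_right₀ (by norm_num) (Nat.succ_le_of_lt hlt))
      linarith
    intro m m' h
    rcases lt_trichotomy m m' with hlt | heq | hlt
    · exact absurd h (key _ _ hlt)
    · exact heq
    · exact absurd h.symm (key _ _ hlt)
  have := Fintype.card_le_of_injective f hinj
  simp at this

/-- The polydisc of radius `R`. -/
def polydisc (ι : Type) (R : ℝ) : Set (ι → ℂ) := Set.univ.pi fun _ => {z | ‖z‖ ≤ R}

/-- A product of annuli. -/
def polyann (ι : Type) (a b : ℝ) : Set (ι → ℂ) := Set.univ.pi fun _ => {z | a < ‖z‖ ∧ ‖z‖ ≤ b}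

/-- A product of complements of discs. -/
def polyext (ι : Type) (a : ℝ) : Set (ι → ℂ) := Set.univ.pi fun _ => {z | a < ‖z‖}

theorem measurableSet_norm_le (R : ℝ) : MeasurableSet {z : ℂ | ‖z‖ ≤ R} :=
  measurableSet_le measurable_norm measurable_const

theorem measurableSet_lt_norm (R : ℝ) : MeasurableSet {z : ℂ | R < ‖z‖} :=
  measurableSet_lt measurable_const measurable_norm

theorem measurableSet_annulus (a b : ℝ) : MeasurableSet {z : ℂ | a < ‖z‖ ∧ ‖z‖ ≤ b} :=
  (measurableSet_lt_norm a).inter (measurableSet_norm_le b)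

theorem measurableSet_polydisc (R : ℝ) : MeasurableSet (polydisc ι R) :=
  MeasurableSet.univ_pi fun _ => measurableSet_norm_le R

theorem measurableSet_polyann (a b : ℝ) : MeasurableSet (polyann ι a b) :=
  MeasurableSet.univ_pi fun _ => measurableSet_annulus a b

theorem measurableSet_polyext (a : ℝ) : MeasurableSet (polyext ι a) :=
  MeasurableSet.univ_pi fun _ => measurableSet_lt_norm a

theorem volume_univ_pi_ne_zero {U : Set ℂ} (hU : IsOpen U) (hne : U.Nonempty) {V : Set ℂ} (hUV : U ⊆ V) :
    volume (Set.univ.pi fun _ : ι => V) ≠ 0 := by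
  rw [volume_pi_pi]
  refine Finset.prod_ne_zero_iff.2 fun _ _ => ?_
  exact ((hU.measure_pos volume hne).trans_le (measure_mono hUV)).ne'

theorem volume_polydisc_ne_zero {R : ℝ} (hR : 0 < R) : volume (polydisc ι R) ≠ 0 :=
  volume_univ_pi_ne_zero (U := Metric.ball 0 R) Metric.isOpen_ball ⟨0, by simpa⟩
    fun z hz => by have := mem_ball_zero_iff.1 hz; exact this.le

theorem volume_polyann_ne_zero {a b : ℝ} (ha : 0 ≤ a) (hab : a < b) : volume (polyann ι a b) ≠ 0 := by
  refine volume_univ_pi_ne_zero (U := {z : ℂ | a < ‖z‖ ∧ ‖z‖ < b}) ?_ ⟨(((a + b) / 2 : ℝ) : ℂ), ?_⟩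
    fun z hz => ⟨hz.1, hz.2.le⟩
  · exact (isOpen_lt continuous_const continuous_norm).inter (isOpen_lt continuous_norm continuous_const)
  · show a < ‖(((a + b) / 2 : ℝ) : ℂ)‖ ∧ ‖(((a + b) / 2 : ℝ) : ℂ)‖ < b
    rw [Complex.norm_real, Real.norm_of_nonneg (by linarith)]
    constructor <;> linarith

theorem volume_polyext_ne_zero {a : ℝ} (ha : 0 ≤ a) : volume (polyext ι a) ≠ 0 := by
  have h := volume_polyann_ne_zero (ι := ι) ha (lt_add_one a)
  intro h0
  exact h (measure_mono_null (Set.pi_mono fun _ _ z hz => hz.1) h0)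

theorem preimage_smul_polydisc {c : ℂ} (hc : c ≠ 0) (R : ℝ) :
    (fun u : ι → ℂ => c • u) ⁻¹' polydisc ι R = polydisc ι (R / ‖c‖) := by
  ext u
  simp [polydisc, le_div_iff₀ (norm_pos_iff.2 hc), mul_comm]

theorem preimage_smul_polyann {c : ℂ} (hc : c ≠ 0) (a b : ℝ) :
    (fun u : ι → ℂ => c • u) ⁻¹' polyann ι a b = polyann ι (a / ‖c‖) (b / ‖c‖) := by
  ext u
  simp [polyann, le_div_iff₀ (norm_pos_iff.2 hc), div_lt_iff₀ (norm_pos_iff.2 hc), mul_comm]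

theorem near_far_cond {K : Finset ι} {a b : ℝ} (hb : 2 * a ≤ b) (hb0 : 0 ≤ b) {B : Set ({l // l ∉ K} → ℂ)}
    (hB : B ⊆ polyext _ b) :
    ∀ x ∈ polydisc {k // k ∈ K} a, ∀ y ∈ B, ∀ l, y l ≠ 0 ∧ ∀ k, 2 * ‖x k‖ ≤ ‖y l‖ := by
  intro x hx y hy l
  have h1 : b < ‖y l‖ := hB hy l trivial
  refine ⟨norm_pos_iff.1 (hb0.trans_lt h1), fun k => ?_⟩
  have h2 : ‖x k‖ ≤ a := hx k trivial
  linarith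

theorem polyann_subset_polyext (a b : ℝ) : polyann ι a b ⊆ polyext ι a :=
  Set.pi_mono fun _ _ _ hz => hz.1

theorem setLIntegral_le_sum_cover {α κ : Type} [MeasurableSpace α] {μ : Measure α} [Fintype κ]
    {S : Set α} {T : κ → Set α} (h : S ⊆ ⋃ i, T i) (f : α → ENNReal) :
    ∫⁻ x in S, f x ∂μ ≤ ∑ i, ∫⁻ x in T i, f x ∂μ :=
  calc _ ≤ ∫⁻ x in ⋃ i, T i, f x ∂μ := lintegral_mono_set h
    _ ≤ ∑' i, ∫⁻ x in T i, f x ∂μ := lintegral_iUnion_le _ _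
    _ = _ := tsum_fintype _

theorem iUnion_splitRegion_polyext {c : ℝ} (hc : 0 < c) :
    (Set.univ : Set (ι → ℂ)) ⊆ ⋃ p : Fin (Fintype.card ι + 1) × Finset ι,
      splitRegion p.2 (polydisc _ (c / 2 ^ (p.1.val + 1))) (polyext _ (c / 2 ^ p.1.val)) := by
  intro u _
  obtain ⟨m, hm⟩ := exists_norm_gap u hc
  refine Set.mem_iUnion.2 ⟨(m, Finset.univ.filter fun k => ‖u k‖ ≤ c / 2 ^ (m.val + 1)), ?_, ?_⟩
  · intro k _
    exact (Finset.mem_filter.1 k.2).2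
  · intro l _
    have := l.2
    simp only [Finset.mem_filter, Finset.mem_univ, true_and] at this
    exact (hm l).resolve_left this

/-- A point outside the smaller polydisc has a coordinate of modulus above `R`, so its set of near
variables is proper. This permits induction on the number of variables. -/
theorem shell_subset {R : ℝ} (hR : 0 < R) :
    polydisc ι (2 * R) ⊆ ⋃ o : Option (Fin (Fintype.card ι + 1) × {K : Finset ι // K ≠ Finset.univ}),
      match o with
      | none => polydisc ι R
      | some p => splitRegion p.2.val (polydisc _ (R / 2 ^ (p.1.val + 1)))
          (polyann _ (R / 2 ^ p.1.val) (2 * R)) := by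
  intro u hu
  rw [Set.mem_iUnion]
  by_cases h : u ∈ polydisc ι R
  · exact ⟨none, h⟩
  obtain ⟨m, hm⟩ := exists_norm_gap u hR
  let K : Finset ι := Finset.univ.filter fun k => ‖u k‖ ≤ R / 2 ^ (m.val + 1)
  have hK : K ≠ Finset.univ := by
    intro hK
    apply h
    intro k _
    have : k ∈ K := by rw [hK]; exact Finset.mem_univ k
    have h1 := (Finset.mem_filter.1 this).2
    have : R / 2 ^ (m.val + 1) ≤ R := div_le_self hR.le (one_le_pow₀ (by norm_num))
    exact h1.trans this
  refine ⟨some (m, ⟨K, hK⟩), ?_, ?_⟩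
  · intro k _
    exact (Finset.mem_filter.1 k.2).2
  · intro l _
    have := l.2
    simp only [K, Finset.mem_filter, Finset.mem_univ, true_and] at this
    exact ⟨(hm l).resolve_left this, hu l trivial⟩

end

/-! ### Growth of the integrals over large polydiscs. -/

section
variable {ι : Type} [Fintype ι] [DecidableEq ι]

/-- Away from the origin the weights are bounded by pure powers, whose integral over an annulus
scales exactly. Finiteness is needed at the one radius `R₁` only, and the lower bounds on `w` serve
to carry it over to the pure powers. -/
theorem annulus_growth {e : ι → ι → ℝ} {d : ι → ℝ} {w : ι → ℂ → ℝ} (hw : ∀ k z, 0 ≤ w k z)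
    (hU : ∀ k, ∃ C, ∀ z, 2 ≤ ‖z‖ → w k z ≤ C * ‖z‖ ^ d k)
    (hL : ∀ k, ∀ R : ℝ, ∃ c, 0 < c ∧ ∀ z, 2 ≤ ‖z‖ → ‖z‖ ≤ R → c ≤ w k z)
    {R₁ : ℝ} {m : ℕ} (h2 : 2 ≤ R₁ / 2 ^ m)
    (hfin : ∫⁻ u in polyann ι (R₁ / 2 ^ m) (2 * R₁), ENNReal.ofReal (coll e w u) ≠ ⊤) :
    ∃ S : ℝ, 0 ≤ S ∧ ∀ R, R₁ ≤ R →
      ∫⁻ u in polyann ι (R / 2 ^ m) (2 * R), ENNReal.ofReal (coll e w u) ≤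
        ENNReal.ofReal (S * R ^ clusterDeg e d Finset.univ) := by
  have hp : (0 : ℝ) < 2 ^ m := by positivity
  have hR₁ : 0 < R₁ := by
    have := (le_div_iff₀ hp).1 h2
    nlinarith
  choose C hC using hU
  choose c hc0 hc using fun k => hL k (2 * R₁)
  set h : ι → ℂ → ℝ := fun k z => ‖z‖ ^ d k with hh
  have hfin2 : ∫⁻ u in polyann ι (R₁ / 2 ^ m) (2 * R₁), ENNReal.ofReal (coll e h u) ≠ ⊤ := by
    refine ne_top_of_le_ne_top (ENNReal.mul_ne_top ENNReal.ofReal_ne_top hfin)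
      (setLIntegral_coll_le (C := fun k => (2 * R₁) ^ |d k| / c k) (measurableSet_annulus _ _)
        (fun k z => by positivity) (fun k => by have := hc0 k; positivity) fun k z hz => ?_)
    have hz1 : 2 ≤ ‖z‖ := h2.trans hz.1.le
    have h1 := hc k z hz1 hz.2
    calc ‖z‖ ^ d k ≤ ‖z‖ ^ |d k| := Real.rpow_le_rpow_of_exponent_le (by linarith) (le_abs_self _)
      _ ≤ (2 * R₁) ^ |d k| := Real.rpow_le_rpow (norm_nonneg _) hz.2 (abs_nonneg _)
      _ = (2 * R₁) ^ |d k| / c k * c k := (div_mul_cancel₀ _ (hc0 k).ne').symm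
      _ ≤ _ := mul_le_mul_of_nonneg_left h1 (by have := hc0 k; positivity)
  set Y := ∫⁻ u in polyann ι (R₁ / 2 ^ m) (2 * R₁), ENNReal.ofReal (coll e h u) with hY
  refine ⟨(∏ k, |C k|) * ((R₁ ^ clusterDeg e d Finset.univ)⁻¹ * Y.toReal), by positivity, fun R hR => ?_⟩
  have hR0 : 0 < R := hR₁.trans_le hR
  have hcc : ((R / R₁ : ℝ) : ℂ) ≠ 0 := by
    exact_mod_cast (div_pos hR0 hR₁).ne'
  have hnc : ‖((R / R₁ : ℝ) : ℂ)‖ = R / R₁ := by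
    rw [Complex.norm_real, Real.norm_of_nonneg (by positivity)]
  have hsc := setLIntegral_coll_scale (e := e) (g := h) (h := h) (d := d) hcc
    (fun k z => by simp only [hh, norm_mul, Real.mul_rpow (norm_nonneg _) (norm_nonneg _)])
    (measurableSet_polyann (ι := ι) (R / 2 ^ m) (2 * R))
  rw [preimage_smul_polyann hcc, hnc,
    show R / 2 ^ m / (R / R₁) = R₁ / 2 ^ m by field_simp, show 2 * R / (R / R₁) = 2 * R₁ by field_simp] at hsc
  calc _ ≤ ENNReal.ofReal (∏ k, |C k|) * ∫⁻ u in polyann ι (R / 2 ^ m) (2 * R), ENNReal.ofReal (coll e h u) := by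
        refine setLIntegral_coll_le (measurableSet_annulus _ _) hw (fun k => abs_nonneg _) fun k z hz => ?_
        have hz1 : 2 ≤ ‖z‖ := h2.trans ((div_le_div_of_nonneg_right hR hp.le).trans hz.1.le)
        exact (hC k z hz1).trans (by gcongr; exact le_abs_self _)
    _ = ENNReal.ofReal (∏ k, |C k|) * (ENNReal.ofReal ((R / R₁) ^ clusterDeg e d Finset.univ) *
          ENNReal.ofReal Y.toReal) := by rw [hsc, ENNReal.ofReal_toReal hfin2]
    _ = _ := by
        rw [← ENNReal.ofReal_mul (by positivity), ← ENNReal.ofReal_mul (by positivity),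
          Real.div_rpow hR0.le hR₁.le]
        congr 1; ring

theorem polydisc_mono {a b : ℝ} (hab : a ≤ b) : polydisc ι a ⊆ polydisc ι b :=
  Set.pi_mono fun _ _ _ hz => le_trans hz hab

theorem splitRegion_subset_polydisc {K : Finset ι} {a b R : ℝ} (ha : a ≤ R) (hb : b ≤ R) (r : ℝ) :
    splitRegion K (polydisc _ a) (polyann _ r b) ⊆ polydisc ι R := by
  intro u hu k _
  by_cases hk : k ∈ K
  · exact (hu.1 ⟨k, hk⟩ trivial).trans ha
  · exact (hu.2 ⟨k, hk⟩ trivial).2.trans hb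

/-- A function on `[1, ∞)` that grows by at most `S R ^ D` on each dyadic step, with `D > 0`, is
`O(R ^ D)`. -/
theorem dyadic_growth {J : ℝ → ENNReal} {R₁ S D : ℝ} (hR₁ : 1 ≤ R₁) (hS : 0 ≤ S) (hD : 0 < D)
    (hmono : Monotone J) (hfin : J R₁ ≠ ⊤)
    (hstep : ∀ R, R₁ ≤ R → J (2 * R) ≤ J R + ENNReal.ofReal (S * R ^ D)) :
    ∃ C : ℝ, 0 ≤ C ∧ ∀ R, 1 ≤ R → J R ≤ ENNReal.ofReal (C * R ^ D) := by
  have h2D : (1 : ℝ) < 2 ^ D := Real.one_lt_rpow (by norm_num) hD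
  -- The second summand is the geometric series over the dyadic steps. It makes `c + S ≤ c * 2 ^ D`,
  -- the inequality that closes the induction and needs `D > 0`.
  set c := (J R₁).toReal + S / (2 ^ D - 1) with hc
  have hc0 : 0 ≤ c := add_nonneg ENNReal.toReal_nonneg (div_nonneg hS (by linarith))
  have hcS : c + S ≤ c * 2 ^ D := by
    have : S / (2 ^ D - 1) ≤ c := le_add_of_nonneg_left ENNReal.toReal_nonneg
    rw [div_le_iff₀ (by linarith)] at this
    linarith
  have hJ1 : J R₁ ≤ ENNReal.ofReal c := by
    rw [← ENNReal.ofReal_toReal hfin]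
    exact ENNReal.ofReal_le_ofReal (le_add_of_nonneg_right (div_nonneg hS (by linarith)))
  have key : ∀ j : ℕ, J (2 ^ j * R₁) ≤ ENNReal.ofReal (c * (2 ^ j * R₁) ^ D) := by
    intro j
    induction j with
    | zero =>
      simp only [pow_zero, one_mul]
      refine hJ1.trans (ENNReal.ofReal_le_ofReal ?_)
      exact le_mul_of_one_le_right hc0 (Real.one_le_rpow hR₁ hD.le)
    | succ j ih =>
      have hR : R₁ ≤ 2 ^ j * R₁ := le_mul_of_one_le_left (by linarith) (one_le_pow₀ (by norm_num))
      have h1 := hstep _ hR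
      rw [pow_succ', mul_assoc]
      refine h1.trans ((add_le_add_left ih _).trans ?_)
      rw [← ENNReal.ofReal_add (by positivity) (by positivity), ← add_mul]
      refine ENNReal.ofReal_le_ofReal ?_
      rw [Real.mul_rpow (x := 2) (by norm_num) (by positivity), ← mul_assoc]
      exact mul_le_mul_of_nonneg_right hcS (by positivity)
  refine ⟨c * 2 ^ D, by positivity, fun R hR => ?_⟩
  rcases le_total R R₁ with h | h
  · refine (hmono h).trans (hJ1.trans (ENNReal.ofReal_le_ofReal ?_))
    have := Real.one_le_rpow hR hD.le
    calc c ≤ c * 2 ^ D := le_mul_of_one_le_right hc0 h2D.le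
      _ ≤ _ := le_mul_of_one_le_right (by positivity) this
  · obtain ⟨j, hj1, hj2⟩ := exists_nat_pow_near ((one_le_div (by linarith)).2 h) (one_lt_two : (1 : ℝ) < 2)
    rw [le_div_iff₀ (by linarith)] at hj1
    rw [div_lt_iff₀ (by linarith)] at hj2
    refine (hmono hj2.le).trans ((key (j + 1)).trans (ENNReal.ofReal_le_ofReal ?_))
    rw [mul_assoc, ← Real.mul_rpow (by norm_num) (by linarith)]
    refine mul_le_mul_of_nonneg_left (Real.rpow_le_rpow (by positivity) ?_ hD.le) hc0
    rw [pow_succ']; linarith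

/-- Passing from radius `R` to `2 * R` adds finitely many near-far regions with a proper near set
`K`. The near factor is `O(R ^ deg K)` by induction on the number of variables, the far factor is
governed by `annulus_growth`, and the degrees add up to the total. Positivity of the total degree
then allows summation over dyadic radii. -/
theorem coll_growth (n : ℕ) : ∀ (ι : Type) [Fintype ι] [DecidableEq ι], Fintype.card ι = n →
    ∀ (e : ι → ι → ℝ) (d : ι → ℝ) (g : ι → ℂ → ℝ), (∀ a, e a a = 0) → (∀ k z, 0 ≤ g k z) →
    (∀ k, Measurable (g k)) → (∀ k, ∀ᵐ z, 0 < g k z) →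
    (∀ k, ∃ C, ∀ z, 2 ≤ ‖z‖ → g k z ≤ C * ‖z‖ ^ d k) →
    (∀ k, ∀ R : ℝ, ∃ c, 0 < c ∧ ∀ z, 2 ≤ ‖z‖ → ‖z‖ ≤ R → c ≤ g k z) →
    (∀ R : ℝ, ∫⁻ u in polydisc ι R, ENNReal.ofReal (coll e g u) ≠ ⊤) →
    (∀ K : Finset ι, K.Nonempty → 0 < clusterDeg e d K) →
    ∃ C : ℝ, 0 ≤ C ∧ ∀ R : ℝ, 1 ≤ R → ∫⁻ u in polydisc ι R, ENNReal.ofReal (coll e g u) ≤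
      ENNReal.ofReal (C * R ^ clusterDeg e d Finset.univ) := by
  induction n using Nat.strong_induction_on with
  | _ n IH =>
  intro ι _ _ hn e d g he hg hgm hpos hU hL hfin hdeg
  rcases isEmpty_or_nonempty ι with hι | hι
  · refine ⟨1, zero_le_one, fun R _ => ?_⟩
    have h1 : clusterDeg e d Finset.univ = 0 := by simp [clusterDeg]
    have h2 : ∀ u, coll e g u = 1 := by simp [coll]
    have h3 : volume (polydisc ι R) = 1 := by
      rw [polydisc, volume_pi_pi]; simp
    rw [h1, Real.rpow_zero]
    simp [h2, h3]
  set D := clusterDeg e d Finset.univ with hD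
  have hD0 : 0 < D := hdeg _ Finset.univ_nonempty
  -- Since `m ≤ n`, this choice keeps `R₁ / 2 ^ m ≥ 2`, where the bounds on the weights apply.
  set R₁ : ℝ := 2 ^ (n + 2) with hR₁
  have hR₁1 : 1 ≤ R₁ := one_le_pow₀ (by norm_num)
  have hpiece : ∀ p : Fin (Fintype.card ι + 1) × {K : Finset ι // K ≠ Finset.univ}, ∃ S : ℝ, 0 ≤ S ∧
      ∀ R, R₁ ≤ R → ∫⁻ u in splitRegion p.2.val (polydisc _ (R / 2 ^ (p.1.val + 1)))
          (polyann _ (R / 2 ^ p.1.val) (2 * R)), ENNReal.ofReal (coll e g u) ≤ ENNReal.ofReal (S * R ^ D) := by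
    rintro ⟨m, K, hK⟩
    have hsub : ∀ R, 0 ≤ R → splitRegion K (polydisc _ (R / 2 ^ (m.val + 1)))
          (polyann _ (R / 2 ^ m.val) (2 * R)) ⊆ polydisc ι (2 * R) := fun R hR =>
      splitRegion_subset_polydisc
        ((div_le_self hR (one_le_pow₀ (by norm_num))).trans (by linarith)) le_rfl _
    have hcond : ∀ R, 0 ≤ R → ∀ x ∈ polydisc {k // k ∈ K} (R / 2 ^ (m.val + 1)),
        ∀ y ∈ polyann {l // l ∉ K} (R / 2 ^ m.val) (2 * R), ∀ l, y l ≠ 0 ∧ ∀ k, 2 * ‖x k‖ ≤ ‖y l‖ :=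
      fun R hR => near_far_cond (by rw [pow_succ]; field_simp; rfl) (by positivity)
        (polyann_subset_polyext _ _)
    have hne : ∀ R : ℝ, 0 < R → _ := fun R hR => near_far_ne_top (e := e) he hg hgm hpos
      (measurableSet_polydisc _) (measurableSet_polyann _ _) (hcond R hR.le)
      (volume_polydisc_ne_zero (by positivity))
      (volume_polyann_ne_zero (by positivity)
        (by have : R / 2 ^ m.val ≤ R := div_le_self hR.le (one_le_pow₀ (by norm_num))
            linarith))
      (ne_top_of_le_ne_top (hfin (2 * R)) (lintegral_mono_set (hsub R hR.le)))
    have hcardK : Fintype.card {k // k ∈ K} < n := by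
      rw [Fintype.card_coe, ← hn, ← Finset.card_univ]
      exact Finset.card_lt_card (Finset.ssubset_univ_iff.2 hK)
    obtain ⟨C, hC0, hC⟩ := IH _ hcardK {k // k ∈ K} rfl (fun a b => e a b) (fun k => d k)
      (fun k => g k) (fun a => he a) (fun k z => hg k z) (fun k => hgm k) (fun k => hpos k)
      (fun k => hU k) (fun k => hL k)
      (fun R => by
        -- The outer radius is chosen so large that the near polydisc contains the given one.
        have h1 := (hne ((|R| + 1) * 2 ^ (m.val + 1)) (by positivity)).1
        refine ne_top_of_le_ne_top h1 (lintegral_mono_set (polydisc_mono ?_))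
        rw [mul_div_cancel_right₀ _ (by positivity)]
        exact (le_abs_self R).trans (by linarith))
      (fun K' hK' => by
        rw [clusterDeg_subtype]
        exact hdeg _ (by simpa using hK'))
    rw [clusterDeg_univ_subtype] at hC
    obtain ⟨S, hS0, hS⟩ := annulus_growth (e := fun a b : {l // l ∉ K} => e a b)
      (d := fun l => d l + ∑ k : {k // k ∈ K}, (e k l + e l k)) (w := farWeight e K g)
      (R₁ := R₁) (m := m.val) (fun l z => farWeight_nonneg hg l z)
      (fun l => by
        obtain ⟨C, hC⟩ := hU l
        refine ⟨C, fun z hz => ?_⟩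
        have hz0 : 0 < ‖z‖ := by linarith
        rw [Real.rpow_add hz0, ← mul_assoc]
        exact mul_le_mul_of_nonneg_right (hC z hz) (by positivity))
      (fun l R => by
        obtain ⟨c, hc0, hc⟩ := hL l R
        set E := ∑ k : {k // k ∈ K}, (e k l + e l k) with hE
        have hR3 : (0 : ℝ) < |R| + 1 := by positivity
        refine ⟨c * (|R| + 1) ^ (-|E|), by positivity, fun z hz hzR => ?_⟩
        refine mul_le_mul (hc z hz hzR) ?_ (by positivity) (hg l z)
        have hz0 : 0 < ‖z‖ := by linarith
        calc (|R| + 1) ^ (-|E|) ≤ ‖z‖ ^ (-|E|) :=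
              Real.rpow_le_rpow_of_nonpos hz0 (by linarith [le_abs_self R]) (by simp)
          _ ≤ _ := Real.rpow_le_rpow_of_exponent_le (by linarith) (neg_abs_le E))
      (by
        rw [hR₁, le_div_iff₀ (by positivity), ← pow_succ']
        exact pow_le_pow_right₀ (by norm_num) (by have := m.2; omega))
      (hne R₁ (by linarith)).2
    refine ⟨crossConst e K * (C * S), by have := crossConst_pos e K; positivity, fun R hR => ?_⟩
    have hR0 : 0 < R := by linarith
    refine (lintegral_coll_splitRegion_le (e := e) hg hgm (measurableSet_polydisc _)
      (measurableSet_polyann _ _) (hcond R hR0.le)).1.trans ?_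
    have h1 : ∫⁻ x in polydisc {k // k ∈ K} (R / 2 ^ (m.val + 1)),
        ENNReal.ofReal (coll (fun a b : {k // k ∈ K} => e a b) (fun k => g k) x) ≤
        ENNReal.ofReal (C * R ^ clusterDeg e d K) :=
      (lintegral_mono_set (polydisc_mono (div_le_self hR0.le (one_le_pow₀ (by norm_num))))).trans
        (hC R (by linarith))
    refine (mul_le_mul_right (mul_le_mul' h1 (hS R hR)) _).trans ?_
    rw [← ENNReal.ofReal_mul (by positivity), ← ENNReal.ofReal_mul (crossConst_pos e K).le]
    refine ENNReal.ofReal_le_ofReal (le_of_eq ?_)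
    rw [hD, ← clusterDeg_add_far e d K, clusterDeg_univ_subtype, Real.rpow_add hR0]
    ring
  choose S hS0 hS using hpiece
  refine dyadic_growth (J := fun R => ∫⁻ u in polydisc ι R, ENNReal.ofReal (coll e g u)) (R₁ := R₁)
    (S := ∑ p, S p) hR₁1 (Finset.sum_nonneg fun p _ => hS0 p) hD0
    (fun a b hab => lintegral_mono_set (polydisc_mono hab)) (hfin R₁) fun R hR => ?_
  have hR0 : 0 < R := by linarith
  refine (setLIntegral_le_sum_cover (shell_subset hR0) _).trans ?_
  rw [Fintype.sum_option, Finset.sum_mul, ENNReal.ofReal_sum_of_nonneg fun p _ => by have := hS0 p; positivity]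
  gcongr with p
  exact hS p R hR

end

/-! ### Necessary positivity of degrees and uniform bounds for merging base points. -/

section
variable {ι : Type} [Fintype ι] [DecidableEq ι]

/-- Convergence of a product-type integral near a point forces the degree of every cluster
at that point to be positive. -/
theorem clusterDeg_pos_of_integrable {e : ι → ι → ℝ} (he : ∀ a, e a a = 0) {p : ι → ℝ} {W : ι → ℂ → ℝ}
    (hW0 : ∀ k z, 0 ≤ W k z) (hWm : ∀ k, Measurable (W k)) (hWpos : ∀ k, ∀ᵐ z, 0 < W k z)
    {δ cL : ℝ} (hδ : 0 < δ) (hcL : 0 < cL) (hWL : ∀ k z, ‖z‖ ≤ δ → cL ≤ W k z)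
    (hfin : ∫⁻ u, ENNReal.ofReal (coll e (fun k z => ‖z‖ ^ p k * W k z) u) ≠ ⊤)
    {K : Finset ι} (hK : K.Nonempty) : 0 < clusterDeg e p K := by
  have hgm : ∀ k, Measurable fun z : ℂ => ‖z‖ ^ p k * W k z := fun k =>
    (measurable_norm.pow_const _).mul (hWm k)
  -- Keeping the variables outside `K` beyond radius `2 * δ` isolates the cluster `K`.
  have hnear := (near_far_ne_top (e := e) (g := fun k z => ‖z‖ ^ p k * W k z) (K := K) he
    (fun k z => mul_nonneg (by positivity) (hW0 k z)) hgm
    (fun k => by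
      filter_upwards [hWpos k, ae_ne 0] with z h1 h2
      have := norm_pos_iff.2 h2
      positivity)
    (measurableSet_polydisc δ) (measurableSet_polyext (2 * δ))
    (near_far_cond le_rfl (by positivity) subset_rfl)
    (volume_polydisc_ne_zero hδ) (volume_polyext_ne_zero (by positivity))
    (ne_top_of_le_ne_top hfin (setLIntegral_le_lintegral _ _))).1
  set E : K → K → ℝ := fun a b => e a b with hE
  set h : K → ℂ → ℝ := fun k z => ‖z‖ ^ p k with hh
  have hfin2 : ∫⁻ u in polydisc K δ, ENNReal.ofReal (coll E h u) ≠ ⊤ := by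
    refine ne_top_of_le_ne_top (ENNReal.mul_ne_top ENNReal.ofReal_ne_top hnear)
      (setLIntegral_coll_le (C := fun k => cL⁻¹) (measurableSet_norm_le _)
        (fun k z => by positivity) (fun k => by positivity) fun k z hz => ?_)
    have h1 := hWL k z hz
    calc ‖z‖ ^ p k = cL⁻¹ * (‖z‖ ^ p k * cL) := by field_simp
      _ ≤ _ := by gcongr
  have hcc : ((1 / 2 : ℝ) : ℂ) ≠ 0 := by exact_mod_cast (by norm_num : (1 / 2 : ℝ) ≠ 0)
  have hnc : ‖((1 / 2 : ℝ) : ℂ)‖ = 1 / 2 := by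
    rw [Complex.norm_real, Real.norm_of_nonneg (by positivity)]
  have hsc := setLIntegral_coll_scale (e := E) (g := h) (h := h) (d := fun k : K => p k) hcc
    (fun k z => by simp only [hh, norm_mul, Real.mul_rpow (norm_nonneg _) (norm_nonneg _)])
    (measurableSet_polydisc (ι := K) (δ / 2))
  rw [preimage_smul_polydisc hcc, hnc, show δ / 2 / (1 / 2) = δ by ring, clusterDeg_univ_subtype] at hsc
  -- For nonpositive degree, scaling by `1 / 2` shows that the polydisc of radius `δ / 2` carries at
  -- least as much mass as that of radius `δ`. The product of annuli between them has positive mass,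
  -- which is impossible when all is finite.
  by_contra! hD
  have h1 : (1 : ℝ) ≤ (1 / 2) ^ clusterDeg e p K :=
    Real.one_le_rpow_of_pos_of_le_one_of_nonpos (by norm_num) (by norm_num) hD
  have h2 : ∫⁻ u in polydisc K δ, ENNReal.ofReal (coll E h u) ≤
      ∫⁻ u in polydisc K (δ / 2), ENNReal.ofReal (coll E h u) := by
    rw [hsc]
    exact le_mul_of_one_le_left' (by simpa using ENNReal.ofReal_le_ofReal h1)
  obtain ⟨k₀, hk₀⟩ := hK
  have hdisj : Disjoint (polydisc K (δ / 2)) (polyann K (δ / 2) δ) := by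
    rw [Set.disjoint_left]
    intro u hu1 hu2
    exact absurd (hu1 ⟨k₀, hk₀⟩ trivial) (not_le.2 (hu2 ⟨k₀, hk₀⟩ trivial).1)
  have hun : polydisc K (δ / 2) ∪ polyann K (δ / 2) δ ⊆ polydisc K δ :=
    Set.union_subset (polydisc_mono (by linarith)) (Set.pi_mono fun _ _ z hz => hz.2)
  have h3 := lintegral_mono_set (μ := volume) (f := fun u => ENNReal.ofReal (coll E h u)) hun
  rw [lintegral_union (measurableSet_polyann _ _) hdisj] at h3
  have h4 := setLIntegral_coll_ne_zero (e := E) (g := h) (fun a => he a)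
    (fun k => measurable_norm.pow_const _)
    (fun k => by
      filter_upwards [ae_ne 0] with z h2
      have := norm_pos_iff.2 h2
      simp only [hh]; positivity)
    (volume_polyann_ne_zero (ι := K) (a := δ / 2) (b := δ) (by positivity) (by linarith))
  have h5 := ne_top_of_le_ne_top hfin2 (lintegral_mono_set (polydisc_mono (ι := K) (by linarith : δ / 2 ≤ δ)))
  have h6 := (h3.trans h2)
  exact absurd h6 (not_le.2 (ENNReal.lt_add_right h5 h4))

/-- A one-variable weight that is jointly homogeneous in the variable `z` and the parameter `ε`. -/
noncomputable def pairWeight (p p' q r : ℝ) (ε z : ℂ) : ℝ :=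
  ‖z‖ ^ p * ‖z - ε‖ ^ p' * ‖ε‖ ^ q * (‖z‖ + ‖ε‖) ^ r

section PairWeight
variable {p p' q r : ℝ}

theorem pairWeight_nonneg (ε z : ℂ) : 0 ≤ pairWeight p p' q r ε z := by
  unfold pairWeight; positivity

theorem measurable_pairWeight (ε : ℂ) : Measurable (pairWeight p p' q r ε) := by
  unfold pairWeight; fun_prop

theorem pairWeight_pos {ε z : ℂ} (h0 : ε ≠ 0) (h1 : z ≠ 0) (h2 : z ≠ ε) :
    0 < pairWeight p p' q r ε z := by
  have a0 := norm_pos_iff.2 h0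
  have a1 := norm_pos_iff.2 h1
  have a2 := norm_pos_iff.2 (sub_ne_zero.2 h2)
  unfold pairWeight; positivity

theorem pairWeight_scale {c : ℂ} (hc : c ≠ 0) (z : ℂ) :
    pairWeight p p' q r c (c * z) = ‖c‖ ^ (p + p' + q + r) * pairWeight p p' q r 1 z := by
  have h0 := norm_pos_iff.2 hc
  have h1 : c * z - c = c * (z - 1) := by ring
  have h2 : ‖c‖ * ‖z‖ + ‖c‖ = ‖c‖ * (‖z‖ + 1) := by ring
  simp only [pairWeight, h1, norm_mul, h2, norm_one, Real.one_rpow]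
  rw [Real.mul_rpow (norm_nonneg _) (norm_nonneg _), Real.mul_rpow (norm_nonneg _) (norm_nonneg _),
    Real.mul_rpow (norm_nonneg _) (by positivity), Real.rpow_add h0, Real.rpow_add h0, Real.rpow_add h0]
  ring

theorem norm_sub_comparable {ε z : ℂ} (h0 : 0 < ‖z‖) (h : 2 * ‖ε‖ ≤ ‖z‖) :
    0 < ‖z - ε‖ ∧ ‖z - ε‖ ≤ 2 * ‖z‖ ∧ ‖z‖ ≤ 2 * ‖z - ε‖ := by
  have h3 := norm_sub_le z ε
  have h4 := norm_sub_norm_le z ε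
  refine ⟨?_, ?_, ?_⟩ <;> linarith

/-- At `ε = 1` the factor `‖ε‖ ^ q` is invisible, yet the joint degree contains `q`. For `q ≥ 0` the
surplus `‖z‖ ^ q` is at least `1`. -/
theorem pairWeight_upper (hq : 0 ≤ q) : ∃ C, ∀ z : ℂ, 2 ≤ ‖z‖ →
    pairWeight p p' q r 1 z ≤ C * ‖z‖ ^ (p + p' + q + r) := by
  refine ⟨2 ^ |p'| * 2 ^ |r|, fun z hz => ?_⟩
  have h0 : 0 < ‖z‖ := by linarith
  obtain ⟨a1, a2, a3⟩ := norm_sub_comparable (ε := 1) h0 (by simpa using hz)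
  have b1 := rpow_le_two_rpow_mul a1 h0 a2 a3 p'
  have b2 := rpow_le_two_rpow_mul (x := ‖z‖ + 1) (by linarith) h0 (by linarith) (by linarith) r
  have b3 : 1 ≤ ‖z‖ ^ q := Real.one_le_rpow (by linarith) hq
  rw [Real.rpow_add h0, Real.rpow_add h0, Real.rpow_add h0]
  simp only [pairWeight, norm_one, Real.one_rpow]
  calc ‖z‖ ^ p * ‖z - 1‖ ^ p' * 1 * (‖z‖ + 1) ^ r
      ≤ ‖z‖ ^ p * (2 ^ |p'| * ‖z‖ ^ p') * ‖z‖ ^ q * (2 ^ |r| * ‖z‖ ^ r) := by gcongr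
    _ = _ := by ring

theorem pairWeight_lower (R : ℝ) : ∃ c, 0 < c ∧ ∀ z : ℂ, 2 ≤ ‖z‖ → ‖z‖ ≤ R →
    c ≤ pairWeight p p' q r 1 z := by
  have hR3 : (0 : ℝ) < |R| + 1 := by positivity
  have key : ∀ x a : ℝ, 1 ≤ x → x ≤ |R| + 1 → (|R| + 1) ^ (-|a|) ≤ x ^ a := fun x a h1 h2 =>
    (Real.rpow_le_rpow_of_nonpos (by linarith) h2 (by simp)).trans
      (Real.rpow_le_rpow_of_exponent_le h1 (neg_abs_le a))
  refine ⟨(|R| + 1) ^ (-|p|) * (|R| + 1) ^ (-|p'|) * 1 * (|R| + 1) ^ (-|r|), by positivity,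
    fun z hz hzR => ?_⟩
  have h3 := norm_sub_le z 1
  have h4 := norm_sub_norm_le z 1
  have h5 := le_abs_self R
  rw [norm_one] at h3 h4
  simp only [pairWeight, norm_one, Real.one_rpow]
  gcongr <;> apply key <;> linarith

/-- Far from both base points, the weight at a small `ε` is controlled by the weight at one fixed
reference value. This makes the far factors uniform in `ε`. -/
theorem pairWeight_le_of_norm_le (hq : 0 ≤ q) : ∃ C, 0 ≤ C ∧ ∀ ε ε' z : ℂ, 0 < ‖ε‖ → ‖ε‖ ≤ ‖ε'‖ →
    2 * ‖ε'‖ ≤ ‖z‖ → pairWeight p p' q r ε z ≤ C * pairWeight p p' q r ε' z := by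
  refine ⟨2 ^ |p'| * 2 ^ |p'| * (2 ^ |r| * 2 ^ |r|), by positivity, fun ε ε' z h0 h1 h2 => ?_⟩
  have hz : 0 < ‖z‖ := by linarith
  obtain ⟨a1, a2, a3⟩ := norm_sub_comparable (ε := ε) hz (by linarith)
  obtain ⟨b1, b2, b3⟩ := norm_sub_comparable (ε := ε') hz (by linarith)
  have c1 := rpow_le_two_rpow_mul a1 hz a2 a3 p'
  have c2 := rpow_le_two_rpow_mul hz b1 b3 b2 p'
  have c3 := rpow_le_two_rpow_mul (x := ‖z‖ + ‖ε‖) (by linarith) hz (by linarith) (by linarith) r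
  have c4 := rpow_le_two_rpow_mul (y := ‖z‖ + ‖ε'‖) hz (by linarith) (by linarith) (by linarith) r
  have c5 : ‖ε‖ ^ q ≤ ‖ε'‖ ^ q := Real.rpow_le_rpow (norm_nonneg _) h1 hq
  unfold pairWeight
  calc ‖z‖ ^ p * ‖z - ε‖ ^ p' * ‖ε‖ ^ q * (‖z‖ + ‖ε‖) ^ r
      ≤ ‖z‖ ^ p * (2 ^ |p'| * (2 ^ |p'| * ‖z - ε'‖ ^ p')) * ‖ε'‖ ^ q *
          (2 ^ |r| * (2 ^ |r| * (‖z‖ + ‖ε'‖) ^ r)) := by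
        gcongr
        · exact c1.trans (by gcongr)
        · exact c3.trans (by gcongr)
    _ = _ := by ring

end PairWeight

section Uniform
variable {e : ι → ι → ℝ} {p p' q r : ι → ℝ} {W : ι → ℂ → ℝ}

theorem polydisc_pairWeight {κ : Type} [Fintype κ] [DecidableEq κ] (e : κ → κ → ℝ) (p p' q r : κ → ℝ)
    {ε : ℂ} (hε : ε ≠ 0) (a : ℝ) :
    ∫⁻ u in polydisc κ a, ENNReal.ofReal (coll e (fun k => pairWeight (p k) (p' k) (q k) (r k) ε) u) =
      ENNReal.ofReal (‖ε‖ ^ clusterDeg e (fun k => p k + p' k + q k + r k) Finset.univ) *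
        ∫⁻ u in polydisc κ (a / ‖ε‖),
          ENNReal.ofReal (coll e (fun k => pairWeight (p k) (p' k) (q k) (r k) 1) u) := by
  rw [setLIntegral_coll_scale hε (fun k z => pairWeight_scale hε z) (measurableSet_polydisc a),
    preimage_smul_polydisc hε]

/-- Uniform boundedness of product-type integrals in which the base points `0` and `ε` collide. -/
theorem coll_uniform_bound (he : ∀ a, e a a = 0) (hq : ∀ k, 0 ≤ q k)
    (hW0 : ∀ k z, 0 ≤ W k z) (hWm : ∀ k, Measurable (W k)) (hWpos : ∀ k, ∀ᵐ z, 0 < W k z)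
    {δ cL CU : ℝ} (hδ : 0 < δ) (hcL : 0 < cL) (hWL : ∀ k z, ‖z‖ ≤ δ → cL ≤ W k z)
    (hWU : ∀ k z, ‖z‖ ≤ δ → W k z ≤ CU) {ε₀ : ℝ} (hε₀ : 0 < ε₀)
    (hfin : ∀ ε : ℂ, ε ≠ 0 → ‖ε‖ < ε₀ → ∫⁻ u, ENNReal.ofReal
      (coll e (fun k z => pairWeight (p k) (p' k) (q k) (r k) ε z * W k z) u) ≠ ⊤)
    (hdeg : ∀ K : Finset ι, K.Nonempty → 0 < clusterDeg e (fun k => p k + p' k + q k + r k) K) :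
    ∃ C : ℝ, ∀ᶠ ε in 𝓝[≠] (0 : ℂ), ∫⁻ u, ENNReal.ofReal
      (coll e (fun k z => pairWeight (p k) (p' k) (q k) (r k) ε z * W k z) u) ≤ ENNReal.ofReal C := by
  set g : ℂ → ι → ℂ → ℝ := fun ε k z => pairWeight (p k) (p' k) (q k) (r k) ε z * W k z with hg
  have hg0 : ∀ ε k z, 0 ≤ g ε k z := fun ε k z => mul_nonneg (pairWeight_nonneg _ _) (hW0 k z)
  have hgm : ∀ ε k, Measurable (g ε k) := fun ε k => (measurable_pairWeight ε).mul (hWm k)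
  have hgpos : ∀ ε, ε ≠ 0 → ∀ k, ∀ᵐ z, 0 < g ε k z := fun ε hε k => by
    filter_upwards [hWpos k, ae_ne 0, ae_ne ε] with z h1 h2 h3
    exact mul_pos (pairWeight_pos hε h2 h3) h1
  -- It suffices to bound each near-far region: the far factor by comparison with a reference
  -- parameter, the near factor by rescaling to `ε = 1`.
  have hpiece : ∀ x : Fin (Fintype.card ι + 1) × Finset ι, ∃ S : ℝ, 0 ≤ S ∧ ∀ᶠ ε in 𝓝[≠] (0 : ℂ),
      ∫⁻ u in splitRegion x.2 (polydisc _ (δ / 2 ^ (x.1.val + 1))) (polyext _ (δ / 2 ^ x.1.val)),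
        ENNReal.ofReal (coll e (g ε) u) ≤ ENNReal.ofReal S := by
    rintro ⟨m, K⟩
    set a := δ / 2 ^ (m.val + 1) with ha
    set b := δ / 2 ^ m.val with hb
    have hab : 2 * a = b := by rw [ha, hb, pow_succ]; field_simp
    have ha0 : 0 < a := by positivity
    have haδ : a ≤ δ := div_le_self hδ.le (one_le_pow₀ (by norm_num))
    have hcond := near_far_cond (K := K) (a := a) (b := b) hab.le (by positivity) subset_rfl
    have hne : ∀ ε : ℂ, ε ≠ 0 → ‖ε‖ < ε₀ → _ := fun ε h1 h2 => near_far_ne_top (e := e) (K := K) he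
      (hg0 ε) (hgm ε) (hgpos ε h1) (measurableSet_polydisc a) (measurableSet_polyext b) hcond
      (volume_polydisc_ne_zero ha0) (volume_polyext_ne_zero (by positivity))
      (ne_top_of_le_ne_top (hfin ε h1 h2) (setLIntegral_le_lintegral _ _))
    set E : K → K → ℝ := fun a b => e a b with hE
    set w : ℂ → K → ℂ → ℝ := fun ε k => pairWeight (p k) (p' k) (q k) (r k) ε with hw
    have hnearW : ∀ ε : ℂ, ε ≠ 0 → ‖ε‖ < ε₀ → ∫⁻ u in polydisc K a, ENNReal.ofReal (coll E (w ε) u) ≠ ⊤ := by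
      intro ε h1 h2
      refine ne_top_of_le_ne_top (ENNReal.mul_ne_top ENNReal.ofReal_ne_top (hne ε h1 h2).1)
        (setLIntegral_coll_le (C := fun k => cL⁻¹) (measurableSet_norm_le _)
          (fun k z => pairWeight_nonneg _ _) (fun k => by positivity) fun k z hz => ?_)
      have h3 := hWL k z (hz.trans haδ)
      have h4 : 0 ≤ w ε k z := pairWeight_nonneg _ _
      calc w ε k z = cL⁻¹ * (w ε k z * cL) := by field_simp
        _ ≤ cL⁻¹ * (w ε k z * W k z) := by gcongr
    have hfinR : ∀ R : ℝ, ∫⁻ u in polydisc K R, ENNReal.ofReal (coll E (w 1) u) ≠ ⊤ := by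
      intro R
      -- Scaling read backwards: the polydisc of radius `a` at parameter `η` corresponds to radius
      -- `a / η ≥ R` at parameter `1`, so convergence for small parameters gives finiteness for
      -- every radius.
      set η := min (ε₀ / 2) (a / (|R| + 1)) with hη
      have hη0 : 0 < η := lt_min (by positivity) (by positivity)
      have hηn : ‖(η : ℂ)‖ = η := by rw [Complex.norm_real, Real.norm_of_nonneg hη0.le]
      have hηc : (η : ℂ) ≠ 0 := by exact_mod_cast hη0.ne'
      have h1 := hnearW η hηc (by rw [hηn]; exact (min_le_left _ _).trans_lt (by linarith))
      rw [hw, polydisc_pairWeight E _ _ _ _ hηc, hηn] at h1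
      have h2 : ENNReal.ofReal (η ^ clusterDeg E (fun k : K => p k + p' k + q k + r k) Finset.univ) ≠ 0 := by
        rw [Ne, ENNReal.ofReal_eq_zero, not_le]; positivity
      have h3 : ∫⁻ u in polydisc K (a / η), ENNReal.ofReal (coll E (w 1) u) ≠ ⊤ := by
        intro ht
        rw [hw] at ht
        rw [ht, ENNReal.mul_top h2] at h1
        exact h1 rfl
      refine ne_top_of_le_ne_top h3 (lintegral_mono_set (polydisc_mono ?_))
      rw [le_div_iff₀ hη0]
      calc R * η ≤ (|R| + 1) * η := by gcongr; linarith [le_abs_self R]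
        _ ≤ (|R| + 1) * (a / (|R| + 1)) := by gcongr; exact min_le_right _ _
        _ = a := by field_simp
    obtain ⟨C, hC0, hC⟩ := coll_growth _ K rfl E (fun k => p k + p' k + q k + r k) (w 1) (fun a => he a)
      (fun k z => pairWeight_nonneg _ _) (fun k => measurable_pairWeight _)
      (fun k => by
        filter_upwards [ae_ne 0, ae_ne 1] with z h1 h2
        exact pairWeight_pos one_ne_zero h1 h2)
      (fun k => pairWeight_upper (hq k)) (fun k R => pairWeight_lower R) hfinR
      (fun K' hK' => by
        rw [hE, clusterDeg_subtype (d := fun k => p k + p' k + q k + r k)]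
        exact hdeg _ (by simpa using hK'))
    set D := clusterDeg E (fun k : K => p k + p' k + q k + r k) Finset.univ with hD
    -- A reference parameter at which the far integral is finite. As `η ≤ a`, far variables exceed
    -- `b = 2 * a ≥ 2 * η`, so the weights for all smaller `ε` are comparable.
    set η := min (ε₀ / 2) a with hη
    have hη0 : 0 < η := lt_min (by positivity) ha0
    have hηn : ‖(η : ℂ)‖ = η := by rw [Complex.norm_real, Real.norm_of_nonneg hη0.le]
    have hηc : (η : ℂ) ≠ 0 := by exact_mod_cast hη0.ne'
    have hY := (hne η hηc (by rw [hηn]; exact (min_le_left _ _).trans_lt (by linarith))).2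
    set Y := ∫⁻ y in polyext {l // l ∉ K} b,
      ENNReal.ofReal (coll (fun a b : {l // l ∉ K} => e a b) (farWeight e K (g η)) y) with hYdef
    choose M hM0 hM using fun k => pairWeight_le_of_norm_le (p := p k) (p' := p' k) (r := r k) (hq k)
    refine ⟨crossConst e K * ((∏ k : K, |CU|) * (C * a ^ D) * ((∏ l : {l // l ∉ K}, M l) * Y.toReal)),
      ?_, ?_⟩
    · have := (crossConst_pos e K).le
      have := Finset.prod_nonneg fun (l : {l // l ∉ K}) (_ : l ∈ Finset.univ) => hM0 l
      positivity
    have hnhds : Metric.closedBall (0 : ℂ) η ∈ 𝓝[≠] (0 : ℂ) :=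
      mem_nhdsWithin_of_mem_nhds (Metric.closedBall_mem_nhds _ hη0)
    filter_upwards [hnhds, self_mem_nhdsWithin] with ε hε hεne
    have hεne : ε ≠ 0 := hεne
    have hεη : ‖ε‖ ≤ η := by simpa using hε
    have hε0 := norm_pos_iff.2 hεne
    refine (lintegral_coll_splitRegion_le (e := e) (K := K) (hg0 ε) (hgm ε) (measurableSet_polydisc a)
      (measurableSet_polyext b) hcond).1.trans ?_
    -- Rescaling produces `‖ε‖ ^ D`, and growth over the polydisc of radius `a / ‖ε‖` produces `(a /
    -- ‖ε‖) ^ D`. The powers of `‖ε‖` cancel.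
    have hX : ∫⁻ x in polydisc K a, ENNReal.ofReal (coll E (fun k => g ε k) x) ≤
        ENNReal.ofReal (∏ k : K, |CU|) * ENNReal.ofReal (C * a ^ D) := by
      refine (setLIntegral_coll_le (h := w ε) (C := fun _ => |CU|) (measurableSet_norm_le _)
        (fun k z => hg0 ε k z) (fun k => abs_nonneg _) fun k z hz => ?_).trans ?_
      · have h3 := (hWU k z (hz.trans haδ)).trans (le_abs_self CU)
        have h4 : 0 ≤ w ε k z := pairWeight_nonneg _ _
        calc w ε k z * W k z ≤ w ε k z * |CU| := by gcongr
          _ = _ := mul_comm _ _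
      · refine mul_le_mul_right ?_ _
        have := polydisc_pairWeight E (fun k : K => p k) (fun k : K => p' k) (fun k : K => q k)
          (fun k : K => r k) hεne a
        rw [polydisc] at this
        rw [this]
        refine (mul_le_mul_right (hC (a / ‖ε‖) ((one_le_div hε0).2 (hεη.trans (min_le_right _ _)))) _).trans ?_
        rw [← ENNReal.ofReal_mul (by positivity), Real.div_rpow ha0.le hε0.le]
        refine ENNReal.ofReal_le_ofReal (le_of_eq ?_)
        have : ‖ε‖ ^ D ≠ 0 := by positivity
        rw [← hD]
        field_simp
    have hYε : ∫⁻ y in polyext {l // l ∉ K} b,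
        ENNReal.ofReal (coll (fun a b : {l // l ∉ K} => e a b) (farWeight e K (g ε)) y) ≤
        ENNReal.ofReal (∏ l : {l // l ∉ K}, M l) * ENNReal.ofReal Y.toReal := by
      rw [ENNReal.ofReal_toReal hY]
      refine setLIntegral_coll_le (C := fun l : {l // l ∉ K} => M l) (measurableSet_lt_norm _)
        (fun k z => farWeight_nonneg (hg0 ε) k z) (fun k => hM0 k) fun l z hz => ?_
      have hz' : b < ‖z‖ := hz
      have h1 := hM l ε η z hε0 (by rw [hηn]; exact hεη)
        (by rw [hηn]; have : η ≤ a := min_le_right _ _; linarith)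
      calc pairWeight (p l) (p' l) (q l) (r l) ε z * W l z * ‖z‖ ^ (∑ k : K, (e k l + e l k))
          ≤ (M l * pairWeight (p l) (p' l) (q l) (r l) η z) * W l z * ‖z‖ ^ (∑ k : K, (e k l + e l k)) := by
            gcongr; exact hW0 _ _
        _ = _ := by simp only [farWeight, hg]; ring
    have hMp : 0 ≤ ∏ l : {l // l ∉ K}, M l :=
      Finset.prod_nonneg fun (l : {l // l ∉ K}) (_ : l ∈ Finset.univ) => hM0 l
    refine (mul_le_mul_right (mul_le_mul' hX hYε) _).trans (le_of_eq ?_)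
    rw [← ENNReal.ofReal_mul hMp, ← ENNReal.ofReal_mul (by positivity),
      ← ENNReal.ofReal_mul (by positivity), ← ENNReal.ofReal_mul (crossConst_pos e K).le]
  choose S hS0 hS using hpiece
  refine ⟨∑ x, S x, ?_⟩
  filter_upwards [eventually_all.2 hS] with ε hε
  rw [← setLIntegral_univ]
  refine (setLIntegral_le_sum_cover (iUnion_splitRegion_polyext hδ) _).trans ?_
  rw [ENNReal.ofReal_sum_of_nonneg fun x _ => hS0 x]
  exact Finset.sum_le_sum fun x _ => hε x

end Uniform

end

/-! ### Lowering exponents and passage to the limit under the integral. -/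

section
variable {ι : Type} [Fintype ι] [DecidableEq ι]

theorem tendsto_coll {β : Type} {l : Filter β} {e : ι → ι → ℝ} {g : β → ι → ℂ → ℝ} {h : ι → ℂ → ℝ}
    {u : ι → ℂ} (H : ∀ k, Tendsto (fun b => g b k (u k)) l (𝓝 (h k (u k)))) :
    Tendsto (fun b => coll e (g b) u) l (𝓝 (coll e h u)) :=
  tendsto_const_nhds.mul (tendsto_finsetProd _ fun k _ => H k)

/-- Fatou's lemma along a sequence extracted from the countably generated filter. -/
theorem lintegral_le_of_tendsto_ae {α β : Type} [MeasurableSpace α] {μ : Measure α} {l : Filter β} [l.NeBot]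
    [l.IsCountablyGenerated] {F : β → α → ENNReal} {f : α → ENNReal} {C : ENNReal}
    (hm : ∀ b, Measurable (F b)) (hC : ∀ᶠ b in l, ∫⁻ x, F b x ∂μ ≤ C)
    (hlim : ∀ᵐ x ∂μ, Tendsto (fun b => F b x) l (𝓝 (f x))) : ∫⁻ x, f x ∂μ ≤ C := by
  obtain ⟨v, hv⟩ := l.exists_seq_tendsto
  calc ∫⁻ x, f x ∂μ = ∫⁻ x, liminf (fun n => F (v n) x) atTop ∂μ := by
        refine lintegral_congr_ae ?_
        filter_upwards [hlim] with x hx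
        exact (hx.comp hv).liminf_eq.symm
    _ ≤ liminf (fun n => ∫⁻ x, F (v n) x ∂μ) atTop := lintegral_liminf_le fun n => hm (v n)
    _ ≤ C := by
        have h := hv.eventually hC
        exact (liminf_le_liminf h).trans (by simp)

/-- Two-sided bounds for powers of the distance to a point of modulus one, near the origin. -/
theorem exists_norm_add_rpow_bounds (α : ι → ℝ) : ∃ cL CU : ℝ, 0 < cL ∧ ∀ k (w z : ℂ), ‖w‖ = 1 →
    ‖z‖ ≤ 1 / 2 → cL ≤ ‖z + w‖ ^ α k ∧ ‖z + w‖ ^ α k ≤ CU := by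
  set A := ∑ k, |α k| with hA
  have hAk : ∀ k, |α k| ≤ A := fun k =>
    Finset.single_le_sum (f := fun k => |α k|) (fun _ _ => abs_nonneg _) (Finset.mem_univ k)
  refine ⟨2 ^ (-A), 2 ^ A, by positivity, fun k w z hw hz => ?_⟩
  have h3 := norm_sub_norm_le w (-z)
  have h4 := norm_add_le z w
  rw [sub_neg_eq_add, norm_neg, add_comm w z, hw] at h3
  rw [hw] at h4
  have h5 := rpow_le_two_rpow_mul (x := ‖z + w‖) (y := 1) (by linarith) one_pos (by linarith) (by linarith) (α k)
  have h6 := rpow_le_two_rpow_mul (y := ‖z + w‖) (x := 1) one_pos (by linarith) (by linarith) (by linarith) (α k)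
  rw [Real.one_rpow] at h5 h6
  have h7 : (2 : ℝ) ^ |α k| ≤ 2 ^ A := Real.rpow_le_rpow_of_exponent_le (by norm_num) (hAk k)
  constructor
  · rw [Real.rpow_neg (by norm_num), inv_le_iff_one_le_mul₀' (by positivity)]
    exact h6.trans (by gcongr)
  · linarith

/-- The exponents at a point may be lowered from `P + σ` to `P` if all clusters keep positive degree;
the decay at infinity is not affected. -/
theorem coll_lower_exponents {e : ι → ι → ℝ} (he : ∀ a, e a a = 0) {α P : ι → ℝ} {σ : ℝ} (hσ : 0 ≤ σ)
    (hdeg : ∀ K : Finset ι, K.Nonempty → 0 < clusterDeg e P K)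
    (hfin : ∫⁻ u, ENNReal.ofReal (coll e (fun k z => ‖z‖ ^ (P k + σ) * ‖z + 1‖ ^ α k) u) ≠ ⊤) :
    ∫⁻ u, ENNReal.ofReal (coll e (fun k z => ‖z‖ ^ P k * (‖z + 1‖ ^ α k * (1 + ‖z‖) ^ σ)) u) ≠ ⊤ := by
  set W : ι → ℂ → ℝ := fun k z => ‖z + 1‖ ^ α k * (1 + ‖z‖) ^ σ with hW
  have hW0 : ∀ k z, 0 ≤ W k z := fun k z => by positivity
  have hWm : ∀ k, Measurable (W k) := fun k => by simp only [hW]; fun_prop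
  have hWpos : ∀ k, ∀ᵐ z, 0 < W k z := fun k => by
    filter_upwards [ae_ne (-1)] with z hz
    have : 0 < ‖z + 1‖ := norm_pos_iff.2 fun h => hz (by linear_combination h)
    positivity
  obtain ⟨cL, CU, hcL, hnear⟩ := exists_norm_add_rpow_bounds α
  -- The weight `‖z‖ ^ (P + σ) * (‖z‖ + ‖ε‖) ^ (-σ)` has joint degree `P` and converges to `‖z‖ ^
  -- P`. For fixed `ε` it stays integrable, since `‖ε‖ * (1 + ‖z‖) ≤ ‖z‖ + ‖ε‖` when `‖ε‖ < 1`. The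
  -- uniform bound followed by Fatou's lemma then removes `ε`.
  have hfin' : ∀ ε : ℂ, ε ≠ 0 → ‖ε‖ < 1 → ∫⁻ u, ENNReal.ofReal
      (coll e (fun k z => pairWeight (P k + σ) 0 0 (-σ) ε z * W k z) u) ≠ ⊤ := by
    intro ε h1 h2
    have h0 := norm_pos_iff.2 h1
    refine ne_top_of_le_ne_top (ENNReal.mul_ne_top (ENNReal.ofReal_ne_top (r := ∏ k : ι, ‖ε‖ ^ (-σ))) hfin) ?_
    rw [← lintegral_const_mul' _ _ ENNReal.ofReal_ne_top]
    refine lintegral_mono fun u => ?_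
    rw [← ENNReal.ofReal_mul (by positivity)]
    refine ENNReal.ofReal_le_ofReal (coll_le_prod_mul
      (fun k z => mul_nonneg (pairWeight_nonneg _ _) (hW0 k z)) fun k => ?_)
    set z := u k
    simp only [pairWeight, Real.rpow_zero, mul_one, hW]
    have h4 : (‖z‖ + ‖ε‖) ^ (-σ) * (1 + ‖z‖) ^ σ ≤ ‖ε‖ ^ (-σ) := by
      rw [Real.rpow_neg (by positivity), Real.rpow_neg (by positivity), inv_mul_le_iff₀ (by positivity),
        ← div_eq_mul_inv, le_div_iff₀ (by positivity), ← Real.mul_rpow (by positivity) (by positivity)]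
      refine Real.rpow_le_rpow (by positivity) ?_ hσ
      nlinarith [norm_nonneg z]
    calc ‖z‖ ^ (P k + σ) * (‖z‖ + ‖ε‖) ^ (-σ) * (‖z + 1‖ ^ α k * (1 + ‖z‖) ^ σ)
        = (‖z‖ ^ (P k + σ) * ‖z + 1‖ ^ α k) * ((‖z‖ + ‖ε‖) ^ (-σ) * (1 + ‖z‖) ^ σ) := by ring
      _ ≤ (‖z‖ ^ (P k + σ) * ‖z + 1‖ ^ α k) * ‖ε‖ ^ (-σ) := by gcongr
      _ = _ := by ring
  obtain ⟨C, hC⟩ := coll_uniform_bound (p := fun k => P k + σ) (p' := fun _ => 0) (q := fun _ => 0)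
    (r := fun _ => -σ) he (fun _ => le_rfl) hW0 hWm hWpos (δ := 1 / 2) (cL := cL) (CU := CU * 2 ^ σ)
    (by norm_num) hcL
    (fun k z hz => by
      have h1 := (hnear k 1 z norm_one hz).1
      have h2 : 1 ≤ (1 + ‖z‖) ^ σ := Real.one_le_rpow (by linarith [norm_nonneg z]) hσ
      exact h1.trans (le_mul_of_one_le_right (by positivity) h2))
    (fun k z hz => mul_le_mul (hnear k 1 z norm_one hz).2
      (Real.rpow_le_rpow (by positivity) (by linarith) hσ) (by positivity)
      ((hcL.trans_le (hnear k 1 z norm_one hz).1).le.trans (hnear k 1 z norm_one hz).2))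
    one_pos hfin'
    (fun K hK => by simpa using hdeg K hK)
  refine ne_top_of_le_ne_top ENNReal.ofReal_ne_top (lintegral_le_of_tendsto_ae (C := ENNReal.ofReal C)
    (F := fun ε u => ENNReal.ofReal (coll e (fun k z => pairWeight (P k + σ) 0 0 (-σ) ε z * W k z) u)) (fun ε =>
    (measurable_coll fun k => (measurable_pairWeight ε).mul (hWm k)).ennreal_ofReal) hC ?_)
  have hae : ∀ᵐ u : ι → ℂ, ∀ k, u k ≠ 0 := ae_all_iff.2 fun k => ae_apply_of_ae k (ae_ne 0)
  filter_upwards [hae] with u hu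
  refine ENNReal.tendsto_ofReal (tendsto_coll fun k => ?_)
  have h0 := norm_pos_iff.2 (hu k)
  have h1 : Tendsto (fun ε : ℂ => (‖u k‖ + ‖ε‖) ^ (-σ)) (𝓝[≠] 0) (𝓝 (‖u k‖ ^ (-σ))) := by
    have : ContinuousAt (fun ε : ℂ => (‖u k‖ + ‖ε‖) ^ (-σ)) 0 :=
      (by fun_prop : ContinuousAt (fun ε : ℂ => ‖u k‖ + ‖ε‖) 0).rpow_const (Or.inl (by simpa using hu k))
    have h2 := this.tendsto.mono_left (nhdsWithin_le_nhds (s := {0}ᶜ))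
    simpa using h2
  have h3 := (h1.const_mul (‖u k‖ ^ (P k + σ))).mul_const (W k (u k))
  rw [← Real.rpow_add h0, add_neg_cancel_right] at h3
  simpa only [pairWeight, Real.rpow_zero, mul_one] using h3

/-- A limit theorem for integrals that are dominated away from a set on which
they are uniformly small. -/
theorem tendsto_integral_of_uniform_tails {α β : Type} [MeasurableSpace α] {μ : Measure α} {l : Filter β}
    [l.NeBot] [l.IsCountablyGenerated] {F : β → α → ℂ} {f : α → ℂ} (hm : ∀ b, Measurable (F b))
    (hfm : Measurable f)
    (hlim : ∀ᵐ x ∂μ, Tendsto (fun b => F b x) l (𝓝 (f x)))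
    (htail : ∀ η : ℝ, 0 < η → ∃ A : Set α, MeasurableSet A ∧
      (∀ᶠ b in l, ∫⁻ x in Aᶜ, ‖F b x‖ₑ ∂μ ≤ ENNReal.ofReal η) ∧
      ∃ B : α → ℝ, Integrable B (μ.restrict A) ∧ ∀ᶠ b in l, ∀ᵐ x ∂μ.restrict A, ‖F b x‖ ≤ B x) :
    Integrable f μ ∧ Tendsto (fun b => ∫ x, F b x ∂μ) l (𝓝 (∫ x, f x ∂μ)) := by
  -- By Fatou's lemma the limit function inherits the small tails.
  have hcompl : ∀ η : ℝ, ∀ A : Set α, MeasurableSet A →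
      (∀ᶠ b in l, ∫⁻ x in Aᶜ, ‖F b x‖ₑ ∂μ ≤ ENNReal.ofReal η) → ∫⁻ x in Aᶜ, ‖f x‖ₑ ∂μ ≤ ENNReal.ofReal η := by
    intro η A hA h
    refine lintegral_le_of_tendsto_ae (fun b => (hm b).enorm) h ?_
    filter_upwards [ae_restrict_of_ae hlim] with x hx
    exact (continuous_enorm.tendsto _).comp hx
  have hA_int : ∀ A : Set α, (∃ B : α → ℝ, Integrable B (μ.restrict A) ∧ ∀ᶠ b in l, ∀ᵐ x ∂μ.restrict A, ‖F b x‖ ≤ B x) →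
      IntegrableOn f A μ ∧ Tendsto (fun b => ∫ x in A, F b x ∂μ) l (𝓝 (∫ x in A, f x ∂μ)) ∧
      ∀ᶠ b in l, IntegrableOn (F b) A μ := by
    rintro A ⟨B, hB, hFB⟩
    refine ⟨?_, tendsto_integral_filter_of_dominated_convergence B
      (Eventually.of_forall fun b => (hm b).aestronglyMeasurable) hFB hB (ae_restrict_of_ae hlim), ?_⟩
    · obtain ⟨v, hv⟩ := l.exists_seq_tendsto
      obtain ⟨N, hN⟩ := eventually_atTop.1 (hv.eventually hFB)
      refine hB.mono' hfm.aestronglyMeasurable ?_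
      have h1 : ∀ᵐ x ∂μ.restrict A, ∀ n, N ≤ n → ‖F (v n) x‖ ≤ B x := by
        rw [ae_all_iff]; intro n
        by_cases hn : N ≤ n
        · filter_upwards [hN n hn] with x hx _ using hx
        · exact Eventually.of_forall fun x h => absurd h hn
      filter_upwards [h1, ae_restrict_of_ae hlim] with x hx hxl
      refine le_of_tendsto (hxl.comp hv).norm ?_
      filter_upwards [eventually_ge_atTop N] with n hn using hx n hn
    · filter_upwards [hFB] with b hb
      exact hB.mono' (hm b).aestronglyMeasurable hb
  have hint : Integrable f μ := by
    obtain ⟨A, hA, h1, h2⟩ := htail 1 one_pos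
    have h3 : IntegrableOn f Aᶜ μ :=
      ⟨hfm.aestronglyMeasurable, (hcompl 1 A hA h1).trans_lt ENNReal.ofReal_lt_top⟩
    have := (hA_int A h2).1.union h3
    rwa [Set.union_compl_self, integrableOn_univ] at this
  refine ⟨hint, Metric.tendsto_nhds.2 fun η hη => ?_⟩
  -- One quarter for the convergence on `A`, one quarter for each of the two tails.
  obtain ⟨A, hA, h1, h2⟩ := htail (η / 4) (by positivity)
  obtain ⟨-, h3, h4⟩ := hA_int A h2
  have hb : ∀ φ : α → ℂ, ∫⁻ x in Aᶜ, ‖φ x‖ₑ ∂μ ≤ ENNReal.ofReal (η / 4) → ‖∫ x in Aᶜ, φ x ∂μ‖ ≤ η / 4 := by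
    intro φ hφ
    have := (enorm_integral_le_lintegral_enorm (μ := μ.restrict Aᶜ) φ).trans hφ
    rwa [← ofReal_norm, ENNReal.ofReal_le_ofReal_iff (by positivity)] at this
  have hf4 := hb f (hcompl _ A hA h1)
  filter_upwards [h1, h4, Metric.tendsto_nhds.1 h3 (η / 4) (by positivity)] with b hb1 hb2 hb3
  have hFint : Integrable (F b) μ := by
    have h3 : IntegrableOn (F b) Aᶜ μ :=
      ⟨(hm b).aestronglyMeasurable, hb1.trans_lt ENNReal.ofReal_lt_top⟩
    have := hb2.union h3
    rwa [Set.union_compl_self, integrableOn_univ] at this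
  rw [← integral_add_compl hA hFint, ← integral_add_compl hA hint]
  calc _ ≤ _ := dist_add_add_le _ _ _ _
    _ < η := by
      have h5 : dist (∫ x in Aᶜ, F b x ∂μ) (∫ x in Aᶜ, f x ∂μ) ≤ η / 4 + η / 4 := by
        rw [dist_eq_norm]
        exact (norm_sub_le _ _).trans (add_le_add (hb _ hb1) hf4)
      linarith

end

/-! ### Complex powers of the modulus and the common kernel. -/

theorem absPow_zero_right (x : ℂ) : absPow x 0 = 1 := by simp [absPow]

theorem absPow_of_norm_eq_one {x : ℂ} (hx : ‖x‖ = 1) (a : ℂ) : absPow x a = 1 := by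
  simp [absPow, hx]

theorem absPow_congr {x y : ℂ} (h : ‖x‖ = ‖y‖) (a : ℂ) : absPow x a = absPow y a := by
  simp [absPow, h]

theorem absPow_mul (x y a : ℂ) : absPow (x * y) a = absPow x a * absPow y a := by
  simp only [absPow, norm_mul, ofReal_mul]
  exact mul_cpow_ofReal_nonneg (norm_nonneg _) (norm_nonneg _) _

theorem absPow_add {x : ℂ} (hx : x ≠ 0) (a b : ℂ) : absPow x (a + b) = absPow x a * absPow x b := by
  rw [absPow, mul_add, cpow_add _ _ (by simpa using hx)]; rfl

theorem absPow_sum {κ : Type} {x : ℂ} (hx : x ≠ 0) (S : Finset κ) (a : κ → ℂ) :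
    absPow x (∑ k ∈ S, a k) = ∏ k ∈ S, absPow x (a k) := by
  classical
  induction S using Finset.induction_on with
  | empty => simp [absPow_zero_right]
  | insert k S hk ih => rw [Finset.sum_insert hk, Finset.prod_insert hk, absPow_add hx, ih]

theorem norm_absPow {x : ℂ} (hx : x ≠ 0) (a : ℂ) : ‖absPow x a‖ = ‖x‖ ^ (2 * a.re) := by
  rw [absPow, norm_cpow_eq_rpow_re_of_pos (norm_pos_iff.2 hx)]
  simp

theorem measurable_absPow (a : ℂ) : Measurable fun x => absPow x a := by
  unfold absPow
  exact (measurable_ofReal.comp measurable_norm).pow_const _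

theorem continuousAt_absPow {x : ℂ} (hx : x ≠ 0) (a : ℂ) : ContinuousAt (fun x => absPow x a) x := by
  unfold absPow
  refine ContinuousAt.cpow (by fun_prop) continuousAt_const ?_
  simp [slitPlane, hx]

theorem tendsto_absPow {β : Type} {l : Filter β} {f : β → ℂ} {x : ℂ} (h : Tendsto f l (𝓝 x)) (hx : x ≠ 0)
    (a : ℂ) : Tendsto (fun b => absPow (f b) a) l (𝓝 (absPow x a)) :=
  (continuousAt_absPow hx a).tendsto.comp h

/-- The common form of all integrands: the fixed points are `0`, `p 2` and `p 3`, with exponents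
`s 1 k`, `σ₂ k` and `σ₃ k`. -/
noncomputable def selbergKernel (L : ℕ) (i : ℕ → ℕ) (s : ℕ → ℕ → ℂ) (σ₂ σ₃ : ℕ → ℂ) (p : ℕ → ℂ)
    (x : Finset.Icc 4 L → ℂ) : ℂ :=
  1 / conj (points 4 L p x L) *
    (∏ a ∈ Finset.Icc 4 L, ∏ b ∈ Finset.Ioc a L, absPow (points 4 L p x a - points 4 L p x b) (s a b)) *
    ∏ k ∈ Finset.Icc 4 L, (absPow (points 4 L p x k) (s 1 k) * absPow (points 4 L p x k - p 2) (σ₂ k) *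
      absPow (points 4 L p x k - p 3) (σ₃ k) *
      (1 / ((points 4 L p x k - points 4 L p x (i k)) * conj (points 4 L p x k - points 4 L p x (k - 1)))))

theorem points_of_mem {a L k : ℕ} (h : k ∈ Finset.Icc a L) (p : ℕ → ℂ) (x : Finset.Icc a L → ℂ) :
    points a L p x k = x ⟨k, h⟩ := dif_pos h

theorem points_of_notMem {a L k : ℕ} (h : k ∉ Finset.Icc a L) (p : ℕ → ℂ) (x : Finset.Icc a L → ℂ) :
    points a L p x k = p k := dif_neg h

theorem Icc_one_eq_insert {L : ℕ} (hL : 4 ≤ L) :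
    Finset.Icc 1 L = insert 1 (insert 2 (insert 3 (Finset.Icc 4 L))) := by
  ext a; simp only [Finset.mem_insert, Finset.mem_Icc]; omega

theorem prod_Icc_one {L : ℕ} (hL : 4 ≤ L) (f : ℕ → ℂ) :
    ∏ a ∈ Finset.Icc 1 L, f a = f 1 * f 2 * f 3 * ∏ a ∈ Finset.Icc 4 L, f a := by
  rw [Icc_one_eq_insert hL, Finset.prod_insert (by simp), Finset.prod_insert (by simp),
    Finset.prod_insert (by simp)]
  ring

section
variable {L : ℕ} {i : ℕ → ℕ} {s : ℕ → ℕ → ℂ} {σ₂ σ₃ : ℕ → ℂ}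

/-- The factors among the three fixed points leave the integral, and `|z_1 - z_2| = 1` makes the
pair of labels `1`, `2` trivial. After this the only traces of `s_{3•}` in the kernel are the
exponents `σ₃`. -/
theorem selbergIntegrand_eq (hL : 4 ≤ L) (t : ℕ → ℂ) (z₃ : ℂ) (x : Finset.Icc 4 L → ℂ) :
    selbergIntegrand L i (withThree s t) z₃ x = conj z₃ * absPow z₃ (t 1) * absPow (1 - z₃) (t 2) *
      selbergKernel L i s (s 2) t (selbergBase z₃) x := by
  have e2 : Finset.Ioc 1 L = insert 2 (insert 3 (Finset.Icc 4 L)) := by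
    ext a; simp only [Finset.mem_Ioc, Finset.mem_insert, Finset.mem_Icc]; omega
  have e3 : Finset.Ioc 2 L = insert 3 (Finset.Icc 4 L) := by
    ext a; simp only [Finset.mem_Ioc, Finset.mem_insert, Finset.mem_Icc]; omega
  have e4 : Finset.Ioc 3 L = Finset.Icc 4 L := (Finset.Icc_add_one_left_eq_Ioc 3 L).symm
  unfold selbergIntegrand selbergKernel
  simp only []
  have h1 : points 4 L (selbergBase z₃) x 1 = 0 := by
    rw [points_of_notMem (by simp)]; simp [selbergBase]
  have h2 : points 4 L (selbergBase z₃) x 2 = 1 := by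
    rw [points_of_notMem (by simp)]; simp [selbergBase]
  have h3 : points 4 L (selbergBase z₃) x 3 = z₃ := by
    rw [points_of_notMem (by simp)]; simp [selbergBase]
  have b2 : selbergBase z₃ 2 = 1 := by simp [selbergBase]
  have b3 : selbergBase z₃ 3 = z₃ := by simp [selbergBase]
  set z := points 4 L (selbergBase z₃) x with hz
  rw [prod_Icc_one hL, e2, e3, e4, Finset.prod_insert (by simp), Finset.prod_insert (by simp),
    Finset.prod_insert (by simp), h1, h2, h3, b2, b3]
  have w1 : ∏ b ∈ Finset.Icc 4 L, absPow (0 - z b) (withThree s t 1 b) =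
      ∏ b ∈ Finset.Icc 4 L, absPow (z b) (s 1 b) := by
    refine Finset.prod_congr rfl fun b hb => ?_
    have := (Finset.mem_Icc.1 hb).1
    simp only [withThree, show b ≠ 3 by omega, if_false, show (1 : ℕ) ≠ 3 by omega]
    exact absPow_congr (by simp) _
  have w2 : ∏ b ∈ Finset.Icc 4 L, absPow (1 - z b) (withThree s t 2 b) =
      ∏ b ∈ Finset.Icc 4 L, absPow (z b - 1) (s 2 b) := by
    refine Finset.prod_congr rfl fun b hb => ?_
    have := (Finset.mem_Icc.1 hb).1
    simp only [withThree, show b ≠ 3 by omega, if_false, show (2 : ℕ) ≠ 3 by omega]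
    exact absPow_congr (norm_sub_rev _ _) _
  have w3 : ∏ b ∈ Finset.Icc 4 L, absPow (z₃ - z b) (withThree s t 3 b) =
      ∏ b ∈ Finset.Icc 4 L, absPow (z b - z₃) (t b) := by
    refine Finset.prod_congr rfl fun b hb => ?_
    simp only [withThree, if_true]
    exact absPow_congr (norm_sub_rev _ _) _
  have w4 : ∏ a ∈ Finset.Icc 4 L, ∏ b ∈ Finset.Ioc a L, absPow (z a - z b) (withThree s t a b) =
      ∏ a ∈ Finset.Icc 4 L, ∏ b ∈ Finset.Ioc a L, absPow (z a - z b) (s a b) := by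
    refine Finset.prod_congr rfl fun a ha => Finset.prod_congr rfl fun b hb => ?_
    have h1 := (Finset.mem_Icc.1 ha).1
    have h2 := (Finset.mem_Ioc.1 hb).1
    simp only [withThree, show a ≠ 3 by omega, show b ≠ 3 by omega, if_false]
  rw [w1, w2, w3, w4]
  have w5 : absPow (0 - 1) (withThree s t 1 2) = 1 := absPow_of_norm_eq_one (by simp) _
  have w6 : absPow (0 - z₃) (withThree s t 1 3) = absPow z₃ (t 1) := by
    simp only [withThree, show (1 : ℕ) ≠ 3 by omega, if_false, if_true]
    exact absPow_congr (by simp) _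
  have w7 : withThree s t 2 3 = t 2 := by simp [withThree]
  rw [w5, w6, w7]
  simp only [Finset.prod_mul_distrib]
  ring

/-- With `σ₂ = 0` the base point labelled `2`, whose default value is `0`, is seen only by factors
with `i_k = 2`. -/
theorem zeroLimitIntegrand_eq :
    zeroLimitIntegrand L i s = selbergKernel L i s 0 0 (fun k => if k = 3 then 1 else 0) := by
  ext x
  simp [zeroLimitIntegrand, selbergKernel, absPow_zero_right]

theorem oneLimitIntegrand_eq :
    oneLimitIntegrand L i s = selbergKernel L i s (s 2) 0 (selbergBase 1) := by
  ext x
  simp only [oneLimitIntegrand, selbergKernel, Pi.zero_apply, absPow_zero_right, mul_one]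
  congr 1
  refine Finset.prod_congr rfl fun k _ => ?_
  rw [absPow_congr (norm_sub_rev (1 : ℂ) _), show selbergBase 1 2 = 1 by simp [selbergBase]]

theorem measurable_points (a L : ℕ) (p : ℕ → ℂ) (k : ℕ) : Measurable fun x => points a L p x k := by
  unfold points
  split_ifs with h
  · exact measurable_pi_apply _
  · exact measurable_const

theorem measurable_selbergKernel (p : ℕ → ℂ) : Measurable (selbergKernel L i s σ₂ σ₃ p) := by
  have hz := measurable_points 4 L p
  have hc : Measurable fun z : ℂ => conj z := continuous_conj.measurable
  unfold selbergKernel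
  refine Measurable.mul (Measurable.mul (measurable_const.div (hc.comp (hz L))) ?_) ?_
  · exact Finset.measurable_prod _ fun a _ => Finset.measurable_prod _ fun b _ =>
      (measurable_absPow _).comp ((hz a).sub (hz b))
  · refine Finset.measurable_prod _ fun k _ => Measurable.mul (Measurable.mul (Measurable.mul ?_ ?_) ?_) ?_
    · exact (measurable_absPow _).comp (hz k)
    · exact (measurable_absPow _).comp ((hz k).sub_const _)
    · exact (measurable_absPow _).comp ((hz k).sub_const _)
    · exact measurable_const.div (((hz k).sub (hz _)).mul (hc.comp ((hz k).sub (hz _))))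

theorem points_smul (a L : ℕ) (c : ℂ) (p : ℕ → ℂ) (x : Finset.Icc a L → ℂ) (k : ℕ) :
    points a L (c • p) (c • x) k = c * points a L p x k := by
  unfold points
  split_ifs <;> simp

/-- Homogeneity under joint dilation of variables and base points. It is used with `c = z₃` to
rescale the Selberg integral, and with `c = w_4` to split off the overall scale. -/
theorem selbergKernel_smul {c : ℂ} (hc : c ≠ 0) (p : ℕ → ℂ) (x : Finset.Icc 4 L → ℂ) :
    selbergKernel L i s σ₂ σ₃ (c • p) (c • x) =
      absPow c (∑ a ∈ Finset.Icc 4 L, ∑ b ∈ Finset.Ioc a L, s a b + ∑ k ∈ Finset.Icc 4 L, (s 1 k + σ₂ k + σ₃ k)) *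
        (1 / conj c) * (1 / (c * conj c)) ^ (Finset.Icc 4 L).card * selbergKernel L i s σ₂ σ₃ p x := by
  rw [absPow_add hc, absPow_sum hc, absPow_sum hc]
  simp only [absPow_sum hc, absPow_add hc, selbergKernel, points_smul, ← mul_sub, absPow_mul, map_mul,
    Finset.prod_mul_distrib, Pi.smul_apply, smul_eq_mul, ← Finset.prod_const]
  have h (k : ℕ) : 1 / (c * (points 4 L p x k - points 4 L p x (i k)) *
      (conj c * conj (points 4 L p x k - points 4 L p x (k - 1)))) = (1 / (c * conj c)) *
        (1 / ((points 4 L p x k - points 4 L p x (i k)) * conj (points 4 L p x k - points 4 L p x (k - 1)))) := by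
    simp only [one_div, mul_inv]; ring
  simp only [h, Finset.prod_mul_distrib]
  simp only [one_div, mul_inv]
  ring

/-! ### Exponents -/

/-- The exponent of `‖x a - x b‖` in the norm of the kernel. -/
noncomputable def pairExp (L : ℕ) (i : ℕ → ℕ) (s : ℕ → ℕ → ℂ) (a b : Finset.Icc 4 L) : ℝ :=
  (if a.val < b.val then 2 * (s a b).re else 0) - (if i a = b then 1 else 0) - (if a.val = b + 1 then 1 else 0)

/-- The exponents at the three base points. In `zeroExp` the term at `k = L` comes from the
prefactor `1 / conj z_L`; in `threeExp` the term at `k = 4` comes from the chain factor `conj (z_4 -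
z_3)`. -/
noncomputable def zeroExp (L : ℕ) (i : ℕ → ℕ) (s : ℕ → ℕ → ℂ) (k : Finset.Icc 4 L) : ℝ :=
  2 * (s 1 k).re - (if i k = 1 then 1 else 0) - (if k.val = L then 1 else 0)

noncomputable def twoExp (L : ℕ) (i : ℕ → ℕ) (σ₂ : ℕ → ℂ) (k : Finset.Icc 4 L) : ℝ :=
  2 * (σ₂ k).re - (if i k = 2 then 1 else 0)

noncomputable def threeExp (L : ℕ) (i : ℕ → ℕ) (σ₃ : ℕ → ℂ) (k : Finset.Icc 4 L) : ℝ :=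
  2 * (σ₃ k).re - (if i k = 3 then 1 else 0) - (if k.val = 4 then 1 else 0)

theorem pairExp_self (hi : ∀ k ∈ Finset.Icc 4 L, i k ∈ Finset.Icc 1 L ∧ i k ≠ k) (a : Finset.Icc 4 L) :
    pairExp L i s a a = 0 := by
  simp [pairExp, (hi a a.2).2]

theorem norm_selbergKernel (hL : 4 ≤ L) (hi : ∀ k ∈ Finset.Icc 4 L, i k ∈ Finset.Icc 1 L ∧ i k ≠ k)
    {p : ℕ → ℂ} (hp : p 1 = 0) {x : Finset.Icc 4 L → ℂ} (hx : ∀ a b, a ≠ b → x a ≠ x b)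
    (h0 : ∀ k, x k ≠ 0) (h2 : ∀ k, x k ≠ p 2) (h3 : ∀ k, x k ≠ p 3) :
    ‖selbergKernel L i s σ₂ σ₃ p x‖ = coll (pairExp L i s) (fun k z => ‖z‖ ^ zeroExp L i s k *
      ‖z - p 2‖ ^ twoExp L i σ₂ k * ‖z - p 3‖ ^ threeExp L i σ₃ k) x := by
  have n0 : ∀ k, 0 < ‖x k‖ := fun k => norm_pos_iff.2 (h0 k)
  have n2 : ∀ k, 0 < ‖x k - p 2‖ := fun k => norm_pos_iff.2 (sub_ne_zero.2 (h2 k))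
  have n3 : ∀ k, 0 < ‖x k - p 3‖ := fun k => norm_pos_iff.2 (sub_ne_zero.2 (h3 k))
  have nx : ∀ a b, a ≠ b → 0 < ‖x a - x b‖ := fun a b hab => norm_pos_iff.2 (sub_ne_zero.2 (hx a b hab))
  have hpt : ∀ k : Finset.Icc 4 L, points 4 L p x k = x k := fun k => points_of_mem k.2 p x
  have hLm : L ∈ Finset.Icc 4 L := Finset.mem_Icc.2 ⟨hL, le_rfl⟩
  have hsub : ∀ {y a b : ℝ}, 0 < y → y ^ (a - b) = y ^ a * y ^ (-b) := fun hy => by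
    rw [sub_eq_add_neg, Real.rpow_add hy]
  have hpair : ∀ a b : Finset.Icc 4 L, ‖x a - x b‖ ^ pairExp L i s a b =
      ‖x a - x b‖ ^ (if a.val < b.val then 2 * (s a b).re else 0) *
      ‖x a - x b‖ ^ (-(if i a = b then 1 else 0 : ℝ)) * ‖x a - x b‖ ^ (-(if a.val = b + 1 then 1 else 0 : ℝ)) := by
    intro a b
    by_cases hab : a = b
    · subst hab; simp [pairExp, (hi a a.2).2]
    · rw [pairExp, hsub (nx a b hab), hsub (nx a b hab)]
  have hA : ∏ a : Finset.Icc 4 L, ∏ b : Finset.Icc 4 L, ‖x a - x b‖ ^ (if a.val < b.val then 2 * (s a b).re else 0) =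
      ∏ a ∈ Finset.Icc 4 L, ∏ b ∈ Finset.Ioc a L, ‖absPow (points 4 L p x a - points 4 L p x b) (s a b)‖ := by
    rw [← Finset.prod_coe_sort (Finset.Icc 4 L)]
    refine Finset.prod_congr rfl fun a _ => ?_
    have hsub : Finset.Ioc a.val L = (Finset.Icc 4 L).filter (fun b => a.val < b) := by
      ext b
      have := (Finset.mem_Icc.1 a.2).1
      simp only [Finset.mem_Ioc, Finset.mem_filter, Finset.mem_Icc]; omega
    rw [hsub, Finset.prod_filter, ← Finset.prod_coe_sort (Finset.Icc 4 L)]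
    refine Finset.prod_congr rfl fun b _ => ?_
    split_ifs with hab
    · rw [hpt, hpt, norm_absPow (sub_ne_zero.2 (hx a b (by rintro rfl; exact lt_irrefl _ hab)))]
    · simp
  -- Exactly one factor on the right is nontrivial, according to whether `i a` labels an integration
  -- variable or one of the base points `1`, `2`, `3`.
  have hB : ∀ a : Finset.Icc 4 L, ‖points 4 L p x a - points 4 L p x (i a)‖⁻¹ =
      (∏ b : Finset.Icc 4 L, ‖x a - x b‖ ^ (-(if i a = b then 1 else 0 : ℝ))) *
      ‖x a‖ ^ (-(if i a = 1 then 1 else 0 : ℝ)) * ‖x a - p 2‖ ^ (-(if i a = 2 then 1 else 0 : ℝ)) *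
      ‖x a - p 3‖ ^ (-(if i a = 3 then 1 else 0 : ℝ)) := by
    intro a
    obtain ⟨h1, -⟩ := hi a a.2
    rw [Finset.mem_Icc] at h1
    rw [hpt]
    by_cases h4 : 4 ≤ i a
    · have hm : i a ∈ Finset.Icc 4 L := Finset.mem_Icc.2 ⟨h4, h1.2⟩
      rw [Finset.prod_eq_single (⟨i a, hm⟩ : Finset.Icc 4 L)]
      · simp [show i a ≠ 1 by omega, show i a ≠ 2 by omega, show i a ≠ 3 by omega, points_of_mem hm,
          Real.rpow_neg_one]
      · intro b _ hb
        have : i a ≠ b := fun h => hb (Subtype.ext h.symm)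
        simp [this]
      · simp
    · have hp1 : ∏ b : Finset.Icc 4 L, ‖x a - x b‖ ^ (-(if i a = b then 1 else 0 : ℝ)) = 1 := by
        refine Finset.prod_eq_one fun b _ => ?_
        have := (Finset.mem_Icc.1 b.2).1
        simp [show i a ≠ b by omega]
      rw [hp1, points_of_notMem (by simp; omega)]
      obtain h | h | h : i a = 1 ∨ i a = 2 ∨ i a = 3 := by omega
      · simp [h, hp, Real.rpow_neg_one]
      · simp [h, Real.rpow_neg_one]
      · simp [h, Real.rpow_neg_one]
  -- The predecessor `a - 1` is a variable unless `a = 4`, when it is the base point `3`.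
  have hC : ∀ a : Finset.Icc 4 L, ‖conj (points 4 L p x a - points 4 L p x (a - 1))‖⁻¹ =
      (∏ b : Finset.Icc 4 L, ‖x a - x b‖ ^ (-(if a.val = b + 1 then 1 else 0 : ℝ))) *
      ‖x a - p 3‖ ^ (-(if a.val = 4 then 1 else 0 : ℝ)) := by
    intro a
    have ha := Finset.mem_Icc.1 a.2
    rw [hpt, norm_conj]
    by_cases h4 : a.val = 4
    · have hp1 : ∏ b : Finset.Icc 4 L, ‖x a - x b‖ ^ (-(if a.val = b + 1 then 1 else 0 : ℝ)) = 1 := by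
        refine Finset.prod_eq_one fun b _ => ?_
        have := (Finset.mem_Icc.1 b.2).1
        simp [show a.val ≠ b + 1 by omega]
      rw [hp1, points_of_notMem (by simp; omega)]
      simp [h4, Real.rpow_neg_one]
    · have hm : a.val - 1 ∈ Finset.Icc 4 L := Finset.mem_Icc.2 ⟨by omega, by omega⟩
      rw [Finset.prod_eq_single (⟨a.val - 1, hm⟩ : Finset.Icc 4 L)]
      · rw [if_pos (show a.val = a.val - 1 + 1 by omega), if_neg h4, points_of_mem hm]
        simp [Real.rpow_neg_one]
      · intro b _ hb
        have : a.val ≠ b + 1 := fun h => hb (Subtype.ext (by simp only; omega))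
        simp [this]
      · simp
  have hD : ‖conj (points 4 L p x L)‖⁻¹ = ∏ k : Finset.Icc 4 L, ‖x k‖ ^ (-(if k.val = L then 1 else 0 : ℝ)) := by
    rw [Finset.prod_eq_single (⟨L, hLm⟩ : Finset.Icc 4 L)]
    · simp [points_of_mem hLm, Real.rpow_neg_one]
    · intro b _ hb
      have : b.val ≠ L := fun h => hb (Subtype.ext h)
      simp [this]
    · simp
  have hz : ∀ k : Finset.Icc 4 L, ‖x k‖ ^ zeroExp L i s k = ‖absPow (points 4 L p x k) (s 1 k)‖ *
      ‖x k‖ ^ (-(if i k = 1 then 1 else 0 : ℝ)) * ‖x k‖ ^ (-(if k.val = L then 1 else 0 : ℝ)) := by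
    intro k
    rw [hpt, norm_absPow (h0 k), zeroExp, hsub (n0 k), hsub (n0 k)]
  have ht : ∀ k : Finset.Icc 4 L, ‖x k - p 2‖ ^ twoExp L i σ₂ k = ‖absPow (points 4 L p x k - p 2) (σ₂ k)‖ *
      ‖x k - p 2‖ ^ (-(if i k = 2 then 1 else 0 : ℝ)) := by
    intro k
    rw [hpt, norm_absPow (sub_ne_zero.2 (h2 k)), twoExp, hsub (n2 k)]
  have hth : ∀ k : Finset.Icc 4 L, ‖x k - p 3‖ ^ threeExp L i σ₃ k = ‖absPow (points 4 L p x k - p 3) (σ₃ k)‖ *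
      ‖x k - p 3‖ ^ (-(if i k = 3 then 1 else 0 : ℝ)) * ‖x k - p 3‖ ^ (-(if k.val = 4 then 1 else 0 : ℝ)) := by
    intro k
    rw [hpt, norm_absPow (sub_ne_zero.2 (h3 k)), threeExp, hsub (n3 k), hsub (n3 k)]
  unfold coll selbergKernel
  simp only [hpair, Finset.prod_mul_distrib, hA, hz, ht, hth, norm_mul, norm_prod, norm_inv, one_div,
    mul_inv, hD]
  have hB' := Finset.prod_congr (rfl : (Finset.univ : Finset (Finset.Icc 4 L)) = Finset.univ) fun a _ => hB a
  have hC' := Finset.prod_congr (rfl : (Finset.univ : Finset (Finset.Icc 4 L)) = Finset.univ) fun a _ => hC a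
  simp only [Finset.prod_mul_distrib] at hB' hC'
  rw [Finset.prod_coe_sort (Finset.Icc 4 L) (fun a => ‖points 4 L p x a - points 4 L p x (i a)‖⁻¹)] at hB'
  rw [Finset.prod_coe_sort (Finset.Icc 4 L) (fun a => ‖conj (points 4 L p x a - points 4 L p x (a - 1))‖⁻¹)] at hC'
  rw [hB', hC',
    Finset.prod_coe_sort (Finset.Icc 4 L) (fun k => ‖absPow (points 4 L p x k) (s 1 k)‖),
    Finset.prod_coe_sort (Finset.Icc 4 L) (fun k => ‖absPow (points 4 L p x k - p 2) (σ₂ k)‖),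
    Finset.prod_coe_sort (Finset.Icc 4 L) (fun k => ‖absPow (points 4 L p x k - p 3) (σ₃ k)‖)]
  ring

theorem ae_generic (c₂ c₃ : ℂ) : ∀ᵐ x : Finset.Icc 4 L → ℂ, (∀ a b, a ≠ b → x a ≠ x b) ∧
    (∀ k, x k ≠ 0) ∧ (∀ k, x k ≠ c₂) ∧ ∀ k, x k ≠ c₃ := by
  have h1 : ∀ᵐ x : Finset.Icc 4 L → ℂ, ∀ a b, a ≠ b → x a ≠ x b := by
    rw [ae_all_iff]; intro a; rw [ae_all_iff]; intro b
    by_cases hab : a = b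
    · simp [hab]
    · filter_upwards [ae_apply_ne_apply hab] with u hu _ using hu
  have h2 (c : ℂ) : ∀ᵐ x : Finset.Icc 4 L → ℂ, ∀ k, x k ≠ c := ae_all_iff.2 fun k => ae_apply_of_ae k (ae_ne c)
  filter_upwards [h1, h2 0, h2 c₂, h2 c₃] with x a b c d using ⟨a, b, c, d⟩

end

theorem coll_eq_mul_of_eq_off {ι : Type} [Fintype ι] [DecidableEq ι] {e : ι → ι → ℝ} {g h : ι → ℂ → ℝ}
    {u : ι → ℂ} (k₀ : ι) {m : ℝ} (h1 : ∀ k, k ≠ k₀ → g k (u k) = h k (u k))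
    (h2 : g k₀ (u k₀) = h k₀ (u k₀) * m) : coll e g u = coll e h u * m := by
  have : ∀ k, g k (u k) = h k (u k) * if k = k₀ then m else 1 := by
    intro k
    by_cases hk : k = k₀
    · subst hk; simp [h2]
    · simp [hk, h1 k hk]
  unfold coll
  simp only [this, Finset.prod_mul_distrib, Finset.prod_ite_eq', Finset.mem_univ, if_true]
  ring

theorem tendsto_absPow_both {β : Type} {l : Filter β} {f g : β → ℂ} {x a : ℂ} (h : Tendsto f l (𝓝 x))
    (hx : x ≠ 0) (hg : Tendsto g l (𝓝 a)) : Tendsto (fun b => absPow (f b) (g b)) l (𝓝 (absPow x a)) := by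
  unfold absPow
  refine Tendsto.cpow ((continuous_ofReal.comp continuous_norm).continuousAt.tendsto.comp h) (hg.const_mul 2) ?_
  simp [slitPlane, hx]

section
variable {L : ℕ} {i : ℕ → ℕ} {s : ℕ → ℕ → ℂ} {σ₂ σ₃ : ℕ → ℂ}

theorem lintegral_enorm_selbergKernel (hL : 4 ≤ L)
    (hi : ∀ k ∈ Finset.Icc 4 L, i k ∈ Finset.Icc 1 L ∧ i k ≠ k) {p : ℕ → ℂ} (hp : p 1 = 0) :
    ∫⁻ x, ‖selbergKernel L i s σ₂ σ₃ p x‖ₑ = ∫⁻ x, ENNReal.ofReal (coll (pairExp L i s)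
      (fun k z => ‖z‖ ^ zeroExp L i s k * ‖z - p 2‖ ^ twoExp L i σ₂ k * ‖z - p 3‖ ^ threeExp L i σ₃ k) x) := by
  refine lintegral_congr_ae ?_
  filter_upwards [ae_generic (L := L) (p 2) (p 3)] with x hx
  rw [← ofReal_norm, norm_selbergKernel hL hi hp hx.1 hx.2.1 hx.2.2.1 hx.2.2.2]

theorem integrable_selbergKernel_iff {p : ℕ → ℂ} :
    Integrable (selbergKernel L i s σ₂ σ₃ p) ↔ ∫⁻ x, ‖selbergKernel L i s σ₂ σ₃ p x‖ₑ ≠ ⊤ :=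
  ⟨fun h => h.2.ne, fun h => ⟨(measurable_selbergKernel p).aestronglyMeasurable, h.lt_top⟩⟩

/-- Trading one exponent at the third base point for another costs a power of the distance to that
point. This power is what becomes small on the tails. -/
theorem norm_selbergKernel_update (hL : 4 ≤ L)
    (hi : ∀ k ∈ Finset.Icc 4 L, i k ∈ Finset.Icc 1 L ∧ i k ≠ k) {p : ℕ → ℂ} (hp : p 1 = 0)
    {x : Finset.Icc 4 L → ℂ} (hx : (∀ a b, a ≠ b → x a ≠ x b) ∧
    (∀ k, x k ≠ 0) ∧ (∀ k, x k ≠ p 2) ∧ ∀ k, x k ≠ p 3) (k₀ : Finset.Icc 4 L) (c : ℂ) :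
    ‖selbergKernel L i s σ₂ σ₃ p x‖ = ‖selbergKernel L i s σ₂ (Function.update σ₃ k₀ c) p x‖ *
      ‖x k₀ - p 3‖ ^ (2 * (σ₃ k₀).re - 2 * c.re) := by
  rw [norm_selbergKernel hL hi hp hx.1 hx.2.1 hx.2.2.1 hx.2.2.2,
    norm_selbergKernel hL hi hp hx.1 hx.2.1 hx.2.2.1 hx.2.2.2]
  refine coll_eq_mul_of_eq_off k₀ ?_ ?_
  · intro k hk
    have : k.val ≠ k₀.val := fun h => hk (Subtype.ext h)
    simp [threeExp, Function.update_of_ne this]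
  · have := norm_pos_iff.2 (sub_ne_zero.2 (hx.2.2.2 k₀))
    rw [mul_assoc _ _ (‖x k₀ - p 3‖ ^ (2 * (σ₃ k₀).re - 2 * c.re)), ← Real.rpow_add this]
    congr 2
    simp only [threeExp, Function.update_self]
    ring

theorem tendsto_selbergKernel {β : Type} {l : Filter β} {P : β → ℕ → ℂ} {S : β → ℕ → ℂ} {p : ℕ → ℂ}
    (hi : ∀ k ∈ Finset.Icc 4 L, i k ∈ Finset.Icc 1 L ∧ i k ≠ k) (hL : 4 ≤ L)
    (hP : ∀ k, Tendsto (fun b => P b k) l (𝓝 (p k))) (hS : ∀ k ∈ Finset.Icc 4 L, Tendsto (fun b => S b k) l (𝓝 (σ₃ k)))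
    {x : Finset.Icc 4 L → ℂ} (hp : p 1 = 0) (hx : (∀ a b, a ≠ b → x a ≠ x b) ∧
    (∀ k, x k ≠ 0) ∧ (∀ k, x k ≠ p 2) ∧ ∀ k, x k ≠ p 3) :
    Tendsto (fun b => selbergKernel L i s σ₂ (S b) (P b) x) l (𝓝 (selbergKernel L i s σ₂ σ₃ p x)) := by
  have hz : ∀ k, Tendsto (fun b => points 4 L (P b) x k) l (𝓝 (points 4 L p x k)) := by
    intro k
    by_cases hk : k ∈ Finset.Icc 4 L
    · simp only [points_of_mem hk]; exact tendsto_const_nhds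
    · simp only [points_of_notMem hk]; exact hP k
  have hc : ∀ {f : β → ℂ} {w : ℂ}, Tendsto f l (𝓝 w) → Tendsto (fun b => conj (f b)) l (𝓝 (conj w)) :=
    fun h => (continuous_conj.tendsto _).comp h
  have hLm : L ∈ Finset.Icc 4 L := Finset.mem_Icc.2 ⟨hL, le_rfl⟩
  have hne : ∀ k ∈ Finset.Icc 4 L, ∀ j ∈ Finset.Icc 1 L, j ≠ k → points 4 L p x k - points 4 L p x j ≠ 0 := by
    intro k hk j hj hjk
    rw [sub_ne_zero, points_of_mem hk]
    rw [Finset.mem_Icc] at hj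
    by_cases h4 : 4 ≤ j
    · have hj' : j ∈ Finset.Icc 4 L := Finset.mem_Icc.2 ⟨h4, hj.2⟩
      rw [points_of_mem hj']
      exact hx.1 _ _ fun h => hjk (congrArg Subtype.val h).symm
    · rw [points_of_notMem (by simp; omega)]
      obtain h | h | h : j = 1 ∨ j = 2 ∨ j = 3 := by omega
      · rw [h, hp]; exact hx.2.1 _
      · rw [h]; exact hx.2.2.1 _
      · rw [h]; exact hx.2.2.2 _
  unfold selbergKernel
  refine Tendsto.mul (Tendsto.mul (tendsto_const_nhds.div (hc (hz L)) ?_) ?_) ?_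
  · rw [points_of_mem hLm]; simpa using hx.2.1 _
  · refine tendsto_finsetProd _ fun a ha => tendsto_finsetProd _ fun b hb => ?_
    refine tendsto_absPow ((hz a).sub (hz b)) ?_ _
    have h1 := Finset.mem_Ioc.1 hb
    have h2 := Finset.mem_Icc.1 ha
    exact hne a ha b (Finset.mem_Icc.2 ⟨by omega, h1.2⟩) h1.1.ne'
  · refine tendsto_finsetProd _ fun k hk => ?_
    have hk' := Finset.mem_Icc.1 hk
    refine Tendsto.mul (Tendsto.mul (Tendsto.mul ?_ ?_) ?_) ?_
    · refine tendsto_absPow (hz k) ?_ _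
      rw [points_of_mem hk]; exact hx.2.1 _
    · refine tendsto_absPow ((hz k).sub (hP 2)) ?_ _
      rw [points_of_mem hk]; exact sub_ne_zero.2 (hx.2.2.1 _)
    · refine tendsto_absPow_both ((hz k).sub (hP 3)) ?_ (hS k hk)
      rw [points_of_mem hk]; exact sub_ne_zero.2 (hx.2.2.2 _)
    · refine tendsto_const_nhds.div (((hz k).sub (hz _)).mul (hc ((hz k).sub (hz _)))) ?_
      refine mul_ne_zero (hne k hk _ (hi k hk).1 (hi k hk).2) ?_
      rw [Ne, map_eq_zero]
      exact hne k hk _ (Finset.mem_Icc.2 ⟨by omega, by omega⟩) (by omega)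

/-! ### Degrees of clusters -/

theorem sum_indicator_le (K : Finset (Finset.Icc 4 L)) (v m : ℕ) :
    ∑ b ∈ K, (if v = b.val + m then (1 : ℝ) else 0) ≤ if 4 + m ≤ v then 1 else 0 := by
  split_ifs with h
  · rw [← Finset.sum_filter, Finset.sum_const, nsmul_eq_mul, mul_one]
    have : (K.filter fun b => v = b.val + m).card ≤ 1 := by
      rw [Finset.card_le_one]
      intro a ha b hb
      have h1 := (Finset.mem_filter.1 ha).2
      have h2 := (Finset.mem_filter.1 hb).2
      exact Subtype.ext (by omega)
    exact_mod_cast this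
  · refine (Finset.sum_eq_zero fun b _ => ?_).le
    have := (Finset.mem_Icc.1 b.2).1
    rw [if_neg (by omega)]

theorem clusterDeg_eq_sum {ι : Type} [Fintype ι] [DecidableEq ι] (e : ι → ι → ℝ) (d : ι → ℝ) (K : Finset ι) :
    clusterDeg e d K = ∑ a ∈ K, (2 + ∑ b ∈ K, e a b + d a) := by
  simp only [clusterDeg, Finset.sum_add_distrib, Finset.sum_const, nsmul_eq_mul]
  ring

/-- Within a cluster each variable loses at most `1` through `i a` and at most `1` through its chain
predecessor, the latter being absent for `a = 4`. -/
theorem sum_pairExp_ge (K : Finset (Finset.Icc 4 L)) (a : Finset.Icc 4 L) :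
    ∑ b ∈ K, (if a.val < b.val then 2 * (s a b).re else 0) - (if 4 ≤ i a then 1 else 0)
      - (if 5 ≤ a.val then 1 else 0) ≤ ∑ b ∈ K, pairExp L i s a b := by
  simp only [pairExp, Finset.sum_sub_distrib]
  have h1 := sum_indicator_le K (i a) 0
  have h2 := sum_indicator_le K a.val 1
  simp only [add_zero] at h1
  linarith

theorem sum_pair_nonneg (hs : ∀ a b : ℕ, 4 ≤ a → a < b → b ≤ L → 0 < (s a b).re)
    (K : Finset (Finset.Icc 4 L)) (a : Finset.Icc 4 L) :
    0 ≤ ∑ b ∈ K, (if a.val < b.val then 2 * (s a b).re else 0) := by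
  refine Finset.sum_nonneg fun b _ => ?_
  split_ifs with h
  · have := hs a b (Finset.mem_Icc.1 a.2).1 h (Finset.mem_Icc.1 b.2).2
    linarith
  · exact le_rfl

/-- The count holds variable by variable. The label `i a` is a single number, so the holomorphic
poles cost at most `1`; the antiholomorphic chain pole costs at most `1`. The `2` from the measure
pays for both, and `2 * (σ₂ a).re > 0` remains. -/
theorem clusterDeg_one_pos (hs : ∀ a b : ℕ, 4 ≤ a → a < b → b ≤ L → 0 < (s a b).re)
    (h2 : ∀ k ∈ Finset.Icc 4 L, 0 < (σ₂ k).re) (h3 : ∀ k ∈ Finset.Icc 4 L, 0 ≤ (σ₃ k).re)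
    {K : Finset (Finset.Icc 4 L)} (hK : K.Nonempty) :
    0 < clusterDeg (pairExp L i s) (fun k => twoExp L i σ₂ k + threeExp L i σ₃ k) K := by
  rw [clusterDeg_eq_sum]
  refine Finset.sum_pos (fun a _ => ?_) hK
  have e1 := sum_pairExp_ge (i := i) (s := s) K a
  have e2 := sum_pair_nonneg hs K a
  have e3 := h2 a a.2
  have e4 := h3 a a.2
  simp only [twoExp, threeExp]
  have e5 : (if 4 ≤ i a then (1 : ℝ) else 0) + (if i a = 2 then 1 else 0) + (if i a = 3 then 1 else 0) ≤ 1 := by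
    split_ifs <;> first | omega | norm_num
  have e6 : (if 5 ≤ a.val then (1 : ℝ) else 0) + (if a.val = 4 then 1 else 0) ≤ 1 := by
    split_ifs <;> first | omega | norm_num
  linarith

/-- Here no `σ₂` helps, and each variable contributes only a nonnegative amount. Strictness comes
from the smallest label `a` of `K`: a second element `b` adds `2 * (s a b).re > 0`, while a
singleton could lose the full `2` only if both poles sat at the third base point, that is, `a = 4`
and `i 4 = 3`. -/
theorem clusterDeg_three_pos (hi : ∀ k ∈ Finset.Icc 4 L, i k ∈ Finset.Icc 1 L ∧ i k ≠ k)
    (hs : ∀ a b : ℕ, 4 ≤ a → a < b → b ≤ L → 0 < (s a b).re)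
    (h3 : ∀ k ∈ Finset.Icc 4 L, 0 ≤ (σ₃ k).re) (h4 : i 4 ≠ 3)
    {K : Finset (Finset.Icc 4 L)} (hK : K.Nonempty) :
    0 < clusterDeg (pairExp L i s) (threeExp L i σ₃) K := by
  rw [clusterDeg_eq_sum]
  have e5 (a : Finset.Icc 4 L) : (if 4 ≤ i a then (1 : ℝ) else 0) + (if i a = 3 then 1 else 0) ≤ 1 := by
    split_ifs <;> first | omega | norm_num
  have e6 (a : Finset.Icc 4 L) : (if 5 ≤ a.val then (1 : ℝ) else 0) + (if a.val = 4 then 1 else 0) ≤ 1 := by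
    split_ifs <;> first | omega | norm_num
  have hnn : ∀ a ∈ K, 0 ≤ 2 + ∑ b ∈ K, pairExp L i s a b + threeExp L i σ₃ a := by
    intro a _
    have e1 := sum_pairExp_ge (i := i) (s := s) K a
    have e2 := sum_pair_nonneg hs K a
    have e4 := h3 a a.2
    have := e5 a
    have := e6 a
    simp only [threeExp]
    linarith
  obtain ⟨a, ha, hmin⟩ := K.exists_min_image (fun a => a.val) hK
  refine Finset.sum_pos' hnn ⟨a, ha, ?_⟩
  have e4 := h3 a a.2
  by_cases hone : ∃ b ∈ K, b ≠ a
  · obtain ⟨b, hb, hba⟩ := hone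
    have hlt : a.val < b.val := lt_of_le_of_ne (hmin b hb) fun h => hba (Subtype.ext h.symm)
    have e1 := sum_pairExp_ge (i := i) (s := s) K a
    have e2 : 0 < ∑ b ∈ K, (if a.val < b.val then 2 * (s a b).re else 0) := by
      refine Finset.sum_pos' (fun c _ => ?_) ⟨b, hb, ?_⟩
      · split_ifs with h
        · have := hs a c (Finset.mem_Icc.1 a.2).1 h (Finset.mem_Icc.1 c.2).2
          linarith
        · exact le_rfl
      · rw [if_pos hlt]
        have := hs a b (Finset.mem_Icc.1 a.2).1 hlt (Finset.mem_Icc.1 b.2).2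
        linarith
    have := e5 a
    have := e6 a
    simp only [threeExp]
    linarith
  · push Not at hone
    have e7 : ∑ b ∈ K, pairExp L i s a b = pairExp L i s a a :=
      Finset.sum_eq_single a (fun b hb hba => absurd (hone b hb) hba) (fun h => absurd ha h)
    rw [e7, pairExp_self hi]
    simp only [threeExp]
    have e9 : (if i a = 3 then (1 : ℝ) else 0) + (if a.val = 4 then 1 else 0) < 2 := by
      by_cases h5 : a.val = 4
      · simp [h4, h5]
      · split_ifs <;> norm_num
    linarith

end

/-! ### The inner limit `z₃ → 1`. -/

/-- Exponents `t = s_{3•}` with positive real parts at which the closed Selberg integral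
converges absolutely for all `z₃`. -/
def AdmissibleThree (L : ℕ) (i : ℕ → ℕ) (s : ℕ → ℕ → ℂ) (t : ℕ → ℂ) : Prop :=
  (∀ j ∈ Finset.Icc 1 L, j ≠ 3 → 0 < (t j).re) ∧
    ∀ z₃ : ℂ, z₃ ≠ 0 → z₃ ≠ 1 → Integrable (selbergIntegrand L i (withThree s t) z₃)

section
variable {L : ℕ} {i : ℕ → ℕ} {s : ℕ → ℕ → ℂ} {t : ℕ → ℂ}

theorem AdmissibleThree.re_pos (ht : AdmissibleThree L i s t) {k : ℕ} (hk : k ∈ Finset.Icc 4 L) :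
    0 < (t k).re := by
  rw [Finset.mem_Icc] at hk
  exact ht.1 k (Finset.mem_Icc.2 ⟨by omega, hk.2⟩) (by omega)

theorem absPow_ne_zero {x : ℂ} (hx : x ≠ 0) (a : ℂ) : absPow x a ≠ 0 := by
  rw [← norm_pos_iff, norm_absPow hx]
  have := norm_pos_iff.2 hx
  positivity

theorem AdmissibleThree.integrable_kernel (hL : 4 ≤ L) (ht : AdmissibleThree L i s t) {z : ℂ} (h0 : z ≠ 0)
    (h1 : z ≠ 1) : Integrable (selbergKernel L i s (s 2) t (selbergBase z)) := by
  have h := ht.2 z h0 h1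
  have hc : conj z * absPow z (t 1) * absPow (1 - z) (t 2) ≠ 0 :=
    mul_ne_zero (mul_ne_zero (by simpa using h0) (absPow_ne_zero h0 _))
      (absPow_ne_zero (sub_ne_zero.2 (Ne.symm h1)) _)
  have e : selbergIntegrand L i (withThree s t) z = fun x => (conj z * absPow z (t 1) * absPow (1 - z) (t 2)) *
      selbergKernel L i s (s 2) t (selbergBase z) x := by
    ext x; exact selbergIntegrand_eq hL t z x
  rw [e] at h
  exact (integrable_const_mul_iff (isUnit_iff_ne_zero.2 hc) _).1 h

theorem selbergBase_one (z : ℂ) : selbergBase z 1 = 0 := by simp [selbergBase]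
theorem selbergBase_two (z : ℂ) : selbergBase z 2 = 1 := by simp [selbergBase]
theorem selbergBase_three (z : ℂ) : selbergBase z 3 = z := by simp [selbergBase]

theorem tendsto_selbergBase {z : ℂ} (k : ℕ) : Tendsto (fun w => selbergBase w k) (𝓝[≠] z) (𝓝 (selbergBase z k)) := by
  unfold selbergBase
  split_ifs
  · exact tendsto_const_nhds
  · exact tendsto_nhdsWithin_of_tendsto_nhds tendsto_id
  · exact tendsto_const_nhds

theorem coll_add_const {ι : Type} [Fintype ι] (e : ι → ι → ℝ) (g : ι → ℂ → ℝ) (c : ℂ) (u : ι → ℂ) :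
    coll e g (u + fun _ => c) = coll e (fun k z => g k (z + c)) u := by
  simp [coll]

theorem lintegral_coll_translate {ι : Type} [Fintype ι] (e : ι → ι → ℝ) (g : ι → ℂ → ℝ) (c : ℂ) :
    ∫⁻ x, ENNReal.ofReal (coll e g x) = ∫⁻ u, ENNReal.ofReal (coll e (fun k z => g k (z + c)) u) := by
  rw [← lintegral_add_right_eq_self (μ := volume) (fun x => ENNReal.ofReal (coll e g x)) (fun _ : ι => c)]
  simp only [coll_add_const]

/-- Translation by `1` moves the merging base points `1` and `1 + ε` to `0` and `ε`. -/
theorem lintegral_kernel_one (hL : 4 ≤ L) (hi : ∀ k ∈ Finset.Icc 4 L, i k ∈ Finset.Icc 1 L ∧ i k ≠ k) (ε : ℂ) :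
    ∫⁻ x, ‖selbergKernel L i s (s 2) t (selbergBase (1 + ε)) x‖ₑ = ∫⁻ u, ENNReal.ofReal (coll (pairExp L i s)
      (fun k z => pairWeight (twoExp L i (s 2) k) (threeExp L i t k) 0 0 ε z * ‖z + 1‖ ^ zeroExp L i s k) u) := by
  rw [lintegral_enorm_selbergKernel hL hi (selbergBase_one _), selbergBase_two, selbergBase_three,
    lintegral_coll_translate _ _ 1]
  refine lintegral_congr fun u => ?_
  congr 2
  ext k z
  rw [add_sub_cancel_right, show z + 1 - (1 + ε) = z - ε by ring]
  simp only [pairWeight, Real.rpow_zero, mul_one]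
  ring

theorem AdmissibleThree.uniform_bound_one (hL : 4 ≤ L) (hi : ∀ k ∈ Finset.Icc 4 L, i k ∈ Finset.Icc 1 L ∧ i k ≠ k)
    (hs : ∀ a b : ℕ, 4 ≤ a → a < b → b ≤ L → 0 < (s a b).re) (hs2 : ∀ k ∈ Finset.Icc 4 L, 0 < (s 2 k).re)
    (ht : AdmissibleThree L i s t) : ∃ C : ℝ, ∀ᶠ z in 𝓝[≠] (1 : ℂ),
      ∫⁻ x, ‖selbergKernel L i s (s 2) t (selbergBase z) x‖ₑ ≤ ENNReal.ofReal C := by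
  obtain ⟨cL, CU, hcL, hnear⟩ := exists_norm_add_rpow_bounds (zeroExp L i s)
  obtain ⟨C, hC⟩ := coll_uniform_bound (e := pairExp L i s) (p := twoExp L i (s 2)) (p' := threeExp L i t)
    (q := fun _ => 0) (r := fun _ => 0) (W := fun k z => ‖z + 1‖ ^ zeroExp L i s k) (pairExp_self hi)
    (fun _ => le_rfl) (fun k z => by positivity) (fun k => by fun_prop)
    (fun k => by
      filter_upwards [ae_ne (-1)] with z hz
      have : 0 < ‖z + 1‖ := norm_pos_iff.2 fun h => hz (by linear_combination h)
      positivity)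
    (δ := 1 / 2) (by norm_num) hcL (fun k z hz => (hnear k 1 z norm_one hz).1)
    (fun k z hz => (hnear k 1 z norm_one hz).2) (ε₀ := 1) one_pos
    (fun ε h0 h1 => by
      rw [← lintegral_kernel_one hL hi ε]
      refine integrable_selbergKernel_iff.1 (ht.integrable_kernel hL ?_ (by simpa using h0))
      intro h
      have : ε = -1 := by linear_combination h
      rw [this] at h1
      simp at h1)
    (fun K hK => by
      simpa only [add_zero] using clusterDeg_one_pos hs hs2 (fun k hk => (ht.re_pos hk).le) hK)
  refine ⟨C, ?_⟩
  have hmap : Tendsto (fun z : ℂ => z - 1) (𝓝[≠] 1) (𝓝[≠] 0) := by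
    refine tendsto_nhdsWithin_iff.2 ⟨?_, ?_⟩
    · have : Tendsto (fun z : ℂ => z - 1) (𝓝 1) (𝓝 (1 - 1)) := by
        exact (continuous_id.sub continuous_const).tendsto 1
      rw [sub_self] at this
      exact this.mono_left nhdsWithin_le_nhds
    · filter_upwards [self_mem_nhdsWithin] with z hz
      exact sub_ne_zero.2 hz
  filter_upwards [hmap.eventually hC] with z hz
  rw [← lintegral_kernel_one hL hi] at hz
  simpa using hz

/-- A union bound over the coordinate that leaves `U`. -/
theorem lintegral_compl_le_sum {ι : Type} [Fintype ι] {U : Set ℂ} {f : (ι → ℂ) → ENNReal} {h : ι → (ι → ℂ) → ENNReal}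
    (hU : MeasurableSet U) (hf : ∀ k, ∀ᵐ x : ι → ℂ, x k ∉ U → f x ≤ h k x) :
    ∫⁻ x in (Set.univ.pi fun _ => U)ᶜ, f x ≤ ∑ k, ∫⁻ x, h k x := by
  have hsub : (Set.univ.pi fun _ : ι => U)ᶜ ⊆ ⋃ k, {x : ι → ℂ | x k ∉ U} := by
    intro x hx
    simp only [Set.mem_compl_iff, Set.mem_univ_pi, not_forall] at hx
    exact Set.mem_iUnion.2 hx
  refine (setLIntegral_le_sum_cover hsub f).trans (Finset.sum_le_sum fun k _ => ?_)
  have hms : MeasurableSet {x : ι → ℂ | x k ∉ U} := hU.compl.preimage (measurable_pi_apply k)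
  calc ∫⁻ x in {x : ι → ℂ | x k ∉ U}, f x ≤ ∫⁻ x in {x : ι → ℂ | x k ∉ U}, h k x := by
        refine setLIntegral_mono_ae' hms ?_
        filter_upwards [hf k] with x hx using hx
    _ ≤ _ := setLIntegral_le_lintegral _ _

theorem exists_small_rpow_sum {ι : Type} [Fintype ι] (τ C : ι → ℝ) (hτ : ∀ k, 0 < τ k) {η : ℝ} (hη : 0 < η) :
    ∃ δ : ℝ, 0 < δ ∧ δ < 1 ∧ ∑ k, (2 * δ) ^ τ k * C k ≤ η := by
  have h2 : Tendsto (fun δ : ℝ => 2 * δ) (𝓝[>] 0) (𝓝 (2 * 0)) :=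
    ((continuous_const.mul continuous_id).tendsto 0).mono_left nhdsWithin_le_nhds
  have hlim : Tendsto (fun δ : ℝ => ∑ k, (2 * δ) ^ τ k * C k) (𝓝[>] 0) (𝓝 (∑ k, (2 * 0) ^ τ k * C k)) :=
    tendsto_finsetSum _ fun k _ => Tendsto.mul_const _ (h2.rpow_const (Or.inr (hτ k).le))
  have h0 : ∑ k, (2 * 0 : ℝ) ^ τ k * C k = 0 := Finset.sum_eq_zero fun k _ => by
    rw [mul_zero, Real.zero_rpow (hτ k).ne', zero_mul]
  rw [h0] at hlim
  have h1 : ∀ᶠ δ : ℝ in 𝓝[>] 0, δ < 1 :=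
    (tendsto_nhdsWithin_of_tendsto_nhds tendsto_id).eventually (gt_mem_nhds one_pos)
  obtain ⟨δ, a, b, c⟩ := ((hlim.eventually (ge_mem_nhds hη)).and (h1.and self_mem_nhdsWithin)).exists
  exact ⟨δ, c, b, a⟩

/-- Uniform integrability has two sources: near `1`, admissibility with a halved exponent; away from
`1`, domination by the kernel at one fixed position of `z₃`. -/
theorem AdmissibleThree.tendsto_kernel_one (hL : 4 ≤ L) (hi : ∀ k ∈ Finset.Icc 4 L, i k ∈ Finset.Icc 1 L ∧ i k ≠ k)
    (hs : ∀ a b : ℕ, 4 ≤ a → a < b → b ≤ L → 0 < (s a b).re) (hs2 : ∀ k ∈ Finset.Icc 4 L, 0 < (s 2 k).re)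
    (ht : AdmissibleThree L i s t)
    (ht' : ∀ k ∈ Finset.Icc 4 L, AdmissibleThree L i s (Function.update t k (t k / 2))) :
    Integrable (selbergKernel L i s (s 2) t (selbergBase 1)) ∧
    Tendsto (fun z => ∫ x, selbergKernel L i s (s 2) t (selbergBase z) x) (𝓝[≠] 1)
      (𝓝 (∫ x, selbergKernel L i s (s 2) t (selbergBase 1) x)) := by
  have hb := fun k : Finset.Icc 4 L => (ht' k k.2).uniform_bound_one hL hi hs hs2
  choose C hC using hb
  refine tendsto_integral_of_uniform_tails (fun z => measurable_selbergKernel _) (measurable_selbergKernel _) ?_ ?_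
  · filter_upwards [ae_generic (L := L) 1 1] with x hx
    have hx' : (∀ a b, a ≠ b → x a ≠ x b) ∧ (∀ k, x k ≠ 0) ∧ (∀ k, x k ≠ selbergBase 1 2) ∧
      ∀ k, x k ≠ selbergBase 1 3 := by rw [selbergBase_two, selbergBase_three]; exact hx
    exact tendsto_selbergKernel (P := selbergBase) (S := fun _ => t) hi hL (fun k => tendsto_selbergBase k)
      (fun k _ => tendsto_const_nhds) (selbergBase_one 1) hx'
  intro η hη
  have hsmall := exists_small_rpow_sum (fun k : Finset.Icc 4 L => (t k).re) (fun k => |C k|)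
    (fun k => ht.re_pos k.2) hη
  obtain ⟨δ, hδ0, hδ1, hδη⟩ := hsmall
  set U : Set ℂ := {z | δ ≤ ‖z - 1‖} with hU
  have hUm : MeasurableSet U := measurableSet_le measurable_const (by fun_prop)
  have hnhds : ∀ᶠ z in 𝓝[≠] (1 : ℂ), ‖z - 1‖ ≤ δ / 2 := by
    have : Metric.closedBall (1 : ℂ) (δ / 2) ∈ 𝓝[≠] (1 : ℂ) :=
      mem_nhdsWithin_of_mem_nhds (Metric.closedBall_mem_nhds _ (by positivity))
    filter_upwards [this] with z hz
    simpa [dist_eq_norm] using hz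
  refine ⟨Set.univ.pi fun _ => U, MeasurableSet.univ_pi fun _ => hUm, ?_, ?_⟩
  -- If `x k` lies within `δ` of `1`, then `‖x k - z‖ ≤ 2 * δ`. Halving `t k` frees the factor `‖x k
  -- - z‖ ^ (t k).re ≤ (2 * δ) ^ (t k).re`, and the remaining kernel has bounded integrals.
  · filter_upwards [eventually_all.2 hC, hnhds] with z hz hzδ
    have h1 := lintegral_compl_le_sum (ι := Finset.Icc 4 L) (U := U)
      (f := fun x => ‖selbergKernel L i s (s 2) t (selbergBase z) x‖ₑ)
      (h := fun k x => ENNReal.ofReal ((2 * δ) ^ (t k).re) *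
        ‖selbergKernel L i s (s 2) (Function.update t k (t k / 2)) (selbergBase z) x‖ₑ) hUm (fun k => by
        filter_upwards [ae_generic (L := L) 1 z] with x hx hxU
        have hx' : (∀ a b, a ≠ b → x a ≠ x b) ∧ (∀ k, x k ≠ 0) ∧ (∀ k, x k ≠ selbergBase z 2) ∧
          ∀ k, x k ≠ selbergBase z 3 := by rw [selbergBase_two, selbergBase_three]; exact hx
        rw [← ofReal_norm, norm_selbergKernel_update hL hi (selbergBase_one z) hx' k (t k / 2),
          ← ofReal_norm, ← ENNReal.ofReal_mul (by positivity), mul_comm, selbergBase_three]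
        refine ENNReal.ofReal_le_ofReal (mul_le_mul_of_nonneg_right ?_ (norm_nonneg _))
        have e1 : 2 * (t k).re - 2 * (t k / 2).re = (t k).re := by simp; ring
        rw [e1]
        refine Real.rpow_le_rpow (norm_nonneg _) ?_ (ht.re_pos k.2).le
        have hxU' : ‖x k - 1‖ < δ := not_le.1 hxU
        have := norm_sub_le (x k - 1) (z - 1)
        rw [show x k - 1 - (z - 1) = x k - z by ring] at this
        linarith)
    refine h1.trans ?_
    calc _ ≤ ∑ k : Finset.Icc 4 L, ENNReal.ofReal ((2 * δ) ^ (t k).re * |C k|) := by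
          refine Finset.sum_le_sum fun k _ => ?_
          rw [lintegral_const_mul' _ _ ENNReal.ofReal_ne_top, ENNReal.ofReal_mul (by positivity)]
          exact mul_le_mul_right ((hz k).trans (ENNReal.ofReal_le_ofReal (le_abs_self _))) _
      _ = ENNReal.ofReal (∑ k : Finset.Icc 4 L, (2 * δ) ^ (t k).re * |C k|) :=
          (ENNReal.ofReal_sum_of_nonneg fun k _ => by positivity).symm
      _ ≤ _ := ENNReal.ofReal_le_ofReal hδη
  -- When all coordinates are at distance at least `δ` from `1`, moving `z₃` within `δ / 2` of `1`
  -- changes each distance to it by a bounded factor. Any fixed point of that disc other than `1`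
  -- yields a majorant.
  · set z₀ : ℂ := ((1 + δ / 2 : ℝ) : ℂ) with hz₀
    have hz₀1 : z₀ - 1 = ((δ / 2 : ℝ) : ℂ) := by rw [hz₀]; push_cast; ring
    have hz₀n : ‖z₀ - 1‖ = δ / 2 := by
      rw [hz₀1, Complex.norm_real, Real.norm_of_nonneg (by positivity)]
    have hne0 : z₀ ≠ 0 := by rw [hz₀]; exact_mod_cast (by positivity : (1 + δ / 2 : ℝ) ≠ 0)
    have hne1 : z₀ ≠ 1 := by
      intro h; rw [h, sub_self, norm_zero] at hz₀n; linarith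
    refine ⟨fun x => (∏ k : Finset.Icc 4 L, (2 : ℝ) ^ |threeExp L i t k| * 2 ^ |threeExp L i t k|) *
      ‖selbergKernel L i s (s 2) t (selbergBase z₀) x‖,
      ((ht.integrable_kernel hL hne0 hne1).norm.const_mul _).integrableOn, ?_⟩
    filter_upwards [hnhds] with z hz
    refine (ae_restrict_iff' (MeasurableSet.univ_pi fun _ => hUm)).2 ?_
    filter_upwards [ae_generic (L := L) 1 z, ae_generic (L := L) 1 z₀] with x hx hx₀ hxU
    have hx' : (∀ a b, a ≠ b → x a ≠ x b) ∧ (∀ k, x k ≠ 0) ∧ (∀ k, x k ≠ selbergBase z 2) ∧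
          ∀ k, x k ≠ selbergBase z 3 := by rw [selbergBase_two, selbergBase_three]; exact hx
    have hx₀' : (∀ a b, a ≠ b → x a ≠ x b) ∧ (∀ k, x k ≠ 0) ∧ (∀ k, x k ≠ selbergBase z₀ 2) ∧
          ∀ k, x k ≠ selbergBase z₀ 3 := by rw [selbergBase_two, selbergBase_three]; exact hx₀
    rw [norm_selbergKernel hL hi (selbergBase_one z) hx'.1 hx'.2.1 hx'.2.2.1 hx'.2.2.2,
      norm_selbergKernel hL hi (selbergBase_one z₀) hx₀'.1 hx₀'.2.1 hx₀'.2.2.1 hx₀'.2.2.2]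
    refine coll_le_prod_mul (fun k z => by positivity) fun k => ?_
    rw [selbergBase_two, selbergBase_three, selbergBase_two, selbergBase_three]
    have h1 : δ ≤ ‖x k - 1‖ := hxU k trivial
    have hpos : 0 < ‖x k - 1‖ := hδ0.trans_le h1
    obtain ⟨a1, a2, a3⟩ := norm_sub_comparable (ε := z - 1) hpos (by linarith)
    obtain ⟨b1, b2, b3⟩ := norm_sub_comparable (ε := z₀ - 1) hpos (by linarith)
    rw [show x k - 1 - (z - 1) = x k - z by ring] at a1 a2 a3
    rw [show x k - 1 - (z₀ - 1) = x k - z₀ by ring] at b1 b2 b3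
    have c1 := rpow_le_two_rpow_mul a1 hpos a2 a3 (threeExp L i t k)
    have c2 := rpow_le_two_rpow_mul hpos b1 b3 b2 (threeExp L i t k)
    calc _ ≤ ‖x k‖ ^ zeroExp L i s k * ‖x k - 1‖ ^ twoExp L i (s 2) k *
          (2 ^ |threeExp L i t k| * (2 ^ |threeExp L i t k| * ‖x k - z₀‖ ^ threeExp L i t k)) := by
          gcongr
          exact c1.trans (by gcongr)
      _ = _ := by ring

end

/-! ### Inversion, rescaling and the inner limit `z₃ → 0`. -/

/-- Since `‖a⁻¹ - b⁻¹‖ = ‖a - b‖ / (‖a‖ * ‖b‖)`, inversion keeps the pair exponents and only changes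
the one-variable weights. -/
theorem coll_inv {ι : Type} [Fintype ι] (e : ι → ι → ℝ) (g : ι → ℂ → ℝ) {u : ι → ℂ} (hu : ∀ k, u k ≠ 0) :
    coll e g (fun k => (u k)⁻¹) =
      coll e (fun k z => ‖z‖ ^ (-∑ b, (e k b + e b k)) * g k z⁻¹) u := by
  have n0 : ∀ k, 0 < ‖u k‖ := fun k => norm_pos_iff.2 (hu k)
  have h1 (a b : ι) : ‖(u a)⁻¹ - (u b)⁻¹‖ ^ e a b = ‖u a - u b‖ ^ e a b * (‖u a‖ ^ (-e a b) * ‖u b‖ ^ (-e a b)) := by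
    rw [inv_sub_inv (hu a) (hu b), norm_div, norm_mul, norm_sub_rev, Real.div_rpow (norm_nonneg _) (by positivity),
      Real.mul_rpow (n0 a).le (n0 b).le, Real.rpow_neg (n0 a).le, Real.rpow_neg (n0 b).le, div_eq_mul_inv, mul_inv]
  have h2 (k : ι) : ‖u k‖ ^ (-∑ b, (e k b + e b k)) = (∏ b, ‖u k‖ ^ (-e k b)) * ∏ b, ‖u k‖ ^ (-e b k) := by
    rw [← Finset.prod_mul_distrib, ← Finset.sum_neg_distrib, Real.rpow_sum_of_pos (n0 k)]
    refine Finset.prod_congr rfl fun b _ => ?_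
    rw [← Real.rpow_add (n0 k), neg_add]
  simp only [coll, h1, h2, Finset.prod_mul_distrib]
  rw [Finset.prod_comm (f := fun a b => ‖u b‖ ^ (-e a b))]
  ring

theorem lintegral_coll_inv {ι : Type} [Fintype ι] (e : ι → ι → ℝ) (g : ι → ℂ → ℝ) :
    ∫⁻ u, ENNReal.ofReal (coll e g u) = ∫⁻ u, ENNReal.ofReal
      (coll e (fun k z => ‖z‖ ^ (-∑ b, (e k b + e b k) - 4) * g k z⁻¹) u) := by
  rw [lintegral_comp_inv]
  refine lintegral_congr_ae ?_
  filter_upwards [ae_all_iff.2 fun k => ae_apply_of_ae k (ae_ne 0)] with u hu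
  rw [coll_inv e g hu, ← ENNReal.ofReal_mul (Finset.prod_nonneg fun k _ => by positivity)]
  congr 1
  simp only [coll]
  rw [mul_left_comm, ← Finset.prod_mul_distrib]
  congr 1
  refine Finset.prod_congr rfl fun k _ => ?_
  rw [← mul_assoc, ← Real.rpow_add (norm_pos_iff.2 (hu k))]
  congr 2
  ring

/-- The fixed points `0`, `1`, `z₃` after division by `z₃`. -/
noncomputable def scaledBase (ζ : ℂ) : ℕ → ℂ := fun k => if k = 2 then ζ⁻¹ else if k = 3 then 1 else 0

theorem scaledBase_one (ζ : ℂ) : scaledBase ζ 1 = 0 := by simp [scaledBase]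
theorem scaledBase_two (ζ : ℂ) : scaledBase ζ 2 = ζ⁻¹ := by simp [scaledBase]
theorem scaledBase_three (ζ : ℂ) : scaledBase ζ 3 = 1 := by simp [scaledBase]

theorem smul_scaledBase {ζ : ℂ} (h : ζ ≠ 0) : ζ • scaledBase ζ = selbergBase ζ := by
  ext k
  simp only [scaledBase, selbergBase, Pi.smul_apply, smul_eq_mul]
  split_ifs <;> simp [h]

/-- The kernel in the variables `z_k / z₃`, normalized to have a limit for `z₃ → 0`. -/
noncomputable def scaledKernel (L : ℕ) (i : ℕ → ℕ) (s : ℕ → ℕ → ℂ) (t : ℕ → ℂ) (ζ : ℂ) (w : Finset.Icc 4 L → ℂ) : ℂ :=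
  absPow ζ (∑ k ∈ Finset.Icc 4 L, s 2 k) * selbergKernel L i s (s 2) t (scaledBase ζ) w

section
variable {L : ℕ} {i : ℕ → ℕ} {s : ℕ → ℕ → ℂ} {t : ℕ → ℂ}

/-- Apart from the term `t 1` of the fixed pair of labels `1`, `3`, this is the dilation exponent of
the absolute powers in the kernel with the point `2` left out. -/
theorem sMax_withThree (hL : 4 ≤ L) : sMax L (withThree s t) = t 1 +
    (∑ a ∈ Finset.Icc 4 L, ∑ b ∈ Finset.Ioc a L, s a b + ∑ k ∈ Finset.Icc 4 L, (s 1 k + t k)) := by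
  have e1 : (Finset.Icc 1 L).erase 2 = insert 1 (insert 3 (Finset.Icc 4 L)) := by
    ext a; simp only [Finset.mem_erase, Finset.mem_insert, Finset.mem_Icc]; omega
  have e2 : (Finset.Ioc 1 L).erase 2 = insert 3 (Finset.Icc 4 L) := by
    ext a; simp only [Finset.mem_erase, Finset.mem_insert, Finset.mem_Icc, Finset.mem_Ioc]; omega
  have e3 : (Finset.Ioc 3 L).erase 2 = Finset.Icc 4 L := by
    ext a; simp only [Finset.mem_erase, Finset.mem_Icc, Finset.mem_Ioc]; omega
  have e4 : ∀ a ∈ Finset.Icc 4 L, ∑ b ∈ (Finset.Ioc a L).erase 2, withThree s t a b = ∑ b ∈ Finset.Ioc a L, s a b := by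
    intro a ha
    rw [Finset.mem_Icc] at ha
    rw [Finset.erase_eq_of_notMem (by simp; omega)]
    refine Finset.sum_congr rfl fun b hb => ?_
    rw [Finset.mem_Ioc] at hb
    rw [withThree, if_neg (by omega), if_neg (by omega)]
  have e5 : ∑ b ∈ Finset.Icc 4 L, withThree s t 1 b = ∑ b ∈ Finset.Icc 4 L, s 1 b := by
    refine Finset.sum_congr rfl fun b hb => ?_
    rw [Finset.mem_Icc] at hb
    rw [withThree, if_neg (by omega), if_neg (by omega)]
  rw [sMax, e1, Finset.sum_insert (by simp), Finset.sum_insert (by simp), e2, e3,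
    Finset.sum_insert (by simp), Finset.sum_congr rfl e4, e5, Finset.sum_add_distrib]
  simp only [withThree, if_true]
  norm_num
  ring

theorem kernel_selbergBase_smul {ζ : ℂ} (h : ζ ≠ 0) (w : Finset.Icc 4 L → ℂ) :
    selbergKernel L i s (s 2) t (selbergBase ζ) (ζ • w) =
      absPow ζ (∑ a ∈ Finset.Icc 4 L, ∑ b ∈ Finset.Ioc a L, s a b + ∑ k ∈ Finset.Icc 4 L, (s 1 k + t k)) *
        (1 / conj ζ) * (1 / (ζ * conj ζ)) ^ (Finset.Icc 4 L).card * scaledKernel L i s t ζ w := by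
  rw [← smul_scaledBase h, selbergKernel_smul h, scaledKernel]
  have : ∑ a ∈ Finset.Icc 4 L, ∑ b ∈ Finset.Ioc a L, s a b + ∑ k ∈ Finset.Icc 4 L, (s 1 k + s 2 k + t k) =
      (∑ a ∈ Finset.Icc 4 L, ∑ b ∈ Finset.Ioc a L, s a b + ∑ k ∈ Finset.Icc 4 L, (s 1 k + t k)) +
        ∑ k ∈ Finset.Icc 4 L, s 2 k := by
    simp only [Finset.sum_add_distrib]; ring
  rw [this, absPow_add h]
  ring

/-- Under `z = ζ w` the Jacobian cancels the scaling of the rational factors, and the prefactor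
`conj z₃` cancels that of `1 / conj z_L`. Only `|ζ|^{2 s_max}` is left. -/
theorem integral_selbergIntegrand_eq (hL : 4 ≤ L) {ζ : ℂ} (h : ζ ≠ 0) :
    ∫ x, selbergIntegrand L i (withThree s t) ζ x =
      absPow ζ (sMax L (withThree s t)) * absPow (1 - ζ) (t 2) * ∫ w, scaledKernel L i s t ζ w := by
  have hn : 0 < ‖ζ‖ := norm_pos_iff.2 h
  have h1 := integral_comp_const_smul ζ h (selbergIntegrand L i (withThree s t) ζ)
  have h2 (w : Finset.Icc 4 L → ℂ) : selbergIntegrand L i (withThree s t) ζ (ζ • w) =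
      (absPow ζ (sMax L (withThree s t)) * absPow (1 - ζ) (t 2) * (1 / (ζ * conj ζ)) ^ (Finset.Icc 4 L).card) *
        scaledKernel L i s t ζ w := by
    rw [selbergIntegrand_eq hL, kernel_selbergBase_smul h, sMax_withThree hL, absPow_add h (t 1)]
    have hc : conj ζ ≠ 0 := by simpa using h
    field_simp
  have h3 : (((‖ζ‖ ^ (-(2 * Fintype.card (Finset.Icc 4 L) : ℝ)) : ℝ)) : ℂ) =
      (1 / (ζ * conj ζ)) ^ (Finset.Icc 4 L).card := by
    rw [mul_conj, normSq_eq_norm_sq, Fintype.card_coe, Real.rpow_neg hn.le]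
    rw [show (2 * ((Finset.Icc 4 L).card : ℝ)) = ((2 * (Finset.Icc 4 L).card : ℕ) : ℝ) by push_cast; ring,
      Real.rpow_natCast, pow_mul]
    push_cast
    rw [one_div, inv_pow]
  simp only [h2, h3] at h1
  rw [integral_const_mul] at h1
  have hne : (1 / (ζ * conj ζ)) ^ (Finset.Icc 4 L).card ≠ 0 := by
    refine pow_ne_zero _ (one_div_ne_zero (mul_ne_zero h (by simpa using h)))
  refine mul_left_cancel₀ hne ?_
  rw [← h1]; ring

theorem AdmissibleThree.integrable_scaledKernel (hL : 4 ≤ L) (ht : AdmissibleThree L i s t) {ζ : ℂ} (h0 : ζ ≠ 0)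
    (h1 : ζ ≠ 1) : Integrable (scaledKernel L i s t ζ) := by
  have hk := integrable_selbergKernel_iff.1 (ht.integrable_kernel hL h0 h1)
  have hc : conj ζ ≠ 0 := by simpa using h0
  have hI : Integrable fun w => selbergKernel L i s (s 2) t (selbergBase ζ) (ζ • w) := by
    refine ⟨((measurable_selbergKernel _).comp (measurable_const_smul ζ)).aestronglyMeasurable, ?_⟩
    have := lintegral_comp_const_smul ζ h0 fun x => ‖selbergKernel L i s (s 2) t (selbergBase ζ) x‖ₑ
    rw [HasFiniteIntegral, this]
    exact ENNReal.mul_lt_top ENNReal.ofReal_lt_top hk.lt_top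
  simp only [kernel_selbergBase_smul h0] at hI
  refine (integrable_const_mul_iff (isUnit_iff_ne_zero.2 ?_) _).1 hI
  refine mul_ne_zero (mul_ne_zero (absPow_ne_zero h0 _) (one_div_ne_zero hc)) (pow_ne_zero _ (one_div_ne_zero (mul_ne_zero h0 hc)))

/-- The exponent of `‖z₃‖` in the rescaled kernel contributed by the index `k`. -/
noncomputable def twoInd (L : ℕ) (i : ℕ → ℕ) (k : Finset.Icc 4 L) : ℝ := if i k = 2 then 1 else 0

theorem twoInd_nonneg (k : Finset.Icc 4 L) : 0 ≤ twoInd L i k := by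
  unfold twoInd; split_ifs <;> norm_num

/-- The normalizing power turns `‖x k - ζ⁻¹‖` into `‖ζ * x k - 1‖`, which is regular at `ζ = 0`. A
pole with `i k = 2` lowers the exponent by one, so that one factor `‖ζ‖` stays behind. -/
theorem norm_scaledKernel (hL : 4 ≤ L) (hi : ∀ k ∈ Finset.Icc 4 L, i k ∈ Finset.Icc 1 L ∧ i k ≠ k) {ζ : ℂ}
    (h : ζ ≠ 0) {x : Finset.Icc 4 L → ℂ} (hx : (∀ a b, a ≠ b → x a ≠ x b) ∧
    (∀ k, x k ≠ 0) ∧ (∀ k, x k ≠ ζ⁻¹) ∧ ∀ k, x k ≠ 1) :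
    ‖scaledKernel L i s t ζ x‖ = coll (pairExp L i s) (fun k z => ‖z‖ ^ zeroExp L i s k *
      (‖ζ * z - 1‖ ^ twoExp L i (s 2) k * ‖ζ‖ ^ twoInd L i k) * ‖z - 1‖ ^ threeExp L i t k) x := by
  have hn : 0 < ‖ζ‖ := norm_pos_iff.2 h
  rw [scaledKernel, norm_mul, norm_selbergKernel hL hi (scaledBase_one _) hx.1 hx.2.1
    (by rw [scaledBase_two]; exact hx.2.2.1) (by rw [scaledBase_three]; exact hx.2.2.2),
    absPow_sum h, norm_prod, ← Finset.prod_coe_sort]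
  simp only [coll, norm_absPow h, scaledBase_two, scaledBase_three]
  rw [mul_left_comm, ← Finset.prod_mul_distrib]
  congr 1
  refine Finset.prod_congr rfl fun k _ => ?_
  have e1 : ‖ζ * x k - 1‖ = ‖ζ‖ * ‖x k - ζ⁻¹‖ := by rw [← norm_mul, mul_sub, mul_inv_cancel₀ h]
  have e2 : ‖ζ‖ ^ (2 * (s 2 k).re) = ‖ζ‖ ^ twoExp L i (s 2) k * ‖ζ‖ ^ twoInd L i k := by
    rw [← Real.rpow_add hn, twoExp, twoInd, sub_add_cancel]
  rw [e1, e2, Real.mul_rpow hn.le (norm_nonneg _)]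
  ring

/-- The exponent at infinity of the variable `k`, seen in the coordinate `1 / w_k`. -/
noncomputable def infExp (L : ℕ) (i : ℕ → ℕ) (s : ℕ → ℕ → ℂ) (t : ℕ → ℂ) (k : Finset.Icc 4 L) : ℝ :=
  -∑ b, (pairExp L i s k b + pairExp L i s b k) - 4 - zeroExp L i s k - twoExp L i (s 2) k - threeExp L i t k

/-- Inversion sends infinity and `ζ⁻¹` to `0` and `ζ`, so that the escaping base point becomes a
merging one. -/
theorem lintegral_scaledKernel (hL : 4 ≤ L) (hi : ∀ k ∈ Finset.Icc 4 L, i k ∈ Finset.Icc 1 L ∧ i k ≠ k) {ζ : ℂ}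
    (h : ζ ≠ 0) : ∫⁻ x, ‖scaledKernel L i s t ζ x‖ₑ = ∫⁻ u, ENNReal.ofReal (coll (pairExp L i s)
      (fun k z => pairWeight (infExp L i s t k) (twoExp L i (s 2) k) (twoInd L i k) 0 ζ z *
        ‖z + -1‖ ^ threeExp L i t k) u) := by
  have h1 : ∫⁻ x, ‖scaledKernel L i s t ζ x‖ₑ = ∫⁻ x, ENNReal.ofReal (coll (pairExp L i s)
      (fun k z => ‖z‖ ^ zeroExp L i s k *
      (‖ζ * z - 1‖ ^ twoExp L i (s 2) k * ‖ζ‖ ^ twoInd L i k) * ‖z - 1‖ ^ threeExp L i t k) x) := by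
    refine lintegral_congr_ae ?_
    filter_upwards [ae_generic (L := L) ζ⁻¹ 1] with x hx
    rw [← ofReal_norm, norm_scaledKernel hL hi h hx]
  rw [h1, lintegral_coll_inv]
  refine lintegral_congr_ae ?_
  filter_upwards [ae_all_iff.2 fun k => ae_apply_of_ae k (ae_ne 0)] with u hu
  congr 1
  simp only [coll]
  congr 1
  refine Finset.prod_congr rfl fun k _ => ?_
  have n0 : 0 < ‖u k‖ := norm_pos_iff.2 (hu k)
  have e1 : ‖ζ * (u k)⁻¹ - 1‖ = ‖u k - ζ‖ * ‖u k‖⁻¹ := by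
    rw [← norm_inv, ← norm_mul, sub_mul, mul_inv_cancel₀ (hu k), norm_sub_rev]
  have e2 : ‖(u k)⁻¹ - 1‖ = ‖u k + -1‖ * ‖u k‖⁻¹ := by
    rw [← norm_inv, ← norm_mul, add_mul, mul_inv_cancel₀ (hu k), norm_sub_rev, neg_one_mul, sub_eq_add_neg]
  rw [e1, e2, norm_inv, Real.mul_rpow (norm_nonneg _) (by positivity), Real.mul_rpow (norm_nonneg _) (by positivity),
    Real.inv_rpow n0.le, Real.inv_rpow n0.le, Real.inv_rpow n0.le, ← Real.rpow_neg n0.le, ← Real.rpow_neg n0.le,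
    ← Real.rpow_neg n0.le, pairWeight, infExp, Real.rpow_zero, mul_one]
  simp only [sub_eq_add_neg, Real.rpow_add n0]
  ring

/-- No sign condition is imposed at infinity; positivity is read off from convergence at the single
value `ζ = 1 / 2`. For `‖z‖ ≤ 1 / 4` the inverted base points `1 / 2` and `1` stay away, and their
weights are bounded below. -/
theorem AdmissibleThree.infExp_clusterDeg_pos (hL : 4 ≤ L)
    (hi : ∀ k ∈ Finset.Icc 4 L, i k ∈ Finset.Icc 1 L ∧ i k ≠ k) (ht : AdmissibleThree L i s t)
    {K : Finset (Finset.Icc 4 L)} (hK : K.Nonempty) : 0 < clusterDeg (pairExp L i s) (infExp L i s t) K := by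
  obtain ⟨cβ, _, hcβ, hβ⟩ := exists_norm_add_rpow_bounds (twoExp L i (s 2))
  obtain ⟨cγ, _, hcγ, hγ⟩ := exists_norm_add_rpow_bounds (threeExp L i t)
  have h2 : ((1 / 2 : ℝ) : ℂ) ≠ 0 := by norm_num
  have hfin := (ht.integrable_scaledKernel hL (ζ := ((1 / 2 : ℝ) : ℂ)) h2 (by norm_num)).2.ne
  rw [lintegral_scaledKernel hL hi h2] at hfin
  have n1 : ‖(-1 : ℂ)‖ = 1 := by simp
  have nh : ‖((1 / 2 : ℝ) : ℂ)‖ = 1 / 2 := by rw [Complex.norm_real]; norm_num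
  refine clusterDeg_pos_of_integrable (pairExp_self hi)
    (W := fun k z => ‖2 * z + -1‖ ^ twoExp L i (s 2) k * ‖z + -1‖ ^ threeExp L i t k) (fun k z => by positivity)
    (fun k => by fun_prop) (fun k => ?_) (δ := 1 / 4) (by norm_num) (mul_pos hcβ hcγ) (fun k z hz => ?_) ?_ hK
  · filter_upwards [ae_ne 1, ae_ne ((1 / 2 : ℝ) : ℂ)] with z hz hz2
    have a1 : 0 < ‖z + -1‖ := norm_pos_iff.2 fun h => hz (by linear_combination h)
    have a2 : 0 < ‖2 * z + -1‖ := norm_pos_iff.2 fun h => hz2 (by push_cast; linear_combination h / 2)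
    positivity
  · have a1 : ‖2 * z‖ ≤ 1 / 2 := by rw [norm_mul]; norm_num; linarith
    exact mul_le_mul (hβ k (-1) (2 * z) n1 a1).1 (hγ k (-1) z n1 (by linarith)).1 hcγ.le (by positivity)
  · refine ne_top_of_le_ne_top (ENNReal.mul_ne_top (ENNReal.ofReal_ne_top
      (r := ∏ k, ((2 : ℝ) ^ twoExp L i (s 2) k * 2 ^ twoInd L i k))) hfin) ?_
    rw [← lintegral_const_mul' _ _ ENNReal.ofReal_ne_top]
    refine lintegral_mono fun u => ?_
    rw [← ENNReal.ofReal_mul (Finset.prod_nonneg fun k _ => by positivity)]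
    refine ENNReal.ofReal_le_ofReal (coll_le_prod_mul (fun k z => by positivity) fun k => le_of_eq ?_)
    have e1 : ‖2 * u k + -1‖ = 2 * ‖u k - ((1 / 2 : ℝ) : ℂ)‖ := by
      have : 2 * u k + -1 = 2 * (u k - ((1 / 2 : ℝ) : ℂ)) := by push_cast; ring
      rw [this, norm_mul]; norm_num
    have e2 : (2 : ℝ) ^ twoInd L i k * (1 / 2) ^ twoInd L i k = 1 := by
      rw [← Real.mul_rpow (by norm_num) (by norm_num)]; norm_num
    rw [e1, Real.mul_rpow (by norm_num) (norm_nonneg _), pairWeight, nh, Real.rpow_zero]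
    linear_combination (-(‖u k‖ ^ infExp L i s t k * 2 ^ twoExp L i (s 2) k *
      ‖u k - ((1 / 2 : ℝ) : ℂ)‖ ^ twoExp L i (s 2) k * ‖u k + -1‖ ^ threeExp L i t k)) * e2

theorem AdmissibleThree.uniform_bound_zero (hL : 4 ≤ L) (hi : ∀ k ∈ Finset.Icc 4 L, i k ∈ Finset.Icc 1 L ∧ i k ≠ k)
    (hs2 : ∀ k ∈ Finset.Icc 4 L, 0 < (s 2 k).re)
    (ht : AdmissibleThree L i s t) : ∃ C : ℝ, ∀ᶠ ζ in 𝓝[≠] (0 : ℂ),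
      ∫⁻ x, ‖scaledKernel L i s t ζ x‖ₑ ≤ ENNReal.ofReal C := by
  obtain ⟨cL, CU, hcL, hnear⟩ := exists_norm_add_rpow_bounds (threeExp L i t)
  have n1 : ‖(-1 : ℂ)‖ = 1 := by simp
  obtain ⟨C, hC⟩ := coll_uniform_bound (e := pairExp L i s) (p := infExp L i s t) (p' := twoExp L i (s 2))
    (q := twoInd L i) (r := fun _ => 0) (W := fun k z => ‖z + -1‖ ^ threeExp L i t k) (pairExp_self hi)
    (fun k => twoInd_nonneg k) (fun k z => by positivity) (fun k => by fun_prop)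
    (fun k => by
      filter_upwards [ae_ne 1] with z hz
      have : 0 < ‖z + -1‖ := norm_pos_iff.2 fun h => hz (by linear_combination h)
      positivity)
    (δ := 1 / 2) (by norm_num) hcL (fun k z hz => (hnear k (-1) z n1 hz).1)
    (fun k z hz => (hnear k (-1) z n1 hz).2) (ε₀ := 1) one_pos
    (fun ζ h0 h1 => by
      rw [← lintegral_scaledKernel hL hi h0]
      refine (ht.integrable_scaledKernel hL h0 ?_).2.ne
      rintro rfl
      simp at h1)
    -- In the joint degree `twoInd` cancels the pole in `twoExp`. The merged cluster therefore has
    -- the degree at infinity plus `∑ 2 * (s 2 k).re`.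
    (fun K hK => by
      have h1 := ht.infExp_clusterDeg_pos hL hi hK
      have h2 : 0 ≤ ∑ k ∈ K, 2 * (s 2 k).re := Finset.sum_nonneg fun k _ => by have := hs2 k k.2; linarith
      have h3 : clusterDeg (pairExp L i s) (fun k => infExp L i s t k + twoExp L i (s 2) k + twoInd L i k + 0) K =
          clusterDeg (pairExp L i s) (infExp L i s t) K + ∑ k ∈ K, 2 * (s 2 k).re := by
        rw [clusterDeg_eq_sum, clusterDeg_eq_sum, ← Finset.sum_add_distrib]
        refine Finset.sum_congr rfl fun k _ => ?_
        rw [twoExp, twoInd]; ring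
      linarith)
  refine ⟨C, ?_⟩
  filter_upwards [hC, self_mem_nhdsWithin] with ζ h1 h0
  rwa [lintegral_scaledKernel hL hi h0]

theorem measurable_scaledKernel (ζ : ℂ) : Measurable (scaledKernel L i s t ζ) :=
  measurable_const.mul (measurable_selbergKernel _)

theorem norm_scaledKernel_update (hL : 4 ≤ L)
    (hi : ∀ k ∈ Finset.Icc 4 L, i k ∈ Finset.Icc 1 L ∧ i k ≠ k) {ζ : ℂ}
    {x : Finset.Icc 4 L → ℂ} (hx : (∀ a b, a ≠ b → x a ≠ x b) ∧
    (∀ k, x k ≠ 0) ∧ (∀ k, x k ≠ ζ⁻¹) ∧ ∀ k, x k ≠ 1) (k₀ : Finset.Icc 4 L) (c : ℂ) :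
    ‖scaledKernel L i s t ζ x‖ = ‖scaledKernel L i s (Function.update t k₀ c) ζ x‖ *
      ‖x k₀ - 1‖ ^ (2 * (t k₀).re - 2 * c.re) := by
  rw [scaledKernel, scaledKernel, norm_mul, norm_mul, norm_selbergKernel_update hL hi (scaledBase_one ζ)
    (by rw [scaledBase_two, scaledBase_three]; exact hx) k₀ c, scaledBase_three, mul_assoc]

/-- The tails now lie at infinity. Doubling `t k` there leaves the decaying factor `‖x k - 1‖ ^ (-2
* (t k).re)` in front of a kernel with bounded integrals. -/
theorem AdmissibleThree.tendsto_scaledKernel (hL : 4 ≤ L) (hi : ∀ k ∈ Finset.Icc 4 L, i k ∈ Finset.Icc 1 L ∧ i k ≠ k)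
    (hs2 : ∀ k ∈ Finset.Icc 4 L, 0 < (s 2 k).re)
    (ht : AdmissibleThree L i s t)
    (ht' : ∀ k ∈ Finset.Icc 4 L, AdmissibleThree L i s (Function.update t k (2 * t k)))
    {f : (Finset.Icc 4 L → ℂ) → ℂ} (hf : Measurable f)
    (hlim : ∀ᵐ x, Tendsto (fun ζ => scaledKernel L i s t ζ x) (𝓝[≠] 0) (𝓝 (f x))) :
    Integrable f ∧ Tendsto (fun ζ => ∫ x, scaledKernel L i s t ζ x) (𝓝[≠] 0) (𝓝 (∫ x, f x)) := by
  have hb := fun k : Finset.Icc 4 L => (ht' k k.2).uniform_bound_zero hL hi hs2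
  choose C hC using hb
  refine tendsto_integral_of_uniform_tails (fun z => measurable_scaledKernel _) hf hlim ?_
  intro η hη
  have hsmall := exists_small_rpow_sum (fun k : Finset.Icc 4 L => 2 * (t k).re) (fun k => |C k|)
    (fun k => by have := ht.re_pos k.2; linarith) hη
  obtain ⟨δ, hδ0, hδ1, hδη⟩ := hsmall
  -- Beyond this radius `‖x k - 1‖ ≥ (2 * δ)⁻¹`.
  set R : ℝ := 1 + (2 * δ)⁻¹ with hR
  have hR0 : 0 < R := by positivity
  set U : Set ℂ := {z | ‖z‖ ≤ R} with hU
  have hUm : MeasurableSet U := measurableSet_norm_le R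
  -- For `‖ζ‖ ≤ ‖ζ₀‖` and `‖x k‖ ≤ R` one has `‖ζ * x k‖ ≤ 1 / 2`. The factors `‖ζ * x k - 1‖` are
  -- then comparable to `1`, and the kernel at `ζ₀` serves as majorant on bounded sets.
  set ζ₀ : ℂ := (((2 * R)⁻¹ : ℝ) : ℂ) with hζ₀
  have hζ₀n : ‖ζ₀‖ = (2 * R)⁻¹ := by rw [hζ₀, Complex.norm_real, Real.norm_of_nonneg (by positivity)]
  have hne0 : ζ₀ ≠ 0 := by rw [← norm_pos_iff, hζ₀n]; positivity
  have hne1 : ζ₀ ≠ 1 := by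
    intro h
    rw [h, norm_one] at hζ₀n
    have : (2 * R)⁻¹ < 1 := inv_lt_one_of_one_lt₀ (by have : 0 < (2 * δ)⁻¹ := by positivity
                                                      linarith)
    linarith
  have hnhds : ∀ᶠ z in 𝓝[≠] (0 : ℂ), ‖z‖ ≤ (2 * R)⁻¹ := by
    have : Metric.closedBall (0 : ℂ) (2 * R)⁻¹ ∈ 𝓝[≠] (0 : ℂ) :=
      mem_nhdsWithin_of_mem_nhds (Metric.closedBall_mem_nhds _ (by positivity))
    filter_upwards [this] with z hz
    simpa using hz
  refine ⟨Set.univ.pi fun _ => U, MeasurableSet.univ_pi fun _ => hUm, ?_, ?_⟩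
  · filter_upwards [eventually_all.2 hC] with z hz
    have h1 := lintegral_compl_le_sum (ι := Finset.Icc 4 L) (U := U)
      (f := fun x => ‖scaledKernel L i s t z x‖ₑ)
      (h := fun k x => ENNReal.ofReal ((2 * δ) ^ (2 * (t k).re)) *
        ‖scaledKernel L i s (Function.update t k (2 * t k)) z x‖ₑ) hUm (fun k => by
        filter_upwards [ae_generic (L := L) z⁻¹ 1] with x hx hxU
        rw [← ofReal_norm, norm_scaledKernel_update hL hi hx k (2 * t k),
          ← ofReal_norm, ← ENNReal.ofReal_mul (by positivity), mul_comm]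
        refine ENNReal.ofReal_le_ofReal (mul_le_mul_of_nonneg_right ?_ (norm_nonneg _))
        have e1 : 2 * (t k).re - 2 * (2 * t k).re = -(2 * (t k).re) := by simp; ring
        have hxU' : R < ‖x k‖ := not_le.1 hxU
        have h3 := norm_sub_norm_le (x k) 1
        rw [norm_one] at h3
        have h4 : (2 * δ)⁻¹ ≤ ‖x k - 1‖ := by linarith
        have hτ := ht.re_pos k.2
        rw [e1, ← inv_inv (2 * δ), Real.inv_rpow (by positivity), ← Real.rpow_neg (by positivity)]
        exact Real.rpow_le_rpow_of_nonpos (by positivity) h4 (by linarith))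
    refine h1.trans ?_
    calc _ ≤ ∑ k : Finset.Icc 4 L, ENNReal.ofReal ((2 * δ) ^ (2 * (t k).re) * |C k|) := by
          refine Finset.sum_le_sum fun k _ => ?_
          rw [lintegral_const_mul' _ _ ENNReal.ofReal_ne_top, ENNReal.ofReal_mul (by positivity)]
          exact mul_le_mul_right ((hz k).trans (ENNReal.ofReal_le_ofReal (le_abs_self _))) _
      _ = ENNReal.ofReal (∑ k : Finset.Icc 4 L, (2 * δ) ^ (2 * (t k).re) * |C k|) :=
          (ENNReal.ofReal_sum_of_nonneg fun k _ => by positivity).symm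
      _ ≤ _ := ENNReal.ofReal_le_ofReal hδη
  · obtain ⟨cL, CU, hcL, hnear⟩ := exists_norm_add_rpow_bounds (twoExp L i (s 2))
    have n1 : ‖(-1 : ℂ)‖ = 1 := by simp
    refine ⟨fun x => (∏ _k : Finset.Icc 4 L, CU / cL) * ‖scaledKernel L i s t ζ₀ x‖,
      ((ht.integrable_scaledKernel hL hne0 hne1).norm.const_mul _).integrableOn, ?_⟩
    filter_upwards [hnhds, self_mem_nhdsWithin] with z hz hz0
    refine (ae_restrict_iff' (MeasurableSet.univ_pi fun _ => hUm)).2 ?_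
    filter_upwards [ae_generic (L := L) z⁻¹ 1, ae_generic (L := L) ζ₀⁻¹ 1] with x hx hx₀ hxU
    rw [norm_scaledKernel hL hi hz0 hx, norm_scaledKernel hL hi hne0 hx₀]
    refine coll_le_prod_mul (fun k z => by positivity) fun k => ?_
    have hsm : ∀ w : ℂ, ‖w‖ ≤ (2 * R)⁻¹ → ‖w * x k‖ ≤ 1 / 2 := by
      intro w hw
      have h1 : ‖x k‖ ≤ R := hxU k trivial
      rw [norm_mul]
      calc ‖w‖ * ‖x k‖ ≤ (2 * R)⁻¹ * R := by gcongr
        _ = 1 / 2 := by field_simp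
    have a1 := (hnear k (-1) (z * x k) n1 (hsm z hz)).2
    have a2 := (hnear k (-1) (ζ₀ * x k) n1 (hsm ζ₀ hζ₀n.le)).1
    rw [← sub_eq_add_neg] at a1 a2
    have hCU : 0 ≤ CU := le_trans (by positivity) a1
    have a3 : ‖z‖ ^ twoInd L i k ≤ ‖ζ₀‖ ^ twoInd L i k :=
      Real.rpow_le_rpow (norm_nonneg _) (hz.trans hζ₀n.ge) (twoInd_nonneg k)
    have a4 : ‖z * x k - 1‖ ^ twoExp L i (s 2) k ≤ CU / cL * ‖ζ₀ * x k - 1‖ ^ twoExp L i (s 2) k := by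
      calc _ ≤ CU / cL * cL := by rw [div_mul_cancel₀ _ hcL.ne']; exact a1
        _ ≤ _ := by gcongr
    calc _ ≤ ‖x k‖ ^ zeroExp L i s k * (CU / cL * ‖ζ₀ * x k - 1‖ ^ twoExp L i (s 2) k * ‖ζ₀‖ ^ twoInd L i k) *
          ‖x k - 1‖ ^ threeExp L i t k := by gcongr
      _ = _ := by ring

theorem tendsto_mul_sub_one (w : ℂ) : Tendsto (fun ζ : ℂ => ζ * w - 1) (𝓝[≠] 0) (𝓝 (-1)) := by
  have : Tendsto (fun ζ : ℂ => ζ * w - 1) (𝓝 0) (𝓝 (0 * w - 1)) :=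
    ((continuous_id.mul continuous_const).sub continuous_const).tendsto 0
  rw [zero_mul, zero_sub] at this
  exact this.mono_left nhdsWithin_le_nhds

/-- Without the index `2`, the parameter `ζ` enters only through the factors `|ζ * x k - 1|^{2
s_{2k}}`, each of which tends to `1`. -/
theorem tendsto_scaledKernel_of_ne_two (hL : 4 ≤ L)
    (h2 : ∀ k ∈ Finset.Icc 4 L, i k ≠ 2) (x : Finset.Icc 4 L → ℂ) :
    Tendsto (fun ζ => scaledKernel L i s t ζ x) (𝓝[≠] 0)
      (𝓝 (selbergKernel L i s 0 t (fun k => if k = 3 then 1 else 0) x)) := by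
  have key : ∀ ζ : ℂ, ζ ≠ 0 → scaledKernel L i s t ζ x =
      (∏ k : Finset.Icc 4 L, absPow (ζ * x k - 1) (s 2 k)) *
        selbergKernel L i s 0 t (fun k => if k = 3 then 1 else 0) x := by
    intro ζ hζ
    have hp : ∀ k, k ≠ 2 → points 4 L (scaledBase ζ) x k = points 4 L (fun k => if k = 3 then 1 else 0) x k := by
      intro k hk
      simp [points, scaledBase, hk]
    have hk4 : ∀ k ∈ Finset.Icc 4 L, k ≠ 2 ∧ k - 1 ≠ 2 := by
      intro k hk; rw [Finset.mem_Icc] at hk; omega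
    have hprod : ∏ a ∈ Finset.Icc 4 L, ∏ b ∈ Finset.Ioc a L, absPow (points 4 L (scaledBase ζ) x a -
        points 4 L (scaledBase ζ) x b) (s a b) = ∏ a ∈ Finset.Icc 4 L, ∏ b ∈ Finset.Ioc a L,
          absPow (points 4 L (fun k => if k = 3 then 1 else 0) x a -
        points 4 L (fun k => if k = 3 then 1 else 0) x b) (s a b) := by
      refine Finset.prod_congr rfl fun a ha => Finset.prod_congr rfl fun b hb => ?_
      rw [Finset.mem_Icc] at ha
      rw [Finset.mem_Ioc] at hb
      rw [hp a (by omega), hp b (by omega)]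
    rw [scaledKernel, selbergKernel, selbergKernel, hprod, hp L (by omega), absPow_sum hζ,
      Finset.prod_coe_sort_eq_attach]
    rw [← Finset.prod_attach (Finset.Icc 4 L), ← Finset.prod_attach (Finset.Icc 4 L) (fun k => absPow _ _ * absPow _ _ * _ * _),
      ← Finset.prod_attach (Finset.Icc 4 L) (fun k => absPow _ _ * absPow _ ((0 : ℕ → ℂ) k) * _ * _), mul_left_comm]
    rw [← Finset.prod_mul_distrib, mul_left_comm (∏ k ∈ _, _), ← Finset.prod_mul_distrib]
    congr 1
    refine Finset.prod_congr rfl fun k _ => ?_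
    rw [hp k (hk4 k k.2).1, hp (k - 1) (hk4 k k.2).2, hp _ (h2 k k.2), points_of_mem k.2, Subtype.coe_eta,
      scaledBase_two, scaledBase_three, Pi.zero_apply, absPow_zero_right, if_pos rfl,
      show ζ * x k - 1 = ζ * (x k - ζ⁻¹) by rw [mul_sub, mul_inv_cancel₀ hζ], absPow_mul]
    ring
  have hlim : Tendsto (fun ζ : ℂ => (∏ k : Finset.Icc 4 L, absPow (ζ * x k - 1) (s 2 k)) *
        selbergKernel L i s 0 t (fun k => if k = 3 then 1 else 0) x) (𝓝[≠] 0)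
      (𝓝 ((∏ k : Finset.Icc 4 L, absPow (-1) (s 2 k)) *
        selbergKernel L i s 0 t (fun k => if k = 3 then 1 else 0) x)) :=
    Tendsto.mul_const _ (tendsto_finsetProd _ fun k _ => tendsto_absPow (tendsto_mul_sub_one _) (by simp) _)
  have e1 : ∀ k : Finset.Icc 4 L, absPow (-1) (s 2 k) = 1 := fun k => absPow_of_norm_eq_one (by simp) _
  simp only [e1, Finset.prod_const_one, one_mul] at hlim
  refine hlim.congr' ?_
  filter_upwards [self_mem_nhdsWithin] with ζ hζ
  exact (key ζ hζ).symm

/-- The factor `‖ζ‖` left by an index `2` tends to zero while all other factors converge. -/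
theorem tendsto_scaledKernel_of_eq_two (hL : 4 ≤ L) (hi : ∀ k ∈ Finset.Icc 4 L, i k ∈ Finset.Icc 1 L ∧ i k ≠ k)
    (h2 : ∃ k ∈ Finset.Icc 4 L, i k = 2) {x : Finset.Icc 4 L → ℂ} (hx : (∀ a b, a ≠ b → x a ≠ x b) ∧
    (∀ k, x k ≠ 0) ∧ (∀ k, x k ≠ 1)) :
    Tendsto (fun ζ => scaledKernel L i s t ζ x) (𝓝[≠] 0) (𝓝 0) := by
  obtain ⟨k₀, hk₀, hik₀⟩ := h2
  rw [tendsto_zero_iff_norm_tendsto_zero]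
  have hnorm : Tendsto (fun ζ : ℂ => ‖ζ‖) (𝓝[≠] 0) (𝓝 0) := by
    have := (continuous_norm (E := ℂ)).tendsto 0
    rw [norm_zero] at this
    exact this.mono_left nhdsWithin_le_nhds
  have hlim := tendsto_coll (l := 𝓝[≠] (0 : ℂ)) (e := pairExp L i s) (u := x)
    (g := fun ζ k z => ‖z‖ ^ zeroExp L i s k *
      (‖ζ * z - 1‖ ^ twoExp L i (s 2) k * ‖ζ‖ ^ twoInd L i k) * ‖z - 1‖ ^ threeExp L i t k)
    (h := fun k z => ‖z‖ ^ zeroExp L i s k *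
      (‖(-1 : ℂ)‖ ^ twoExp L i (s 2) k * 0 ^ twoInd L i k) * ‖z - 1‖ ^ threeExp L i t k)
    (fun k => Tendsto.mul_const _ (Tendsto.const_mul _ (Tendsto.mul
      ((tendsto_mul_sub_one _).norm.rpow_const (Or.inl (by simp))) (hnorm.rpow_const (Or.inr (twoInd_nonneg k))))))
  have h0 : coll (pairExp L i s) (fun k z => ‖z‖ ^ zeroExp L i s k *
      (‖(-1 : ℂ)‖ ^ twoExp L i (s 2) k * 0 ^ twoInd L i k) * ‖z - 1‖ ^ threeExp L i t k) x = 0 := by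
    refine mul_eq_zero_of_right _ (Finset.prod_eq_zero (Finset.mem_univ (⟨k₀, hk₀⟩ : Finset.Icc 4 L)) ?_)
    simp [twoInd, hik₀]
  rw [h0] at hlim
  refine hlim.congr' ?_
  have hev : ∀ᶠ ζ in 𝓝[≠] (0 : ℂ), ∀ k, ζ * x k - 1 ≠ 0 :=
    eventually_all.2 fun k => (tendsto_mul_sub_one (x k)).eventually_ne (by simp)
  filter_upwards [self_mem_nhdsWithin, hev] with ζ hζ hev
  refine (norm_scaledKernel hL hi hζ ⟨hx.1, hx.2.1, fun k hk => hev k ?_, hx.2.2⟩).symm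
  rw [hk, mul_inv_cancel₀ hζ, sub_self]

end

/-! ### The outer limit `s_{3•} → 0`. -/

section
variable {L : ℕ} {i : ℕ → ℕ} {s : ℕ → ℕ → ℂ} {t : ℕ → ℂ}

theorem tendsto_physicalFilter_apply (k : ℕ) : Tendsto (fun t : ℕ → ℂ => t k) (physicalFilter L) (𝓝 0) :=
  ((continuous_apply k).tendsto (0 : ℕ → ℂ)).mono_left nhdsWithin_le_nhds

theorem eventually_physicalFilter_pos : ∀ᶠ t in physicalFilter L, ∀ j ∈ Finset.Icc 1 L, j ≠ 3 → 0 < (t j).re :=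
  self_mem_nhdsWithin

theorem tendsto_update_physicalFilter {g : ℂ → ℂ} (hg : Continuous g) (h0 : g 0 = 0)
    (hpos : ∀ z, 0 < z.re → 0 < (g z).re) (k : ℕ) :
    Tendsto (fun t : ℕ → ℂ => Function.update t k (g (t k))) (physicalFilter L) (physicalFilter L) := by
  refine tendsto_nhdsWithin_iff.2 ⟨?_, ?_⟩
  · have hc : Continuous fun t : ℕ → ℂ => Function.update t k (g (t k)) :=
      continuous_id.update k (hg.comp (continuous_apply k))
    have := hc.tendsto 0
    have e : Function.update (0 : ℕ → ℂ) k (g ((0 : ℕ → ℂ) k)) = 0 := by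
      rw [Pi.zero_apply, h0]; exact Function.update_eq_self k 0
    rw [e] at this
    exact this.mono_left nhdsWithin_le_nhds
  · filter_upwards [eventually_physicalFilter_pos] with t ht j hj hj3
    by_cases h : j = k
    · subst h; rw [Function.update_self]; exact hpos _ (ht j hj hj3)
    · rw [Function.update_of_ne h]; exact ht j hj hj3

theorem tendsto_const_physicalFilter :
    Tendsto (fun τ : ℝ => fun _ : ℕ => (τ : ℂ)) (𝓝[>] 0) (physicalFilter L) := by
  refine tendsto_nhdsWithin_iff.2 ⟨?_, ?_⟩
  · have hc : Continuous fun τ : ℝ => fun _ : ℕ => (τ : ℂ) := continuous_pi fun _ => continuous_ofReal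
    have := hc.tendsto 0
    have e : (fun _ : ℕ => ((0 : ℝ) : ℂ)) = 0 := by ext; simp
    rw [e] at this
    exact this.mono_left nhdsWithin_le_nhds
  · filter_upwards [self_mem_nhdsWithin] with τ hτ j _ _
    simpa using hτ

/-- Admissible exponents that stay admissible when one of them is halved or doubled. -/
def StablyAdmissible (L : ℕ) (i : ℕ → ℕ) (s : ℕ → ℕ → ℂ) (t : ℕ → ℂ) : Prop :=
  AdmissibleThree L i s t ∧ (∀ k ∈ Finset.Icc 4 L, AdmissibleThree L i s (Function.update t k (t k / 2))) ∧
    ∀ k ∈ Finset.Icc 4 L, AdmissibleThree L i s (Function.update t k (2 * t k))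

theorem eventually_stablyAdmissible (hconv : ∀ᶠ t in physicalFilter L, ∀ z₃ : ℂ, z₃ ≠ 0 → z₃ ≠ 1 →
      Integrable (selbergIntegrand L i (withThree s t) z₃)) :
    ∀ᶠ t in physicalFilter L, StablyAdmissible L i s t := by
  have h : ∀ᶠ t in physicalFilter L, AdmissibleThree L i s t := eventually_physicalFilter_pos.and hconv
  refine h.and (((Finset.eventually_all _).2 fun k _ => ?_).and ((Finset.eventually_all _).2 fun k _ => ?_))
  · exact (tendsto_update_physicalFilter (g := fun z => z / 2) (by fun_prop) (by simp) (fun z hz => by simpa using hz) k).eventually h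
  · exact (tendsto_update_physicalFilter (g := fun z => 2 * z) (by fun_prop) (by simp) (fun z hz => by simpa using hz) k).eventually h

theorem lintegral_coll_sub_one (P : Finset.Icc 4 L → ℝ) :
    ∫⁻ x, ENNReal.ofReal (coll (pairExp L i s) (fun k z => ‖z‖ ^ zeroExp L i s k * ‖z - 1‖ ^ P k) x) =
      ∫⁻ u, ENNReal.ofReal (coll (pairExp L i s) (fun k z => ‖z‖ ^ P k * ‖z + 1‖ ^ zeroExp L i s k) u) := by
  rw [lintegral_coll_translate _ _ 1]
  simp only [add_sub_cancel_right, mul_comm]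

/-- Dominated convergence from two inputs: integrability at one constant exponent `τ`, and positive
cluster degrees already at exponent `0`. The first controls infinity and the points other than `1`,
the second controls the point `1`. -/
theorem tendsto_integral_physicalFilter
    (hi : ∀ k ∈ Finset.Icc 4 L, i k ∈ Finset.Icc 1 L ∧ i k ≠ k)
    {F : (ℕ → ℂ) → (Finset.Icc 4 L → ℂ) → ℂ} (hm : ∀ t, Measurable (F t)) {P : Finset.Icc 4 L → ℝ}
    (hnorm : ∀ t, ∀ᵐ x, ‖F t x‖ = coll (pairExp L i s)
      (fun k z => ‖z‖ ^ zeroExp L i s k * ‖z - 1‖ ^ (P k + 2 * (t k).re)) x)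
    (hdeg : ∀ K : Finset (Finset.Icc 4 L), K.Nonempty → 0 < clusterDeg (pairExp L i s) P K)
    (hlim : ∀ᵐ x, Tendsto (fun t => F t x) (physicalFilter L) (𝓝 (F 0 x)))
    {τ : ℝ} (hτ : 0 < τ) (hint : Integrable (F fun _ => τ)) :
    Integrable (F 0) ∧ Tendsto (fun t => ∫ x, F t x) (physicalFilter L) (𝓝 (∫ x, F 0 x)) := by
  have h1 : ∫⁻ u, ENNReal.ofReal (coll (pairExp L i s)
      (fun k z => ‖z‖ ^ (P k + 2 * τ) * ‖z + 1‖ ^ zeroExp L i s k) u) ≠ ⊤ := by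
    rw [← lintegral_coll_sub_one fun k => P k + 2 * τ]
    have := hint.2.ne
    rw [lintegral_congr_ae (g := fun x => ENNReal.ofReal (coll (pairExp L i s)
      (fun k z => ‖z‖ ^ zeroExp L i s k * ‖z - 1‖ ^ (P k + 2 * τ)) x))] at this
    · exact this
    · filter_upwards [hnorm fun _ => τ] with x hx
      rw [← ofReal_norm, hx]
      simp
  have h2 := coll_lower_exponents (pairExp_self hi) (by positivity : (0 : ℝ) ≤ 2 * τ) hdeg h1
  -- For `0 ≤ (t k).re ≤ τ` the factor `‖z - 1‖ ^ (2 * (t k).re)` is at most `(1 + ‖z - 1‖) ^ (2 *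
  -- τ)`. One function thus dominates all exponents, and its integrability is the content of
  -- `coll_lower_exponents`.
  set D : (Finset.Icc 4 L → ℂ) → ℝ := coll (pairExp L i s)
    (fun k z => ‖z - 1‖ ^ P k * (‖z‖ ^ zeroExp L i s k * (1 + ‖z - 1‖) ^ (2 * τ))) with hD
  have hDm : Measurable D := measurable_coll fun k => by fun_prop
  have hD0 : ∀ x, 0 ≤ D x := fun x => coll_nonneg (fun k z => by positivity) x
  have hDint : Integrable D := by
    refine ⟨hDm.aestronglyMeasurable, ?_⟩
    have : ∫⁻ x, ‖D x‖ₑ = ∫⁻ x, ENNReal.ofReal (D x) :=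
      lintegral_congr fun x => by rw [Real.enorm_of_nonneg (hD0 x)]
    rw [HasFiniteIntegral, this, hD, lintegral_coll_translate _ _ 1]
    simpa only [add_sub_cancel_right] using h2.lt_top
  have hbound : ∀ t : ℕ → ℂ, (∀ k ∈ Finset.Icc 4 L, 0 ≤ (t k).re ∧ (t k).re ≤ τ) → ∀ᵐ x, ‖F t x‖ ≤ D x := by
    intro t ht
    filter_upwards [hnorm t, ae_generic (L := L) 1 1] with x hx hgen
    rw [hx, hD]
    refine coll_mono (fun k z => by positivity) x fun k => ?_
    have n1 : 0 < ‖x k - 1‖ := norm_pos_iff.2 (sub_ne_zero.2 (hgen.2.2.2 k))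
    have a1 : ‖x k - 1‖ ^ (2 * (t k).re) ≤ (1 + ‖x k - 1‖) ^ (2 * τ) := by
      calc _ ≤ (1 + ‖x k - 1‖) ^ (2 * (t k).re) :=
            Real.rpow_le_rpow n1.le (by linarith) (by have := (ht k k.2).1; linarith)
        _ ≤ _ := Real.rpow_le_rpow_of_exponent_le (by linarith) (by have := (ht k k.2).2; linarith)
    rw [Real.rpow_add n1]
    calc _ = ‖x k - 1‖ ^ P k * (‖x k‖ ^ zeroExp L i s k * ‖x k - 1‖ ^ (2 * (t k).re)) := by ring
      _ ≤ _ := by gcongr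
  refine ⟨hDint.mono' (hm 0).aestronglyMeasurable (hbound 0 fun k _ => by simp [hτ.le]), ?_⟩
  have hev : ∀ᶠ t in physicalFilter L, ∀ k ∈ Finset.Icc 4 L, (t k).re ≤ τ :=
    (Finset.eventually_all _).2 fun k _ =>
      ((continuous_re.tendsto 0).comp (tendsto_physicalFilter_apply k)).eventually (ge_mem_nhds (by simpa using hτ))
  have : (physicalFilter L).IsCountablyGenerated := by unfold physicalFilter; infer_instance
  refine tendsto_integral_filter_of_dominated_convergence D (Eventually.of_forall fun t => (hm t).aestronglyMeasurable)
    ?_ hDint hlim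
  filter_upwards [hev, eventually_physicalFilter_pos] with t h3 h4
  refine hbound t fun k hk => ⟨(h4 k ?_ ?_).le, h3 k hk⟩
  · rw [Finset.mem_Icc] at hk ⊢; omega
  · rw [Finset.mem_Icc] at hk; omega

theorem exists_stablyAdmissible_const (hconv : ∀ᶠ t in physicalFilter L, ∀ z₃ : ℂ, z₃ ≠ 0 → z₃ ≠ 1 →
      Integrable (selbergIntegrand L i (withThree s t) z₃)) :
    ∃ τ : ℝ, 0 < τ ∧ StablyAdmissible L i s fun _ => τ := by
  obtain ⟨τ, h1, h2⟩ := ((tendsto_const_physicalFilter.eventually (eventually_stablyAdmissible hconv)).and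
    self_mem_nhdsWithin).exists
  exact ⟨τ, h2, h1⟩

theorem threeExp_eq_add (σ₃ : ℕ → ℂ) (k : Finset.Icc 4 L) : threeExp L i σ₃ k = threeExp L i 0 k + 2 * (σ₃ k).re := by
  simp [threeExp]; ring

theorem outer_limit_one (hL : 4 ≤ L) (hi : ∀ k ∈ Finset.Icc 4 L, i k ∈ Finset.Icc 1 L ∧ i k ≠ k)
    (hs : ∀ a b : ℕ, 4 ≤ a → a < b → b ≤ L → 0 < (s a b).re) (hs2 : ∀ k ∈ Finset.Icc 4 L, 0 < (s 2 k).re)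
    (hconv : ∀ᶠ t in physicalFilter L, ∀ z₃ : ℂ, z₃ ≠ 0 → z₃ ≠ 1 →
      Integrable (selbergIntegrand L i (withThree s t) z₃)) :
    Integrable (selbergKernel L i s (s 2) 0 (selbergBase 1)) ∧
      Tendsto (fun t => ∫ x, selbergKernel L i s (s 2) t (selbergBase 1) x) (physicalFilter L)
        (𝓝 (∫ x, selbergKernel L i s (s 2) 0 (selbergBase 1) x)) := by
  obtain ⟨τ, hτ, hadm⟩ := exists_stablyAdmissible_const hconv
  have hgen : ∀ᵐ x : Finset.Icc 4 L → ℂ, (∀ a b, a ≠ b → x a ≠ x b) ∧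
      (∀ k, x k ≠ 0) ∧ (∀ k, x k ≠ selbergBase 1 2) ∧ ∀ k, x k ≠ selbergBase 1 3 := ae_generic _ _
  refine tendsto_integral_physicalFilter (F := fun t => selbergKernel L i s (s 2) t (selbergBase 1)) hi
    (fun t => measurable_selbergKernel _) (P := fun k => twoExp L i (s 2) k + threeExp L i 0 k) (fun t => ?_)
    (fun K hK => clusterDeg_one_pos hs hs2 (fun k _ => by simp) hK) ?_ hτ
    (hadm.1.tendsto_kernel_one hL hi hs hs2 hadm.2.1).1
  · filter_upwards [hgen] with x hx
    rw [norm_selbergKernel hL hi (selbergBase_one 1) hx.1 hx.2.1 hx.2.2.1 hx.2.2.2]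
    simp only [coll]
    congr 1
    refine Finset.prod_congr rfl fun k _ => ?_
    rw [selbergBase_two] at hx ⊢
    rw [selbergBase_three, threeExp_eq_add, mul_assoc, ← Real.rpow_add (norm_pos_iff.2 (sub_ne_zero.2 (hx.2.2.1 k))),
      add_assoc]
  · filter_upwards [hgen] with x hx
    exact tendsto_selbergKernel (P := fun _ => selbergBase 1) (S := fun t => t) hi hL (fun k => tendsto_const_nhds)
      (fun k _ => tendsto_physicalFilter_apply k) (selbergBase_one 1) hx

theorem ae_norm_kernel_zero (hL : 4 ≤ L) (hi : ∀ k ∈ Finset.Icc 4 L, i k ∈ Finset.Icc 1 L ∧ i k ≠ k)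
    (h2 : ∀ k ∈ Finset.Icc 4 L, i k ≠ 2) (t : ℕ → ℂ) :
    ∀ᵐ x, ‖selbergKernel L i s 0 t (fun k => if k = 3 then 1 else 0) x‖ = coll (pairExp L i s)
      (fun k z => ‖z‖ ^ zeroExp L i s k * ‖z - 1‖ ^ (threeExp L i 0 k + 2 * (t k).re)) x := by
  filter_upwards [ae_generic (L := L) 0 1] with x hx
  rw [norm_selbergKernel hL hi (by simp) hx.1 hx.2.1 (by simpa using hx.2.2.1) (by simpa using hx.2.2.2)]
  simp only [coll]
  congr 1
  refine Finset.prod_congr rfl fun k _ => ?_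
  rw [← threeExp_eq_add, twoExp, if_neg (h2 k k.2)]
  simp

theorem outer_limit_zero (hL : 4 ≤ L) (hi : ∀ k ∈ Finset.Icc 4 L, i k ∈ Finset.Icc 1 L ∧ i k ≠ k)
    (hs : ∀ a b : ℕ, 4 ≤ a → a < b → b ≤ L → 0 < (s a b).re) (hs2 : ∀ k ∈ Finset.Icc 4 L, 0 < (s 2 k).re)
    (hconv : ∀ᶠ t in physicalFilter L, ∀ z₃ : ℂ, z₃ ≠ 0 → z₃ ≠ 1 →
      Integrable (selbergIntegrand L i (withThree s t) z₃))
    (h2 : ∀ k ∈ Finset.Icc 4 L, i k ≠ 2) (h4 : i 4 ≠ 3) :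
    Integrable (selbergKernel L i s 0 0 (fun k => if k = 3 then 1 else 0)) ∧
      Tendsto (fun t => ∫ x, selbergKernel L i s 0 t (fun k => if k = 3 then 1 else 0) x) (physicalFilter L)
        (𝓝 (∫ x, selbergKernel L i s 0 0 (fun k => if k = 3 then 1 else 0) x)) := by
  obtain ⟨τ, hτ, hadm⟩ := exists_stablyAdmissible_const hconv
  refine tendsto_integral_physicalFilter (F := fun t => selbergKernel L i s 0 t (fun k => if k = 3 then 1 else 0)) hi
    (fun t => measurable_selbergKernel _) (P := threeExp L i 0) (ae_norm_kernel_zero hL hi h2)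
    (fun K hK => clusterDeg_three_pos hi hs (fun k _ => by simp) h4 hK) ?_ hτ
    (hadm.1.tendsto_scaledKernel hL hi hs2 hadm.2.2 (measurable_selbergKernel _)
      (Eventually.of_forall fun x => tendsto_scaledKernel_of_ne_two hL h2 x)).1
  filter_upwards [ae_generic (L := L) 0 1] with x hx
  exact tendsto_selbergKernel (P := fun _ k => if k = 3 then 1 else 0) (S := fun t => t) hi hL
    (fun k => tendsto_const_nhds) (fun k _ => tendsto_physicalFilter_apply k) (by simp) (by simpa using hx)

/-- The cluster consisting of `w_4` alone has degree `2 - 1 - 1 = 0` at the point `1`, since both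
its holomorphic and its antiholomorphic pole lie there. -/
theorem not_integrable_kernel_zero (hL : 4 ≤ L) (hi : ∀ k ∈ Finset.Icc 4 L, i k ∈ Finset.Icc 1 L ∧ i k ≠ k)
    (h2 : ∀ k ∈ Finset.Icc 4 L, i k ≠ 2) (h4 : i 4 = 3) :
    ¬ Integrable (selbergKernel L i s 0 0 (fun k => if k = 3 then 1 else 0)) := by
  intro hint
  obtain ⟨cL, CU, hcL, hnear⟩ := exists_norm_add_rpow_bounds (zeroExp L i s)
  have hfin := hint.2.ne
  rw [lintegral_congr_ae (g := fun x => ENNReal.ofReal (coll (pairExp L i s)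
      (fun k z => ‖z‖ ^ zeroExp L i s k * ‖z - 1‖ ^ threeExp L i 0 k) x)), lintegral_coll_sub_one] at hfin
  · have hmem : 4 ∈ Finset.Icc 4 L := Finset.mem_Icc.2 ⟨le_rfl, hL⟩
    have h := clusterDeg_pos_of_integrable (W := fun k z => ‖z + 1‖ ^ zeroExp L i s k) (pairExp_self hi)
      (fun k z => by positivity) (fun k => by fun_prop) (fun k => by
        filter_upwards [ae_ne (-1)] with z hz
        have : 0 < ‖z + 1‖ := norm_pos_iff.2 fun h => hz (by linear_combination h)
        positivity) (δ := 1 / 2) (by norm_num) hcL (fun k z hz => (hnear k 1 z norm_one hz).1) hfin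
      (Finset.singleton_nonempty (⟨4, hmem⟩ : Finset.Icc 4 L))
    rw [clusterDeg_eq_sum, Finset.sum_singleton, Finset.sum_singleton, pairExp_self hi] at h
    simp [threeExp, h4] at h
    norm_num at h
  · filter_upwards [ae_norm_kernel_zero hL hi h2 0] with x hx
    rw [← ofReal_norm, hx]
    simp

end

/-! ### The integral over the overall scale and the reduction by one variable. -/

/-- The function is the conjugate of `1 / (z - 1)`, holomorphic on the disc, so its mean is the
conjugate of the value at the centre. -/
theorem circleAverage_one_div_conj_of_lt_one {r : ℝ} (h0 : 0 < r) (h1 : r < 1) :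
    Real.circleAverage (fun z => 1 / conj (z - 1)) 0 r = -1 := by
  have hne : ∀ z ∈ Metric.closedBall (0 : ℂ) |r|, z - 1 ≠ 0 := by
    intro z hz h
    rw [mem_closedBall_zero_iff, abs_of_pos h0, sub_eq_zero.1 h, norm_one] at hz
    linarith
  have hd : DiffContOnCl ℂ (fun z : ℂ => 1 / (z - 1)) (Metric.ball 0 |r|) := by
    refine DifferentiableOn.diffContOnCl_ball (U := Metric.closedBall 0 |r|) ?_ subset_rfl
    intro z hz
    have := hne z hz
    exact DifferentiableAt.differentiableWithinAt (by fun_prop (disch := assumption))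
  have h := hd.circleAverage
  rw [Real.circleAverage_def, intervalIntegral.integral_of_le (by positivity)] at h ⊢
  have e : (fun θ : ℝ => 1 / conj (circleMap 0 r θ - 1)) = fun θ => conj (1 / (circleMap 0 r θ - 1)) := by
    ext θ; simp
  rw [e, integral_conj]
  have := congrArg conj h
  simpa [Complex.conj_ofNat] using this

/-- On the circle `conj z = r ^ 2 / z`, so the function agrees there with `z / (r ^ 2 - z)`. For `r
> 1` this is holomorphic on the closed disc and vanishes at the centre. -/
theorem circleAverage_one_div_conj_of_one_lt {r : ℝ} (h1 : 1 < r) :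
    Real.circleAverage (fun z => 1 / conj (z - 1)) 0 r = 0 := by
  have h0 : 0 < r := by linarith
  have hne : ∀ z ∈ Metric.closedBall (0 : ℂ) |r|, (r : ℂ) ^ 2 - z ≠ 0 := by
    intro z hz h
    rw [mem_closedBall_zero_iff, abs_of_pos h0, ← sub_eq_zero.1 h, norm_pow, Complex.norm_real,
      Real.norm_of_nonneg h0.le] at hz
    nlinarith
  have hd : DiffContOnCl ℂ (fun z : ℂ => z / ((r : ℂ) ^ 2 - z)) (Metric.ball 0 |r|) := by
    refine DifferentiableOn.diffContOnCl_ball (U := Metric.closedBall 0 |r|) ?_ subset_rfl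
    intro z hz
    have := hne z hz
    exact DifferentiableAt.differentiableWithinAt (by fun_prop (disch := assumption))
  have h : Real.circleAverage (fun z : ℂ => z / ((r : ℂ) ^ 2 - z)) 0 r = 0 :=
    (DiffContOnCl.circleAverage hd).trans (zero_div _)
  refine Eq.trans ?_ h
  apply Real.circleAverage_congr_sphere
  intro z hz
  have hn : ‖z‖ = r := by simpa [abs_of_pos h0] using hz
  have hz0 : z ≠ 0 := by rw [← norm_pos_iff, hn]; exact h0
  have hz1 : conj z - 1 ≠ 0 := by
    intro h
    have h2 := norm_conj z
    rw [sub_eq_zero.1 h, norm_one, hn] at h2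
    linarith
  have hz2 := hne z (by rw [mem_closedBall_zero_iff, abs_of_pos h0, hn])
  have h3 : z * conj z = (r : ℂ) ^ 2 := by
    rw [mul_conj, normSq_eq_norm_sq, hn]; push_cast; rfl
  change 1 / conj (z - 1) = z / ((r : ℂ) ^ 2 - z)
  rw [map_sub, map_one, div_eq_div_iff hz1 hz2, ← h3]
  ring

theorem integral_polar_one_div_conj (r : ℝ) :
    ∫ θ in Set.Ioo (-Real.pi) Real.pi, 1 / conj (Complex.polarCoord.symm (r, θ) - 1) =
      2 * Real.pi * Real.circleAverage (fun z => 1 / conj (z - 1)) 0 r := by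
  have e (θ : ℝ) : Complex.polarCoord.symm (r, θ) = circleMap 0 r θ := by
    rw [Complex.polarCoord_symm_apply, circleMap, zero_add, exp_mul_I, ofReal_cos, ofReal_sin]
  have hp : Function.Periodic (fun θ : ℝ => 1 / conj (circleMap 0 r θ - 1)) (2 * Real.pi) := fun θ => by
    simp only [periodic_circleMap 0 r θ]
  have h := hp.intervalIntegral_add_eq (-Real.pi) 0
  rw [zero_add, show -Real.pi + 2 * Real.pi = Real.pi by ring] at h
  simp only [e]
  rw [← integral_Ioc_eq_integral_Ioo, ← intervalIntegral.integral_of_le (by linarith [Real.pi_pos]), h,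
    Real.circleAverage_def, real_smul]
  push_cast
  have : (Real.pi : ℂ) ≠ 0 := by exact_mod_cast Real.pi_ne_zero
  field_simp

/-- The integrand of the overall scale in the limit `z₃ → 0`. -/
noncomputable def scaleFactor (S c : ℂ) : ℂ := absPow c S * (1 / (c * conj c)) / conj (c - 1)

theorem measurable_scaleFactor (S : ℂ) : Measurable (scaleFactor S) := by
  have hc : Measurable fun z : ℂ => conj z := continuous_conj.measurable
  unfold scaleFactor
  exact ((measurable_absPow S).mul (measurable_const.div (measurable_id.mul hc))).div
    (hc.comp (measurable_id.sub measurable_const))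

/-- In polar coordinates the modulus part is `r ^ (2 * S - 1)` and the angular integral is `-2π` for
`r < 1` and `0` for `r > 1`. What remains is the integral of `-2π * r ^ (2 * S - 1)` over `(0, 1]`;
the circle `r = 1` is null. -/
theorem integral_scaleFactor {S : ℂ} (hS : 0 < S.re) (hint : Integrable (scaleFactor S)) :
    ∫ c, scaleFactor S c = -Real.pi / S := by
  -- Joint integrability justifies performing the angular integral, with its cancellation, first.
  have hint2 : IntegrableOn (fun p : ℝ × ℝ => p.1 • scaleFactor S (Complex.polarCoord.symm p)) polarCoord.target := by
    refine ⟨?_, ?_⟩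
    · refine Measurable.aestronglyMeasurable ?_
      refine measurable_fst.smul ((measurable_scaleFactor S).comp ?_)
      have : (Complex.polarCoord.symm : ℝ × ℝ → ℂ) =
        fun p => p.1 * (Real.cos p.2 + Real.sin p.2 * Complex.I) := by ext p; simp
      rw [this]
      fun_prop
    · have h := Complex.lintegral_comp_polarCoord_symm fun c => ‖scaleFactor S c‖ₑ
      rw [HasFiniteIntegral]
      refine lt_of_eq_of_lt ?_ hint.2
      rw [← h]
      refine setLIntegral_congr_fun polarCoord.open_target.measurableSet fun p hp => ?_
      rw [enorm_smul, smul_eq_mul, Real.enorm_of_nonneg (le_of_lt hp.1)]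
  have hr : ∀ r : ℝ, 0 < r → ∀ θ : ℝ, r • scaleFactor S (Complex.polarCoord.symm (r, θ)) =
      (r : ℂ) ^ (2 * S - 1) * (1 / conj (Complex.polarCoord.symm (r, θ) - 1)) := by
    intro r hr θ
    have hn : ‖Complex.polarCoord.symm (r, θ)‖ = r := by
      rw [Complex.norm_polarCoord_symm, abs_of_pos hr]
    have hr0 : (r : ℂ) ≠ 0 := by exact_mod_cast hr.ne'
    rw [scaleFactor, absPow, hn, mul_conj, normSq_eq_norm_sq, hn, real_smul, cpow_sub _ _ hr0, cpow_one]
    push_cast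
    field_simp
  rw [← Complex.integral_comp_polarCoord_symm]
  change ∫ p in Set.Ioi (0 : ℝ) ×ˢ Set.Ioo (-Real.pi) Real.pi, _ = _
  rw [Measure.volume_eq_prod, setIntegral_prod _ hint2]
  have h2 : ∀ r ∈ Set.Ioi (0 : ℝ), r ≠ 1 → ∫ θ in Set.Ioo (-Real.pi) Real.pi,
      r • scaleFactor S (Complex.polarCoord.symm (r, θ)) =
      (Set.Ioc (0 : ℝ) 1).indicator (fun r : ℝ => (r : ℂ) ^ (2 * S - 1) * (-2 * Real.pi)) r := by
    intro r h0 h1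
    rw [Set.mem_Ioi] at h0
    simp only [hr r h0]
    rw [integral_const_mul, integral_polar_one_div_conj]
    rcases lt_or_gt_of_ne h1 with h | h
    · rw [circleAverage_one_div_conj_of_lt_one h0 h, Set.indicator_of_mem (Set.mem_Ioc.2 ⟨h0, h.le⟩)]
      ring
    · rw [circleAverage_one_div_conj_of_one_lt h, Set.indicator_of_notMem (fun hm => by
        have := (Set.mem_Ioc.1 hm).2; linarith)]
      ring
  have h3 : ∀ᵐ r : ℝ, r ∈ Set.Ioi (0 : ℝ) → ∫ θ in Set.Ioo (-Real.pi) Real.pi,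
      r • scaleFactor S (Complex.polarCoord.symm (r, θ)) =
      (Set.Ioc (0 : ℝ) 1).indicator (fun r : ℝ => (r : ℂ) ^ (2 * S - 1) * (-2 * Real.pi)) r := by
    have : ∀ᵐ r : ℝ, r ≠ 1 := by simp [ae_iff]
    filter_upwards [this] with r h1 h0 using h2 r h0 h1
  rw [setIntegral_congr_ae measurableSet_Ioi h3, setIntegral_indicator measurableSet_Ioc,
    Set.inter_eq_right.2 fun r hr => hr.1, ← intervalIntegral.integral_of_le zero_le_one,
    intervalIntegral.integral_mul_const, integral_cpow (Or.inl (by simp; linarith))]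
  have hS0 : S ≠ 0 := by rintro rfl; simp at hS
  rw [sub_add_cancel, ofReal_one, one_cpow, ofReal_zero, zero_cpow (by simpa using hS0)]
  field_simp
  ring

theorem mem_Icc_four {L k : ℕ} (h : k ∈ Finset.Icc 5 L) : k ∈ Finset.Icc 4 L := by
  rw [Finset.mem_Icc] at h ⊢; omega

theorem Icc_four_eq_insert {L : ℕ} (hL : 4 ≤ L) : Finset.Icc 4 L = insert 4 (Finset.Icc 5 L) := by
  ext a; simp only [Finset.mem_insert, Finset.mem_Icc]; omega

theorem prod_Icc_four_univ {M : Type} [CommMonoid M] {L : ℕ} (hL : 4 ≤ L) (f : Finset.Icc 4 L → M) :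
    ∏ k, f k = f ⟨4, Finset.mem_Icc.2 ⟨le_rfl, hL⟩⟩ * ∏ k : Finset.Icc 5 L, f ⟨k, mem_Icc_four k.2⟩ := by
  set g : ℕ → M := fun k => if h : k ∈ Finset.Icc 4 L then f ⟨k, h⟩ else 1
  have h1 : ∏ k, f k = ∏ k : Finset.Icc 4 L, g k :=
    Finset.prod_congr rfl fun k _ => by simp only [g, dif_pos k.2, Subtype.coe_eta]
  have h2 : ∏ k : Finset.Icc 5 L, f ⟨k, mem_Icc_four k.2⟩ = ∏ k : Finset.Icc 5 L, g k :=
    Finset.prod_congr rfl fun k _ => by simp only [g, dif_pos (mem_Icc_four k.2)]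
  have h3 : f ⟨4, Finset.mem_Icc.2 ⟨le_rfl, hL⟩⟩ = g 4 := by
    simp only [g, dif_pos (Finset.mem_Icc.2 ⟨le_rfl, hL⟩ : 4 ∈ Finset.Icc 4 L)]
  rw [h1, h2, h3, Finset.prod_coe_sort (Finset.Icc 4 L) g, Finset.prod_coe_sort (Finset.Icc 5 L) g,
    Icc_four_eq_insert hL, Finset.prod_insert (by simp)]

/-- The variables `x_4, …, x_L` as the pair of `x_4` and the others. -/
def consVar {L : ℕ} (hL : 4 ≤ L) : ℂ × (Finset.Icc 5 L → ℂ) ≃ᵐ (Finset.Icc 4 L → ℂ) where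
  toFun q k := if h : k.val = 4 then q.1 else q.2 ⟨k, by
    have := Finset.mem_Icc.1 k.2; rw [Finset.mem_Icc]; omega⟩
  invFun x := (x ⟨4, Finset.mem_Icc.2 ⟨le_rfl, hL⟩⟩, fun k => x ⟨k, mem_Icc_four k.2⟩)
  left_inv q := by
    refine Prod.ext (by simp) (funext fun k => ?_)
    have := (Finset.mem_Icc.1 k.2).1
    exact dif_neg (by change ¬ k.val = 4; omega)
  right_inv x := by
    ext k
    by_cases h : k.val = 4
    · simp only [dif_pos h]
      congr 1
      exact Subtype.ext h.symm
    · simp only [dif_neg h]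
  measurable_toFun := by
    refine measurable_pi_lambda _ fun k => ?_
    simp only [Equiv.coe_fn_mk]
    split_ifs
    · exact measurable_fst
    · exact (measurable_pi_apply _).comp measurable_snd
  measurable_invFun := by
    simp only [Equiv.coe_fn_symm_mk]
    fun_prop

section
variable {L : ℕ} {i : ℕ → ℕ} {s : ℕ → ℕ → ℂ}

theorem consVar_four (hL : 4 ≤ L) (q : ℂ × (Finset.Icc 5 L → ℂ)) (h : 4 ∈ Finset.Icc 4 L) :
    consVar hL q ⟨4, h⟩ = q.1 := by
  simp [consVar]

theorem consVar_of_mem (hL : 4 ≤ L) (q : ℂ × (Finset.Icc 5 L → ℂ)) {k : ℕ} (h : k ∈ Finset.Icc 5 L)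
    (h' : k ∈ Finset.Icc 4 L) : consVar hL q ⟨k, h'⟩ = q.2 ⟨k, h⟩ := by
  have := (Finset.mem_Icc.1 h).1
  exact dif_neg (by change ¬ k = 4; omega)

theorem consVar_smul (hL : 4 ≤ L) (c d : ℂ) (y : Finset.Icc 5 L → ℂ) :
    consVar hL (c * d, c • y) = c • consVar hL (d, y) := by
  ext k
  by_cases h : k.val = 4
  · obtain ⟨k, hk⟩ := k
    subst h
    rw [Pi.smul_apply, consVar_four, consVar_four, smul_eq_mul]
  · obtain ⟨k, hk⟩ := k
    have hk5 : k ∈ Finset.Icc 5 L := by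
      rw [Finset.mem_Icc] at hk ⊢; change ¬ k = 4 at h; omega
    rw [Pi.smul_apply, consVar_of_mem hL _ hk5, consVar_of_mem hL _ hk5]
    rfl

theorem measurePreserving_consVar (hL : 4 ≤ L) : MeasurePreserving (consVar hL) volume volume := by
  refine ⟨(consVar hL).measurable, ?_⟩
  rw [volume_pi]
  refine (Measure.pi_eq fun S hS => ?_).symm
  rw [Measure.map_apply (consVar hL).measurable (MeasurableSet.univ_pi hS)]
  have : (consVar hL) ⁻¹' Set.univ.pi S = S ⟨4, Finset.mem_Icc.2 ⟨le_rfl, hL⟩⟩ ×ˢ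
      Set.univ.pi fun k : Finset.Icc 5 L => S ⟨k, mem_Icc_four k.2⟩ := by
    ext q
    simp only [Set.mem_preimage, Set.mem_univ_pi, Set.mem_prod]
    constructor
    · intro h
      refine ⟨?_, fun k => ?_⟩
      · have := h ⟨4, Finset.mem_Icc.2 ⟨le_rfl, hL⟩⟩
        rwa [consVar_four] at this
      · have := h ⟨k, mem_Icc_four k.2⟩
        rwa [consVar_of_mem hL _ k.2] at this
    · rintro ⟨h1, h2⟩ ⟨k, hk⟩
      by_cases h : k = 4
      · subst h; rwa [consVar_four]
      · have hk5 : k ∈ Finset.Icc 5 L := by rw [Finset.mem_Icc] at hk ⊢; omega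
        rw [consVar_of_mem hL _ hk5]
        exact h2 ⟨k, hk5⟩
  rw [this, Measure.volume_eq_prod, Measure.prod_prod, volume_pi_pi, prod_Icc_four_univ hL]

theorem points_consVar (hL : 4 ≤ L) (y : Finset.Icc 5 L → ℂ) (j : ℕ) :
    points 4 L 0 (consVar hL (1, y)) j = points 5 L (fun k => if k = 4 then 1 else 0) y j := by
  by_cases h5 : j ∈ Finset.Icc 5 L
  · rw [points_of_mem h5, points_of_mem (mem_Icc_four h5), consVar_of_mem hL _ h5]
  · rw [points_of_notMem h5]
    by_cases h4 : j = 4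
    · subst h4
      rw [points_of_mem (Finset.mem_Icc.2 ⟨le_rfl, hL⟩), consVar_four, if_pos rfl]
    · rw [points_of_notMem, if_neg h4, Pi.zero_apply]
      rw [Finset.mem_Icc] at h5 ⊢; omega

/-- With all base points at `0` and the fourth variable at `1`, the chain factor `conj (x_4 - x_3)`
is `1`, and the remaining factor at `k = 4` becomes `1 / (1 - y_{i_4})`. -/
theorem kernel_consVar_one (hL : 4 ≤ L) (y : Finset.Icc 5 L → ℂ) :
    selbergKernel L i s 0 0 0 (consVar hL (1, y)) = zeroLimitReducedIntegrand L i s y := by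
  have e4 : points 5 L (fun k => if k = 4 then (1 : ℂ) else 0) y 4 = 1 := by
    rw [points_of_notMem (by simp)]; simp
  have e3 : points 5 L (fun k => if k = 4 then (1 : ℂ) else 0) y 3 = 0 := by
    rw [points_of_notMem (by simp)]; simp
  have e5 : Finset.Ioc 4 L = Finset.Icc 5 L := (Finset.Icc_add_one_left_eq_Ioc 4 L).symm
  simp only [selbergKernel, points_consVar, zeroLimitReducedIntegrand, Pi.zero_apply, absPow_zero_right, mul_one]
  rw [Icc_four_eq_insert hL, Finset.prod_insert (by simp), Finset.prod_insert (by simp), e4, e5,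
    absPow_of_norm_eq_one norm_one, show 4 - 1 = 3 from rfl, e3]
  simp only [Finset.prod_mul_distrib, sub_zero, map_one, mul_one, one_mul, one_div, mul_inv, map_sub]
  ring

/-- As no `i_k` equals `3`, the third base point occurs only in the chain factor of `x_4`. Moving it
to `0` makes the kernel homogeneous at the cost of one explicit factor in `c = x_4`. -/
theorem kernel_base_eq (hL : 4 ≤ L) (h23 : ∀ k ∈ Finset.Icc 4 L, i k ≠ 2 ∧ i k ≠ 3) {x : Finset.Icc 4 L → ℂ}
    {c : ℂ} (hc : points 4 L 0 x 4 = c) (h0 : c ≠ 0) :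
    selbergKernel L i s 0 0 (fun k => if k = 3 then 1 else 0) x =
      selbergKernel L i s 0 0 0 x * (conj c / conj (c - 1)) := by
  have hp : ∀ j, j ≠ 3 → points 4 L (fun k => if k = 3 then (1 : ℂ) else 0) x j = points 4 L 0 x j := by
    intro j hj
    simp [points, hj]
  have hp3 : points 4 L (fun k => if k = 3 then (1 : ℂ) else 0) x 3 = 1 := by
    rw [points_of_notMem (by simp)]; simp
  have hq3 : points 4 L (0 : ℕ → ℂ) x 3 = 0 := by
    rw [points_of_notMem (by simp)]; simp
  have hpair : ∏ a ∈ Finset.Icc 4 L, ∏ b ∈ Finset.Ioc a L,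
      absPow (points 4 L (fun k => if k = 3 then 1 else 0) x a -
        points 4 L (fun k => if k = 3 then 1 else 0) x b) (s a b) =
      ∏ a ∈ Finset.Icc 4 L, ∏ b ∈ Finset.Ioc a L, absPow (points 4 L 0 x a - points 4 L 0 x b) (s a b) := by
    refine Finset.prod_congr rfl fun a ha => Finset.prod_congr rfl fun b hb => ?_
    rw [Finset.mem_Icc] at ha
    rw [Finset.mem_Ioc] at hb
    rw [hp a (by omega), hp b (by omega)]
  have hc' : conj c ≠ 0 := by simpa using h0
  simp only [selbergKernel, hpair, hp L (by omega), Pi.zero_apply, absPow_zero_right, mul_one]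
  rw [mul_assoc (1 / conj (points 4 L 0 x L) * _)]
  congr 1
  rw [Icc_four_eq_insert hL, Finset.prod_insert (by simp), Finset.prod_insert (by simp)]
  have h5 : ∀ k ∈ Finset.Icc 5 L, absPow (points 4 L (fun k => if k = 3 then 1 else 0) x k) (s 1 k) *
      (1 / ((points 4 L (fun k => if k = 3 then 1 else 0) x k -
        points 4 L (fun k => if k = 3 then 1 else 0) x (i k)) *
        conj (points 4 L (fun k => if k = 3 then 1 else 0) x k -
        points 4 L (fun k => if k = 3 then 1 else 0) x (k - 1)))) =
      absPow (points 4 L 0 x k) (s 1 k) *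
      (1 / ((points 4 L 0 x k - points 4 L 0 x (i k)) * conj (points 4 L 0 x k - points 4 L 0 x (k - 1)))) := by
    intro k hk
    have hk' := Finset.mem_Icc.1 hk
    rw [hp k (by omega), hp (k - 1) (by omega), hp (i k) (h23 k (mem_Icc_four hk)).2]
  rw [Finset.prod_congr rfl h5, hp 4 (by omega), hp (i 4) (h23 4 (Finset.mem_Icc.2 ⟨le_rfl, hL⟩)).2, hc,
    show 4 - 1 = 3 from rfl, hp3, hq3, sub_zero]
  simp only [one_div, mul_inv]
  field_simp

/-- The dilation by `c` scales the homogeneous kernel. The power of `1 / (c * conj c)` beyond the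
one absorbed in `scaleFactor` is the Jacobian of `y ↦ c • y`. -/
theorem kernel_smul_consVar (hL : 4 ≤ L) (h23 : ∀ k ∈ Finset.Icc 4 L, i k ≠ 2 ∧ i k ≠ 3) {c : ℂ} (h0 : c ≠ 0)
    (y : Finset.Icc 5 L → ℂ) :
    selbergKernel L i s 0 0 (fun k => if k = 3 then 1 else 0) (consVar hL (c, c • y)) =
      (1 / (c * conj c)) ^ (Finset.Icc 5 L).card * scaleFactor (sOneFourToL L s) c *
        zeroLimitReducedIntegrand L i s y := by
  have hc' : conj c ≠ 0 := by simpa using h0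
  have h1 : consVar hL (c, c • y) = c • consVar hL (1, y) := by rw [← consVar_smul, mul_one]
  have h2 : points 4 L 0 (consVar hL (c, c • y)) 4 = c := by
    rw [points_of_mem (Finset.mem_Icc.2 ⟨le_rfl, hL⟩), consVar_four]
  have h3 := selbergKernel_smul (L := L) (i := i) (s := s) (σ₂ := 0) (σ₃ := 0) h0 0 (consVar hL (1, y))
  have h4 : (Finset.Icc 4 L).card = (Finset.Icc 5 L).card + 1 := by
    rw [Icc_four_eq_insert hL, Finset.card_insert_of_notMem (by simp)]
  simp only [smul_zero, Pi.zero_apply, add_zero] at h3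
  rw [kernel_base_eq hL h23 h2 h0, h1, h3, kernel_consVar_one, h4, pow_succ, scaleFactor, sOneFourToL,
    add_comm (∑ k ∈ Finset.Icc 4 L, s 1 k)]
  field_simp

theorem ofReal_norm_rpow_card {κ : Type} [Fintype κ] (c : ℂ) :
    ((‖c‖ ^ (-(2 * Fintype.card κ : ℝ)) : ℝ) : ℂ) = (1 / (c * conj c)) ^ Fintype.card κ := by
  rw [mul_conj, normSq_eq_norm_sq, Real.rpow_neg (norm_nonneg _)]
  rw [show (2 * (Fintype.card κ : ℝ)) = ((2 * Fintype.card κ : ℕ) : ℝ) by push_cast; ring,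
    Real.rpow_natCast, pow_mul]
  push_cast
  rw [one_div, inv_pow]

theorem integral_consVar_right (hL : 4 ≤ L) (h23 : ∀ k ∈ Finset.Icc 4 L, i k ≠ 2 ∧ i k ≠ 3) {c : ℂ} (h0 : c ≠ 0) :
    ∫ y, selbergKernel L i s 0 0 (fun k => if k = 3 then 1 else 0) (consVar hL (c, y)) =
      scaleFactor (sOneFourToL L s) c * ∫ y, zeroLimitReducedIntegrand L i s y := by
  have h := integral_comp_const_smul c h0
    fun y => selbergKernel L i s 0 0 (fun k => if k = 3 then 1 else 0) (consVar hL (c, y))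
  simp only [kernel_smul_consVar hL h23 h0] at h
  rw [integral_const_mul, ofReal_norm_rpow_card, Fintype.card_coe, mul_assoc] at h
  have hc : conj c ≠ 0 := by simpa using h0
  exact (mul_left_cancel₀ (pow_ne_zero _ (one_div_ne_zero (mul_ne_zero h0 hc))) h).symm

theorem lintegral_consVar_right (hL : 4 ≤ L) (h23 : ∀ k ∈ Finset.Icc 4 L, i k ≠ 2 ∧ i k ≠ 3) {c : ℂ} (h0 : c ≠ 0) :
    ∫⁻ y, ‖selbergKernel L i s 0 0 (fun k => if k = 3 then 1 else 0) (consVar hL (c, y))‖ₑ =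
      ‖scaleFactor (sOneFourToL L s) c‖ₑ * ∫⁻ y, ‖zeroLimitReducedIntegrand L i s y‖ₑ := by
  have h := lintegral_comp_const_smul c h0
    fun y => ‖selbergKernel L i s 0 0 (fun k => if k = 3 then 1 else 0) (consVar hL (c, y))‖ₑ
  have hn : 0 < ‖c‖ := norm_pos_iff.2 h0
  have hpos : 0 < ‖c‖ ^ (-(2 * Fintype.card (Finset.Icc 5 L) : ℝ)) := by positivity
  have e : ‖(1 / (c * conj c)) ^ (Finset.Icc 5 L).card‖ₑ =
      ENNReal.ofReal (‖c‖ ^ (-(2 * Fintype.card (Finset.Icc 5 L) : ℝ))) := by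
    have := ofReal_norm_rpow_card (κ := Finset.Icc 5 L) c
    rw [Fintype.card_coe] at this ⊢
    rw [← this, ← ofReal_norm, Complex.norm_real, Real.norm_of_nonneg]
    rw [Fintype.card_coe] at hpos
    exact hpos.le
  simp only [kernel_smul_consVar hL h23 h0, enorm_mul, e] at h
  simp only [mul_assoc] at h
  rw [lintegral_const_mul' _ _ ENNReal.ofReal_ne_top, lintegral_const_mul' _ _ enorm_ne_top] at h
  exact ((ENNReal.mul_right_inj (by simpa using hpos) ENNReal.ofReal_ne_top).1 h).symm

theorem measurable_zeroLimitReducedIntegrand (hL : 4 ≤ L) : Measurable (zeroLimitReducedIntegrand L i s) := by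
  have : zeroLimitReducedIntegrand L i s = fun y => selbergKernel L i s 0 0 0 (consVar hL (1, y)) :=
    funext fun y => (kernel_consVar_one hL y).symm
  rw [this]
  exact (measurable_selbergKernel _).comp ((consVar hL).measurable.comp (measurable_const.prodMk measurable_id))

/-- By Tonelli the integral of the modulus is a product of a scale integral and a reduced integral.
It is finite and nonzero, so both factors are finite; this gives convergence of the reduced integral
and legitimizes Fubini. -/
theorem integral_kernel_zero_eq_reduced (hL : 4 ≤ L) (hi : ∀ k ∈ Finset.Icc 4 L, i k ∈ Finset.Icc 1 L ∧ i k ≠ k)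
    (h23 : ∀ k ∈ Finset.Icc 4 L, i k ≠ 2 ∧ i k ≠ 3) (hS : 0 < (sOneFourToL L s).re)
    (hint : Integrable (selbergKernel L i s 0 0 (fun k => if k = 3 then 1 else 0))) :
    Integrable (zeroLimitReducedIntegrand L i s) ∧
      ∫ x, selbergKernel L i s 0 0 (fun k => if k = 3 then 1 else 0) x =
        -Real.pi / sOneFourToL L s * ∫ y, zeroLimitReducedIntegrand L i s y := by
  have hmp := measurePreserving_consVar hL
  have hm := measurable_selbergKernel (L := L) (i := i) (s := s) (σ₂ := 0) (σ₃ := 0) fun k => if k = 3 then 1 else 0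
  have hprod : ∫⁻ x, ‖selbergKernel L i s 0 0 (fun k => if k = 3 then 1 else 0) x‖ₑ =
      (∫⁻ c, ‖scaleFactor (sOneFourToL L s) c‖ₑ) * ∫⁻ y, ‖zeroLimitReducedIntegrand L i s y‖ₑ := by
    have hm2 : Measurable fun q => ‖selbergKernel L i s 0 0 (fun k => if k = 3 then 1 else 0) (consVar hL q)‖ₑ :=
      (hm.comp (consVar hL).measurable).enorm
    rw [← hmp.lintegral_comp hm.enorm, Measure.volume_eq_prod, lintegral_prod _ hm2.aemeasurable,
      ← lintegral_mul_const _ (measurable_scaleFactor _).enorm]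
    refine lintegral_congr_ae ?_
    filter_upwards [ae_ne 0] with c hc
    exact lintegral_consVar_right hL h23 hc
  have hne : ∫⁻ x, ‖selbergKernel L i s 0 0 (fun k => if k = 3 then 1 else 0) x‖ₑ ≠ 0 := by
    rw [lintegral_eq_zero_iff hm.enorm |>.ne]
    intro h
    replace h : ∀ᵐ x, ‖selbergKernel L i s 0 0 (fun k => if k = 3 then 1 else 0) x‖ₑ = 0 := h
    have hpos := coll_pos_ae (e := pairExp L i s)
      (g := fun k z => ‖z‖ ^ zeroExp L i s k * ‖z - 1‖ ^ (threeExp L i 0 k + 2 * ((0 : ℕ → ℂ) k).re))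
      (pairExp_self hi) (fun k => by
        filter_upwards [ae_ne 0, ae_ne 1] with z h0 h1
        have a0 := norm_pos_iff.2 h0
        have a1 := norm_pos_iff.2 (sub_ne_zero.2 h1)
        positivity)
    obtain ⟨x, hx1, hx2, hx3⟩ := (h.and (hpos.and (ae_norm_kernel_zero hL hi (fun k hk => (h23 k hk).1) 0))).exists
    have : ‖selbergKernel L i s 0 0 (fun k => if k = 3 then 1 else 0) x‖ = 0 := by
      simpa using hx1
    rw [← hx3, this] at hx2
    exact lt_irrefl _ hx2
  have hfin := hint.2.ne
  rw [hprod] at hne hfin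
  have hA0 := left_ne_zero_of_mul hne
  have hB0 := right_ne_zero_of_mul hne
  have hA : Integrable (scaleFactor (sOneFourToL L s)) := by
    refine ⟨(measurable_scaleFactor _).aestronglyMeasurable, lt_top_iff_ne_top.2 fun h => hfin ?_⟩
    rw [h, ENNReal.top_mul hB0]
  have hB : Integrable (zeroLimitReducedIntegrand L i s) := by
    refine ⟨(measurable_zeroLimitReducedIntegrand hL).aestronglyMeasurable, lt_top_iff_ne_top.2 fun h => hfin ?_⟩
    rw [h, ENNReal.mul_top hA0]
  refine ⟨hB, ?_⟩
  rw [← integral_scaleFactor hS hA, ← integral_mul_const,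
    ← hmp.integral_comp (consVar hL).measurableEmbedding, Measure.volume_eq_prod, integral_prod]
  · refine integral_congr_ae ?_
    filter_upwards [ae_ne 0] with c hc
    exact integral_consVar_right hL h23 hc
  · exact (hmp.integrable_comp_emb (consVar hL).measurableEmbedding).2 hint

/-! ### The iterated limits. -/

theorem hasPhysicalLimit_zero (hL : 4 ≤ L) (hi : ∀ k ∈ Finset.Icc 4 L, i k ∈ Finset.Icc 1 L ∧ i k ≠ k)
    (hs2 : ∀ k ∈ Finset.Icc 4 L, 0 < (s 2 k).re)
    (hconv : ∀ᶠ t in physicalFilter L, ∀ z₃ : ℂ, z₃ ≠ 0 → z₃ ≠ 1 →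
      Integrable (selbergIntegrand L i (withThree s t) z₃))
    {f : (ℕ → ℂ) → (Finset.Icc 4 L → ℂ) → ℂ} (hf : ∀ t, Measurable (f t))
    (hlim : ∀ t, ∀ᵐ x, Tendsto (fun ζ => scaledKernel L i s t ζ x) (𝓝[≠] 0) (𝓝 (f t x)))
    {c : ℂ} (hc : Tendsto (fun t => ∫ x, f t x) (physicalFilter L) (𝓝 c)) :
    HasPhysicalLimit L 0
      (fun t z₃ => absPow z₃ (-sMax L (withThree s t)) * closedSelberg L i (withThree s t) z₃)
      (1 / (-2 * Real.pi * I) ^ (L - 3) * ((2 * I) ^ (Finset.Icc 4 L).card * c)) := by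
  refine ⟨fun t => 1 / (-2 * Real.pi * I) ^ (L - 3) * ((2 * I) ^ (Finset.Icc 4 L).card * ∫ x, f t x), ?_,
    Tendsto.const_mul _ (Tendsto.const_mul _ hc)⟩
  filter_upwards [eventually_stablyAdmissible hconv] with t ht
  have h1 := (ht.1.tendsto_scaledKernel hL hi hs2 ht.2.2 (hf t) (hlim t)).2
  -- Of the factors outside the integral, `|ζ|^{2 s_max}` is removed by the normalization and this
  -- one tends to `1`.
  have h2 : Tendsto (fun ζ : ℂ => absPow (1 - ζ) (t 2)) (𝓝[≠] 0) (𝓝 1) := by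
    have h3 : Tendsto (fun ζ : ℂ => 1 - ζ) (𝓝 0) (𝓝 (1 - 0)) := (continuous_const.sub continuous_id).tendsto 0
    have h4 := tendsto_absPow h3 (by simp) (t 2)
    rw [sub_zero, absPow_of_norm_eq_one norm_one] at h4
    exact h4.mono_left nhdsWithin_le_nhds
  have h5 := ((h2.mul h1).const_mul ((2 * I) ^ (Finset.Icc 4 L).card)).const_mul (1 / (-2 * Real.pi * I) ^ (L - 3))
  rw [one_mul] at h5
  refine h5.congr' ?_
  filter_upwards [self_mem_nhdsWithin] with ζ hζ
  have h6 : absPow ζ (-sMax L (withThree s t)) * absPow ζ (sMax L (withThree s t)) = 1 := by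
    rw [← absPow_add hζ, neg_add_cancel, absPow_zero_right]
  rw [closedSelberg, formIntegral, integral_selbergIntegrand_eq hL hζ]
  linear_combination (-(1 / (-2 * Real.pi * I) ^ (L - 3) * ((2 * I) ^ (Finset.Icc 4 L).card *
    (absPow (1 - ζ) (t 2) * ∫ x, scaledKernel L i s t ζ x)))) * h6

theorem hasPhysicalLimit_one (hL : 4 ≤ L) (hi : ∀ k ∈ Finset.Icc 4 L, i k ∈ Finset.Icc 1 L ∧ i k ≠ k)
    (hs : ∀ a b : ℕ, 4 ≤ a → a < b → b ≤ L → 0 < (s a b).re) (hs2 : ∀ k ∈ Finset.Icc 4 L, 0 < (s 2 k).re)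
    (hconv : ∀ᶠ t in physicalFilter L, ∀ z₃ : ℂ, z₃ ≠ 0 → z₃ ≠ 1 →
      Integrable (selbergIntegrand L i (withThree s t) z₃)) :
    Integrable (oneLimitIntegrand L i s) ∧ HasPhysicalLimit L 1
      (fun t z₃ => absPow (1 - z₃) (-(withThree s t) 2 3) * closedSelberg L i (withThree s t) z₃)
      (1 / (-2 * Real.pi * I) ^ (L - 3) * formIntegral 4 L (oneLimitIntegrand L i s)) := by
  have h := outer_limit_one hL hi hs hs2 hconv
  rw [oneLimitIntegrand_eq]
  refine ⟨h.1, fun t => 1 / (-2 * Real.pi * I) ^ (L - 3) * ((2 * I) ^ (Finset.Icc 4 L).card *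
    ∫ x, selbergKernel L i s (s 2) t (selbergBase 1) x), ?_, Tendsto.const_mul _ (Tendsto.const_mul _ h.2)⟩
  filter_upwards [eventually_stablyAdmissible hconv] with t ht
  have h1 := (ht.1.tendsto_kernel_one hL hi hs hs2 ht.2.1).2
  have hid : Tendsto (fun z : ℂ => z) (𝓝[≠] 1) (𝓝 1) := nhdsWithin_le_nhds
  have h2 := tendsto_absPow hid one_ne_zero (t 1)
  rw [absPow_of_norm_eq_one norm_one] at h2
  have h3 : Tendsto (fun z : ℂ => conj z) (𝓝[≠] 1) (𝓝 1) := by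
    have := (continuous_conj.tendsto (1 : ℂ)).comp hid
    rwa [map_one] at this
  have h5 := (((h3.mul h2).mul h1).const_mul ((2 * I) ^ (Finset.Icc 4 L).card)).const_mul
    (1 / (-2 * Real.pi * I) ^ (L - 3))
  rw [one_mul, one_mul] at h5
  refine h5.congr' ?_
  filter_upwards [self_mem_nhdsWithin] with z hz
  have h6 : absPow (1 - z) (-t 2) * absPow (1 - z) (t 2) = 1 := by
    rw [← absPow_add (sub_ne_zero.2 (Ne.symm hz)), neg_add_cancel, absPow_zero_right]
  have h7 : withThree s t 2 3 = t 2 := by simp [withThree]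
  rw [closedSelberg, formIntegral, h7]
  simp only [selbergIntegrand_eq hL]
  rw [integral_const_mul]
  linear_combination (-(1 / (-2 * Real.pi * I) ^ (L - 3) * ((2 * I) ^ (Finset.Icc 4 L).card *
    (conj z * absPow z (t 1) * ∫ x, selbergKernel L i s (s 2) t (selbergBase z) x)))) * h6

end

theorem mainTheorem5 (L : ℕ) (hL : 4 ≤ L) (i : ℕ → ℕ)
    (hi : ∀ k ∈ Finset.Icc 4 L, i k ∈ Finset.Icc 1 L ∧ i k ≠ k)
    (s : ℕ → ℕ → ℂ)
    (hs : ∀ a b : ℕ, 1 ≤ a → a < b → 4 ≤ b → b ≤ L → a ≠ 3 → 0 < (s a b).re)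
    (hconv : ∀ᶠ t in physicalFilter L, ∀ z₃ : ℂ, z₃ ≠ 0 → z₃ ≠ 1 →
      Integrable (selbergIntegrand L i (withThree s t) z₃)) :
    -- the limit at 0, no index equal to 2
    ((∀ k ∈ Finset.Icc 4 L, i k ≠ 2) →
      (Integrable (zeroLimitIntegrand L i s) ↔ i 4 ≠ 3) ∧
      (i 4 ≠ 3 → HasPhysicalLimit L 0
        (fun t z₃ => absPow z₃ (-sMax L (withThree s t)) * closedSelberg L i (withThree s t) z₃)
        (1 / (-2 * Real.pi * I) ^ (L - 3) * formIntegral 4 L (zeroLimitIntegrand L i s)))) ∧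
    -- the limit at 0, some index equal to 2
    ((∃ k ∈ Finset.Icc 4 L, i k = 2) →
      HasPhysicalLimit L 0
        (fun t z₃ => absPow z₃ (-sMax L (withThree s t)) * closedSelberg L i (withThree s t) z₃)
        0) ∧
    -- the limit at 0, no index equal to 2 or 3
    ((∀ k ∈ Finset.Icc 4 L, i k ≠ 2 ∧ i k ≠ 3) →
      Integrable (zeroLimitReducedIntegrand L i s) ∧
      HasPhysicalLimit L 0
        (fun t z₃ => absPow z₃ (-sMax L (withThree s t)) * closedSelberg L i (withThree s t) z₃)
        (1 / sOneFourToL L s * (1 / (-2 * Real.pi * I) ^ (L - 4)) *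
          formIntegral 5 L (zeroLimitReducedIntegrand L i s))) ∧
    -- the limit at 1
    (Integrable (oneLimitIntegrand L i s) ∧
      HasPhysicalLimit L 1
        (fun t z₃ => absPow (1 - z₃) (-(withThree s t) 2 3) *
          closedSelberg L i (withThree s t) z₃)
        (1 / (-2 * Real.pi * I) ^ (L - 3) * formIntegral 4 L (oneLimitIntegrand L i s))) := by
  have hs4 : ∀ a b : ℕ, 4 ≤ a → a < b → b ≤ L → 0 < (s a b).re := fun a b h1 h2 h3 =>
    hs a b (by omega) h2 (by omega) h3 (by omega)
  have hs1 : ∀ k ∈ Finset.Icc 4 L, 0 < (s 1 k).re := fun k hk => by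
    rw [Finset.mem_Icc] at hk
    exact hs 1 k le_rfl (by omega) hk.1 hk.2 (by omega)
  have hs2 : ∀ k ∈ Finset.Icc 4 L, 0 < (s 2 k).re := fun k hk => by
    rw [Finset.mem_Icc] at hk
    exact hs 2 k (by omega) (by omega) hk.1 hk.2 (by omega)
  have hlimit (h2 : ∀ k ∈ Finset.Icc 4 L, i k ≠ 2) (h4 : i 4 ≠ 3) :=
    hasPhysicalLimit_zero hL hi hs2 hconv
      (f := fun t => selbergKernel L i s 0 t (fun k => if k = 3 then 1 else 0))
      (fun t => measurable_selbergKernel _)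
      (fun t => Eventually.of_forall fun x => tendsto_scaledKernel_of_ne_two hL h2 x)
      (outer_limit_zero hL hi hs4 hs2 hconv h2 h4).2
  refine ⟨fun h2 => ?_, fun h2 => ?_, fun h23 => ?_, hasPhysicalLimit_one hL hi hs4 hs2 hconv⟩
  · rw [zeroLimitIntegrand_eq]
    exact ⟨⟨fun h h4 => not_integrable_kernel_zero hL hi h2 h4 h,
      fun h4 => (outer_limit_zero hL hi hs4 hs2 hconv h2 h4).1⟩, hlimit h2⟩
  · have h := hasPhysicalLimit_zero hL hi hs2 hconv (f := fun _ _ => 0) (fun _ => measurable_const)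
      (fun t => by
        filter_upwards [ae_generic (L := L) 1 1] with x hx
        exact tendsto_scaledKernel_of_eq_two hL hi h2 ⟨hx.1, hx.2.1, hx.2.2.1⟩)
      (c := 0) (by simpa using tendsto_const_nhds)
    simpa using h
  · have h2 : ∀ k ∈ Finset.Icc 4 L, i k ≠ 2 := fun k hk => (h23 k hk).1
    have h4 : i 4 ≠ 3 := (h23 4 (Finset.mem_Icc.2 ⟨le_rfl, hL⟩)).2
    have hS : 0 < (sOneFourToL L s).re := by
      rw [sOneFourToL, add_re, re_sum, re_sum]
      refine add_pos_of_pos_of_nonneg (Finset.sum_pos hs1 ⟨4, Finset.mem_Icc.2 ⟨le_rfl, hL⟩⟩)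
        (Finset.sum_nonneg fun a ha => ?_)
      rw [re_sum]
      refine Finset.sum_nonneg fun b hb => ?_
      rw [Finset.mem_Icc] at ha
      rw [Finset.mem_Ioc] at hb
      exact (hs4 a b ha.1 hb.1 hb.2).le
    obtain ⟨hint, hval⟩ := integral_kernel_zero_eq_reduced hL hi h23 hS (outer_limit_zero hL hi hs4 hs2 hconv h2 h4).1
    refine ⟨hint, ?_⟩
    have h := hlimit h2 h4
    rw [hval] at h
    have hcard : (Finset.Icc 4 L).card = (Finset.Icc 5 L).card + 1 := by
      rw [Icc_four_eq_insert hL, Finset.card_insert_of_notMem (by simp)]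
    convert h using 1
    -- The variable split off contributes `2 * I` from the form, `1 / (-2 * π * I)` from the
    -- normalization and `-π / S` from the scale integral, with product `1 / S`.
    rw [formIntegral, hcard, show L - 3 = (L - 4) + 1 by omega, pow_succ, pow_succ]
    have hS0 : sOneFourToL L s ≠ 0 := by
      intro h0
      rw [h0] at hS
      simp at hS
    have hπ : (Real.pi : ℂ) ≠ 0 := by exact_mod_cast Real.pi_ne_zero
    have hpow : (-2 * (Real.pi : ℂ) * I) ^ (L - 4) ≠ 0 :=
      pow_ne_zero _ (mul_ne_zero (mul_ne_zero (by norm_num) hπ) I_ne_zero)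
    have hI := I_ne_zero
    field_simp
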